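/- Setting. Let $N\ge 1$, $p\ge 2$ be integers, $b\in\mathbb R$, and let $v=(v_n)_{n\in\mathbb Z}$ be a real $2p$-periodic sequence with $v_1,\dots,v_{2p}$ pairwise distinct. On $\ell^2(\mathbb Z\times\{0,1\}\times\mathbb Z/N)$ let $H^b(t)=H_0^b+tV$ be the Hamiltonian of the zigzag nanotube, $$(H_0^bf)_{n,0,k}=e^{-ib}f_{n-1,1,k}+e^{ib}f_{n-1,1,k-1}+f_{n,1,k},\qquad (H_0^bf)_{n,1,k}=e^{-ib}f_{n+1,0,k+1}+e^{ib}f_{n+1,0,k}+f_{n,0,k},$$ $$(Vf)_{n,0,k}=v_{2n+1}f_{n,0,k},\qquad (Vf)_{n,1,k}=v_{2n+2}f_{n,1,k}.$$ For $k\in\{1,\dots,N\}$ put $c_k=\cos(b+\pi k/N)$, $a_{k,2n}=2|c_k|$, $a_{k,2n+1}=1$, and let $J_k^b(t)$ be the Jacobi operator $(J_k^b(t)y)_n=a_{k,n-1}y_{n-1}+a_{k,n}y_{n+1}+tv_ny_n$ on $\ell^2(\mathbb Z)$. Let $z_{k,0}^+(t)\le z_{k,1}^-(t)\le z_{k,1}^+(t)\le\dots\le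 z_{k,2p}^-(t)$ be its $2p$-periodic and $2p$-antiperiodic eigenvalues, counted with multiplicity, and let $\sigma_{k,m}(t)=[z_{k,m-1}^+(t),z_{k,m}^-(t)]$, $1\le m\le 2p$, be its bands. Let $\alpha$ be the permutation of $\{1,\dots,2p\}$ with $v_{\alpha(1)}<\dots<v_{\alpha(2p)}$, and $\tilde n=\alpha^{-1}(n)$. Put $h_m=v_{\alpha(m)}$, $h_m^0=(h_m+h_{m+1})/2$ for $1\le m<2p$, $h_0^0=-\infty$, $h_{2p}^0=+\infty$, and $\mathcal C_m(t)=[th_{m-1}^0,th_m^0)$ (intersected with $\mathbb R$). Put $$C_{k,n}=\frac{a_{k,n-1}^2}{v_{n-1}-v_n}+\frac{a_{k,n}^2}{v_{n+1}-v_n},\qquad E_{k,n}=\frac1{4|2c_k|^p}\prod_{1\le j\le 2p,\ j\ne n}|v_n-v_j| .$$ Theorem. (1) If $c_k\neq0$, then for every $n\in\{1,\dots,2p\}$, as $t\to\infty$, $$z_{k,\tilde n-1}^{+}(t)=tv_n-\frac{C_{k,n}+O(t^{-1})}{t},\qquad z_{k,\tilde n}^{-}(t)-z_{k,\tilde n-1}^{+}(t)=\frac{1+O(t^{-1})}{E_{k,n}\,t^{2p-1}}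 .$$ (2) For all sufficiently large $t$ and all $n\in\{1,\dots,2p\}$, $$\sigma(H^b(t))\cap\mathcal C_{\tilde n}(t)=\bigcup_{k=1}^N\sigma_{k,\tilde n}(t).$$ Moreover, if $\delta>\max_{k,n}|C_{k,n}|$, or if $\delta>\max_n\frac{5}{|v_n-v_{n+1}|}$, then for all sufficiently large $t$ and all $n$ this set is contained in $\left(v_nt-\frac\delta t,\ v_nt+\frac\delta t\right)$. (3) For all sufficiently large $t$, all $n\in\{1,\dots,2p\}$ and all $k,k'\in\{1,\dots,N\}$: $\sigma_{k,\tilde n}(t)\cap\sigma_{k',\tilde n}(t)=\emptyset$ whenever $|c_k|\ne|c_{k'}|$, and also whenever $k\ne k'$ and $b\notin\frac{\pi}{2N}\mathbb Z$. (4) For all sufficiently large $t$, all $n\in\{1,\dots,2p\}$ and all $k\in\{1,\dots,N\}$: if $c_k\ne0$, the spectrum of $H^b(t)$ on $\sigma_{k,\tilde n}(t)$ has uniform multiplicity $2\cdot\#\{k'\in\{1,\dots,N\}:|c_{k'}|=|c_k|\}$, which is $2$ when $b\notin\frac\pi{2N}\mathbb Z$. If $c_k=0$, then $\sigma_{k,\tilde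 n}(t)$ is a flat band: it is a single point, and this point is an eigenvalue of infinite multiplicity of $J_k^b(t)$ and of $H^b(t)$. -/

import Mathlib

open MeasureTheory Filter Asymptotics Set

namespace Nanotube

noncomputable section

/-- The Hilbert space `ℓ²(ι)` of square-summable complex functions. -/
abbrev Ell2 (ι : Type) : Type := lp (fun _ : ι => ℂ) 2

/-- Real bounded two-sided sequences `ℓ^∞(ℤ)`. -/
abbrev EllInfty : Type := lp (fun _ : ℤ => ℝ) ⊤

/-! ### Weighted composition operators on `ℓ²` -/

theorem summable_weighted {ι : Type} (w : ι → ℂ) (C : ℝ) (hw : ∀ i, ‖w i‖ ≤ C) (s : ι ≃ ι)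
    (f : Ell2 ι) :
    Summable (fun i => ‖w i * f (s i)‖ ^ 2) ∧
      ∑' i, ‖w i * f (s i)‖ ^ 2 ≤ C ^ 2 * ‖f‖ ^ 2 := by
  have hf : HasSum (fun i => ‖f i‖ ^ 2) (‖f‖ ^ 2) := by
    have h := lp.hasSum_norm (p := 2) (by norm_num) f
    simpa using h
  have hfs : HasSum (fun i => ‖f (s i)‖ ^ 2) (‖f‖ ^ 2) := (Equiv.hasSum_iff s).2 hf
  have hC := hfs.mul_left (C ^ 2)
  have hle : ∀ i, ‖w i * f (s i)‖ ^ 2 ≤ C ^ 2 * ‖f (s i)‖ ^ 2 := by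
    intro i
    rw [norm_mul, mul_pow]
    have := hw i
    gcongr
  have hs : Summable (fun i => ‖w i * f (s i)‖ ^ 2) :=
    Summable.of_nonneg_of_le (fun i => by positivity) hle hC.summable
  exact ⟨hs, hC.tsum_eq ▸ hs.tsum_le_tsum hle hC.summable⟩

/-- The bounded operator `(T f)_i = w_i f_{s(i)}` on `ℓ²(ι)`, for a bounded weight `w` and a
permutation `s` of the index set. -/
def weighted {ι : Type} (w : ι → ℂ) (s : ι ≃ ι) (hw : ∃ C : ℝ, ∀ i, ‖w i‖ ≤ C) :
    Ell2 ι →L[ℂ] Ell2 ι :=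
  LinearMap.mkContinuousOfExistsBound
    { toFun := fun f => ⟨fun i => w i * f (s i), by
        obtain ⟨C, hC⟩ := hw
        exact memℓp_gen (by simpa using (summable_weighted w C hC s f).1)⟩
      map_add' := fun f g => by
        ext i
        exact mul_add _ _ _
      map_smul' := fun c f => by
        ext i
        exact mul_left_comm _ _ _ }
    (by
      obtain ⟨C, hC⟩ := hw
      refine ⟨|C|, fun f => ?_⟩
      refine lp.norm_le_of_tsum_le (p := 2) (by norm_num) (by positivity) ?_
      have h := (summable_weighted w C hC s f).2
      have : (|C| * ‖f‖) ^ 2 = C ^ 2 * ‖f‖ ^ 2 := by rw [mul_pow, sq_abs]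
      simpa [this] using h)

theorem weighted_apply {ι : Type} (w : ι → ℂ) (s : ι ≃ ι) (hw : ∃ C : ℝ, ∀ i, ‖w i‖ ≤ C)
    (f : Ell2 ι) (i : ι) : weighted w s hw f i = w i * f (s i) := rfl

/-! ### The Hamiltonian of the zigzag nanotube -/

/-- The vertices `(n, j, k) ∈ ℤ × {0,1} × ℤ/N` of the zigzag nanotube. -/
abbrev Vertex (N : ℕ) : Type := ℤ × Fin 2 × ZMod N

/-- The involution exchanging the end points of the edges
`(n, 0, k) ~ (n - d, 1, k - e)` of one of the three families of edges. -/
def edgeFlip (N : ℕ) (d : ℤ) (e : ZMod N) : Vertex N ≃ Vertex N where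
  toFun := fun ω => match ω with
    | (n, 0, k) => (n - d, 1, k - e)
    | (n, 1, k) => (n + d, 0, k + e)
  invFun := fun ω => match ω with
    | (n, 0, k) => (n - d, 1, k - e)
    | (n, 1, k) => (n + d, 0, k + e)
  left_inv := by
    rintro ⟨n, j, k⟩
    fin_cases j <;> simp
  right_inv := by
    rintro ⟨n, j, k⟩
    fin_cases j <;> simp

/-- The Peierls factor: `e^{iβ}` at the vertices with `j = 0`, `e^{-iβ}` at those with `j = 1`. -/
def phase (N : ℕ) (β : ℝ) (ω : Vertex N) : ℂ :=
  if ω.2.1 = 0 then Complex.exp (Complex.I * β) else Complex.exp (-(Complex.I * β))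

theorem phase_bdd (N : ℕ) (β : ℝ) : ∃ C : ℝ, ∀ ω, ‖phase N β ω‖ ≤ C := by
  refine ⟨1, fun ω => ?_⟩
  unfold phase
  split_ifs
  · rw [mul_comm, Complex.norm_exp_ofReal_mul_I]
  · rw [← mul_neg, mul_comm, ← Complex.ofReal_neg, Complex.norm_exp_ofReal_mul_I]

/-- The axial electric potential `V_{n,0,k} = v_{2n+1}`, `V_{n,1,k} = v_{2n+2}`. -/
def potential (N : ℕ) (v : ℤ → ℝ) (ω : Vertex N) : ℝ :=
  if ω.2.1 = 0 then v (2 * ω.1 + 1) else v (2 * ω.1 + 2)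

theorem potential_bdd (N : ℕ) (v : EllInfty) (t : ℝ) :
    ∃ C : ℝ, ∀ ω, ‖((t * potential N v ω : ℝ) : ℂ)‖ ≤ C := by
  refine ⟨|t| * ‖v‖, fun ω => ?_⟩
  rw [Complex.norm_real, norm_mul, Real.norm_eq_abs t]
  gcongr
  unfold potential
  split_ifs
  · exact lp.norm_apply_le_norm ENNReal.top_ne_zero v _
  · exact lp.norm_apply_le_norm ENNReal.top_ne_zero v _

/-- The tight-binding Hamiltonian `H^b(t) = H_0^b + t V` on `ℓ²(ℤ × {0,1} × ℤ/N)`.  Its pointwise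
form is spelled out in the two theorems that follow. -/
def hamiltonian (N : ℕ) (b : ℝ) (v : EllInfty) (t : ℝ) : Ell2 (Vertex N) →L[ℂ] Ell2 (Vertex N) :=
  weighted (phase N (-b)) (edgeFlip N 1 0) (phase_bdd N (-b)) +
    weighted (phase N b) (edgeFlip N 1 1) (phase_bdd N b) +
    weighted (phase N 0) (edgeFlip N 0 0) (phase_bdd N 0) +
    weighted (fun ω => ((t * potential N v ω : ℝ) : ℂ)) (Equiv.refl _) (potential_bdd N v t)

theorem hamiltonian_apply_zero (N : ℕ) (b : ℝ) (v : EllInfty) (t : ℝ) (f : Ell2 (Vertex N))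
    (n : ℤ) (k : ZMod N) :
    hamiltonian N b v t f (n, 0, k) =
      Complex.exp (-(Complex.I * b)) * f (n - 1, 1, k) +
        Complex.exp (Complex.I * b) * f (n - 1, 1, k - 1) + f (n, 1, k) +
        ((t * v (2 * n + 1) : ℝ) : ℂ) * f (n, 0, k) := by
  have h : hamiltonian N b v t f (n, 0, k) =
      phase N (-b) (n, 0, k) * f (n - 1, 1, k - 0) + phase N b (n, 0, k) * f (n - 1, 1, k - 1) +
        phase N 0 (n, 0, k) * f (n - 0, 1, k - 0) +
        ((t * potential N v (n, 0, k) : ℝ) : ℂ) * f (n, 0, k) := rfl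
  rw [h]
  simp [phase, potential]

theorem hamiltonian_apply_one (N : ℕ) (b : ℝ) (v : EllInfty) (t : ℝ) (f : Ell2 (Vertex N))
    (n : ℤ) (k : ZMod N) :
    hamiltonian N b v t f (n, 1, k) =
      Complex.exp (-(Complex.I * b)) * f (n + 1, 0, k + 1) +
        Complex.exp (Complex.I * b) * f (n + 1, 0, k) + f (n, 0, k) +
        ((t * v (2 * n + 2) : ℝ) : ℂ) * f (n, 1, k) := by
  have h : hamiltonian N b v t f (n, 1, k) =
      phase N (-b) (n, 1, k) * f (n + 1, 0, k + 0) + phase N b (n, 1, k) * f (n + 1, 0, k + 1) +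
        phase N 0 (n, 1, k) * f (n + 0, 0, k + 0) +
        ((t * potential N v (n, 1, k) : ℝ) : ℂ) * f (n, 1, k) := rfl
  rw [h]
  simp [phase, potential]
  ring

/-! ### The Jacobi operators and their spectral bands -/

/-- `c_k = cos (b + π k / N)`. -/
def cCoef (N : ℕ) (b : ℝ) (k : ℕ) : ℝ := Real.cos (b + Real.pi * k / N)

/-- The off-diagonal coefficients `a_{k,2n} = 2 |c_k|`, `a_{k,2n+1} = 1`. -/
def aCoef (N : ℕ) (b : ℝ) (k : ℕ) (n : ℤ) : ℝ := if Even n then 2 * |cCoef N b k| else 1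

theorem aCoef_bdd (N : ℕ) (b : ℝ) (k : ℕ) (d : ℤ) :
    ∃ C : ℝ, ∀ n : ℤ, ‖((aCoef N b k (n - d) : ℝ) : ℂ)‖ ≤ C := by
  refine ⟨2, fun n => ?_⟩
  rw [Complex.norm_real, Real.norm_eq_abs]
  unfold aCoef
  split_ifs
  · rw [abs_mul, abs_abs, abs_two]
    have := Real.abs_cos_le_one (b + Real.pi * k / N)
    unfold cCoef
    linarith
  · norm_num

theorem mulPot_bdd (v : EllInfty) (t : ℝ) : ∃ C : ℝ, ∀ n : ℤ, ‖((t * v n : ℝ) : ℂ)‖ ≤ C := by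
  refine ⟨|t| * ‖v‖, fun n => ?_⟩
  rw [Complex.norm_real, norm_mul, Real.norm_eq_abs t]
  gcongr
  exact lp.norm_apply_le_norm ENNReal.top_ne_zero v _

/-- The Jacobi operator `J_k^b(t)` on `ℓ²(ℤ)`,
`(J y)_n = a_{n-1} y_{n-1} + a_n y_{n+1} + t v_n y_n`. -/
def jacobi (N : ℕ) (b : ℝ) (v : EllInfty) (t : ℝ) (k : ℕ) : Ell2 ℤ →L[ℂ] Ell2 ℤ :=
  weighted (fun n => ((aCoef N b k (n - 1) : ℝ) : ℂ)) (Equiv.subRight 1) (aCoef_bdd N b k 1) +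
    weighted (fun n => ((aCoef N b k (n - 0) : ℝ) : ℂ)) (Equiv.addRight 1) (aCoef_bdd N b k 0) +
    weighted (fun n => ((t * v n : ℝ) : ℂ)) (Equiv.refl _) (mulPot_bdd v t)

theorem jacobi_apply (N : ℕ) (b : ℝ) (v : EllInfty) (t : ℝ) (k : ℕ) (y : Ell2 ℤ) (n : ℤ) :
    jacobi N b v t k y n =
      (aCoef N b k (n - 1) : ℂ) * y (n - 1) + (aCoef N b k n : ℂ) * y (n + 1) +
        ((t * v n : ℝ) : ℂ) * y n := by
  have h : jacobi N b v t k y n =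
      (aCoef N b k (n - 1) : ℂ) * y (n - 1) + (aCoef N b k (n - 0) : ℂ) * y (n + 1) +
        ((t * v n : ℝ) : ℂ) * y n := rfl
  rw [h, sub_zero]

/-- The `m × m` matrix of `a_{n-1} y_{n-1} + a_n y_{n+1} + u_n y_n`, `n = 1, …, m`, acting on
sequences with `y_{n+m} = τ y_n` (the row and column `i : Fin m` stand for the site `i + 1`). -/
def floquetMatrix (m : ℕ) (a u : ℤ → ℝ) (τ : ℝ) : Matrix (Fin m) (Fin m) ℝ := fun i j =>
  (if i = j then u ((i : ℕ) + 1) else 0) +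
    (if (j : ℕ) = i + 1 then a ((i : ℕ) + 1) else 0) +
    (if (i : ℕ) = j + 1 then a (i : ℕ) else 0) +
    (if (i : ℕ) = 0 ∧ (j : ℕ) + 1 = m then τ⁻¹ * a 0 else 0) +
    (if (i : ℕ) + 1 = m ∧ (j : ℕ) = 0 then τ * a m else 0)

/-- The `2p`-periodic and `2p`-antiperiodic (together: `4p`-periodic) eigenvalues of
`a_{n-1} y_{n-1} + a_n y_{n+1} + t v_n y_n = z y_n`, with multiplicities, in increasing order:
`z_0^+ ≤ z_1^- ≤ z_1^+ ≤ z_2^- ≤ … ≤ z_{2p}^-`. -/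
def bandEdges (N p : ℕ) (b : ℝ) (v : ℤ → ℝ) (t : ℝ) (k : ℕ) : List ℝ :=
  ((floquetMatrix (2 * p) (aCoef N b k) (fun n => t * v n) 1).charpoly.roots +
    (floquetMatrix (2 * p) (aCoef N b k) (fun n => t * v n) (-1)).charpoly.roots).sort (· ≤ ·)

/-- The left end point `z_{m}^+` of the band number `m + 1`, `m = 0, …, 2p - 1`. -/
def bandLeft (N p : ℕ) (b : ℝ) (v : ℤ → ℝ) (t : ℝ) (k m : ℕ) : ℝ :=
  (bandEdges N p b v t k).getD (2 * m) 0

/-- The right end point `z_{m+1}^-` of the band number `m + 1`, `m = 0, …, 2p - 1`. -/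
def bandRight (N p : ℕ) (b : ℝ) (v : ℤ → ℝ) (t : ℝ) (k m : ℕ) : ℝ :=
  (bandEdges N p b v t k).getD (2 * m + 1) 0

/-- The band number `m + 1` of `J_k^b(t)`, `m = 0, …, 2p - 1`. -/
def band (N p : ℕ) (b : ℝ) (v : ℤ → ℝ) (t : ℝ) (k m : ℕ) : Set ℝ :=
  Icc (bandLeft N p b v t k m) (bandRight N p b v t k m)

/-! ### The constants and the clusters -/

/-- `C_{k,n} = a_{k,n-1}² / (v_{n-1} - v_n) + a_{k,n}² / (v_{n+1} - v_n)`. -/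
def shiftC (N : ℕ) (b : ℝ) (v : ℤ → ℝ) (k : ℕ) (n : ℤ) : ℝ :=
  aCoef N b k (n - 1) ^ 2 / (v (n - 1) - v n) + aCoef N b k n ^ 2 / (v (n + 1) - v n)

/-- `E_{k,n} = (4 |2 c_k|^p)⁻¹ ∏_{j ≠ n} |v_n - v_j|`, where `n, j` run over the sites
`1, …, 2p` (`i : Fin (2 * p)` stands for the site `i + 1`). -/
def widthE (N p : ℕ) (b : ℝ) (v : ℤ → ℝ) (k : ℕ) (n : Fin (2 * p)) : ℝ :=
  (1 / (4 * |2 * cCoef N b k| ^ p)) *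
    ∏ j ∈ Finset.univ.erase n, |v ((n : ℕ) + 1) - v ((j : ℕ) + 1)|

/-- The interval `[t h⁰_m, t h⁰_{m+1})`, where `h_1 < … < h_{2p}` are the values `v_1, …, v_{2p}`
in increasing order (`h_{i+1} = v_{α(i)+1}`), `h⁰_j = (h_j + h_{j+1}) / 2` for `0 < j < 2p`,
`h⁰_0 = -∞` and `h⁰_{2p} = ∞`. -/
def clusterInterval (p : ℕ) (v : ℤ → ℝ) (α : Equiv.Perm (Fin (2 * p))) (t : ℝ)
    (m : Fin (2 * p)) : Set ℝ :=
  {x | (∀ i : Fin (2 * p), (i : ℕ) + 1 = m →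
          t * ((v ((α i : ℕ) + 1) + v ((α m : ℕ) + 1)) / 2) ≤ x) ∧
       (∀ i : Fin (2 * p), (i : ℕ) = m + 1 →
          x < t * ((v ((α m : ℕ) + 1) + v ((α i : ℕ) + 1)) / 2))}

/-! ### Spectrum, spectral multiplicity, flat bands -/

section Spectral

variable {E : Type} [NormedAddCommGroup E] [InnerProductSpace ℂ E]

/-- The real points of the spectrum (all of the spectrum, when `T` is self-adjoint). -/
def realSpectrum (T : E →L[ℂ] E) : Set ℝ := {x | (x : ℂ) ∈ spectrum ℂ T}

/-- `μ` is the spectral measure of the vector `u` for the bounded self-adjoint operator `T`: the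
compactly supported finite measure with moments `⟨u, Tⁿ u⟩`. -/
def IsSpectralMeasure (T : E →L[ℂ] E) (u : E) (μ : Measure ℝ) : Prop :=
  IsFiniteMeasure μ ∧ (∃ R : ℝ, μ (Icc (-R) R)ᶜ = 0) ∧
    ∀ n : ℕ, inner ℂ u ((T ^ n) u) = ((∫ x, x ^ n ∂μ : ℝ) : ℂ)

/-- The range of the spectral projection of the bounded self-adjoint operator `T` on the Borel
set `S`: the vectors whose spectral measure is carried by `S`. -/
def spectralSubspace (T : E →L[ℂ] E) (S : Set ℝ) : Set E :=
  {u | ∃ μ : Measure ℝ, IsSpectralMeasure T u μ ∧ μ Sᶜ = 0}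

/-- The spectrum of the bounded self-adjoint operator `T` on the Borel set `S` has (uniform)
multiplicity `m`: the part of `T` in the spectral subspace of `S` is unitarily equivalent to
multiplication by `x` in `L²(μ; ℂ^m)` for a nonzero finite measure `μ` carried by `S`. -/
def HasSpectralMultiplicity (T : E →L[ℂ] E) (S : Set ℝ) (m : ℕ) : Prop :=
  ∃ μ : Measure ℝ, IsFiniteMeasure μ ∧ μ ≠ 0 ∧ μ Sᶜ = 0 ∧
    ∃ U : Lp (EuclideanSpace ℂ (Fin m)) 2 μ →ₗᵢ[ℂ] E,
      range U = spectralSubspace T S ∧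
      ∀ f g : Lp (EuclideanSpace ℂ (Fin m)) 2 μ,
        (∀ᵐ x ∂μ, g x = (x : ℂ) • f x) → T (U f) = U g

/-- `S` is a flat band of `T`: a single point that is an eigenvalue of infinite multiplicity. -/
def IsFlatBand (T : E →L[ℂ] E) (S : Set ℝ) : Prop :=
  ∃ x : ℝ, S = {x} ∧
    ¬ FiniteDimensional ℂ (Module.End.eigenspace (T : E →ₗ[ℂ] E) (x : ℂ))

end Spectral

end

end Nanotube

/-! A Fourier transform in the angular variable, followed by a longitudinal gauge change, turns the
Hamiltonian into the orthogonal sum of the `N` channels `jacobi N b v t k` (`hamiltonian_tubeU`,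
`tubeU_complete`). Each channel is `2p`-periodic, so Bloch theory reduces it to the Floquet matrices
`A_τ` with `|τ| = 1`. Expanding in the two corner entries gives `det (z - A_τ) = det (z - A_1) + P
(2 - τ - τ⁻¹)` with `P = ∏ a = |2 c_k|^p` (`det_sub_cycMatrix`), so the quasi-momentum enters only
through its cosine `x`.

For large `t` the Gershgorin discs around the values `t v_n` are far apart. Hence for every `x ∈
[-1, 1]` there is exactly one level near each `t v_n`. It is Lipschitz and monotone in `x`, and a
column of an adjugate matrix gives an eigenvector that is continuous and nowhere zero on the whole
circle. This yields a `DiagModel`: the operator becomes an orthogonal sum of multiplications by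
continuous even functions `l` on `L²(ℝ/ℤ)`. The spectral claims are read off from it. The spectrum
is the union of the ranges of the band functions. If `P ≠ 0`, the cosine is a function of `l`, and
splitting `L²` of the circle into even and odd functions gives multiplicity two per band function.
If `P = 0`, the band functions are constant, which gives flat bands.

The asymptotics have two sources. Second-order perturbation theory, made quantitative row by row on
the eigenvector equation, gives the term `C_{k,n} / t` with error `O(t⁻²)` (`level_shift`). The
width follows from an exact identity: the difference of level `n` at `x = 1` and at `x = -1`, times
the product of its distances to the other levels, equals `4P` up to sign (`level_sub_mul_prod`).
Different values of `|c_k|` give different constants `C_{k,n}`, so the corresponding bands separate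
at scale `1/t`, which dominates the error. -/

namespace Nanotube
noncomputable section

open AddCircle

/-! ### Multiplication operators on `L²` of the circle -/

/-- `L²` of the circle `ℝ/ℤ`. -/
abbrev CircL2 : Type := Lp ℂ 2 (haarAddCircle : Measure UnitAddCircle)

theorem memLp_mul_circL2 (w : C(UnitAddCircle, ℂ)) (f : CircL2) :
    MemLp (fun θ => w θ * f θ) 2 (haarAddCircle : Measure UnitAddCircle) := by
  refine MemLp.of_le_mul (c := ‖w‖) (Lp.memLp f) ?_ ?_
  · exact w.continuous.aestronglyMeasurable.mul (Lp.aestronglyMeasurable f)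
  · refine Eventually.of_forall fun θ => ?_
    rw [norm_mul]
    gcongr
    exact w.norm_coe_le_norm θ

/-- Multiplication by a continuous function on `L²` of the circle. -/
def mulC (w : C(UnitAddCircle, ℂ)) (f : CircL2) : CircL2 := (memLp_mul_circL2 w f).toLp _

theorem mulC_ae (w : C(UnitAddCircle, ℂ)) (f : CircL2) :
    mulC w f =ᵐ[haarAddCircle] fun θ => w θ * f θ := MemLp.coeFn_toLp _

/-- A real continuous function, viewed as a complex one. -/
def ofRealC (l : C(UnitAddCircle, ℝ)) : C(UnitAddCircle, ℂ) :=
  ⟨fun θ => (l θ : ℂ), Complex.continuous_ofReal.comp l.continuous⟩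

@[simp] theorem ofRealC_apply (l : C(UnitAddCircle, ℝ)) (θ : UnitAddCircle) :
    ofRealC l θ = (l θ : ℂ) := rfl

theorem inner_mulC (w : C(UnitAddCircle, ℂ)) (f g : CircL2) :
    inner ℂ f (mulC w g) = ∫ θ, w θ * (inner ℂ (f θ) (g θ)) ∂haarAddCircle := by
  rw [L2.inner_def]
  refine integral_congr_ae ?_
  filter_upwards [mulC_ae w g] with θ h
  rw [h, RCLike.inner_apply, RCLike.inner_apply]
  ring

theorem norm_sq_circL2 {α : Type} [MeasurableSpace α] {μ : Measure α} (f : Lp ℂ 2 μ) :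
    ‖f‖ ^ 2 = ∫ θ, ‖f θ‖ ^ 2 ∂μ := by
  have h := @L2.inner_def α ℂ ℂ _ _ _ _ _ f f
  rw [inner_self_eq_norm_sq_to_K] at h
  apply Complex.ofReal_injective
  rw [← integral_complex_ofReal, Complex.ofReal_pow]
  refine h.trans (integral_congr_ae (Eventually.of_forall fun a => ?_))
  simp [inner_self_eq_norm_sq_to_K]

theorem integrable_norm_sq (f : CircL2) :
    Integrable (fun θ => ‖f θ‖ ^ 2) (haarAddCircle : Measure UnitAddCircle) :=
  (memLp_two_iff_integrable_sq_norm (Lp.aestronglyMeasurable f)).1 (Lp.memLp f)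

theorem integrable_mul_norm_sq (w : UnitAddCircle → ℝ) (hw : Continuous w) (f : CircL2) :
    Integrable (fun θ => w θ * ‖f θ‖ ^ 2) (haarAddCircle : Measure UnitAddCircle) := by
  let W : C(UnitAddCircle, ℝ) := ⟨w, hw⟩
  exact (integrable_norm_sq f).bdd_mul (c := ‖W‖) hw.aestronglyMeasurable
    (Eventually.of_forall fun θ => W.norm_coe_le_norm θ)

theorem mulC_eq_zero (l : C(UnitAddCircle, ℝ)) (hl : ∀ θ, l θ ≠ 0) (f : CircL2)
    (h : mulC (ofRealC l) f = 0) : f = 0 := by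
  refine Lp.ext ?_
  have h0 : mulC (ofRealC l) f =ᵐ[haarAddCircle] (0 : UnitAddCircle → ℂ) := by
    rw [h]; exact Lp.coeFn_zero _ _ _
  filter_upwards [mulC_ae (ofRealC l) f, h0, Lp.coeFn_zero ℂ 2 haarAddCircle] with θ h1 h2 h3
  rw [h3]
  rw [h2] at h1
  have := (mul_eq_zero.1 h1.symm).resolve_left (by simpa using hl θ)
  simpa using this

theorem isFiniteMeasure_density (f : CircL2) :
    IsFiniteMeasure ((haarAddCircle : Measure UnitAddCircle).withDensity
      fun θ => ENNReal.ofReal (‖f θ‖ ^ 2)) :=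
  isFiniteMeasure_withDensity_ofReal (integrable_norm_sq f).2

/-! ### Operators that are diagonal in a continuous family of bands -/

section Model

variable {E : Type} [NormedAddCommGroup E] [InnerProductSpace ℂ E]

/-- A unitary diagonalization of `T`: `E` is the orthogonal sum of copies of `L²(ℝ/ℤ)`, on which
`T` acts as multiplication by continuous band functions. -/
structure DiagModel (T : E →L[ℂ] E) (I : Type) [Fintype I] where
  /-- the band functions -/
  lam : I → C(UnitAddCircle, ℝ)
  /-- the embeddings of the summands -/
  U : I → CircL2 →ₗᵢ[ℂ] E
  intertwine : ∀ i f, T (U i f) = U i (mulC (ofRealC (lam i)) f)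
  orth : ∀ i j, i ≠ j → ∀ f g, inner ℂ (U i f) (U j g) = 0
  complete : ∀ u, ∃ f : I → CircL2, u = ∑ i, U i (f i)

namespace DiagModel

variable {T : E →L[ℂ] E} {I : Type} [Fintype I] (D : DiagModel T I)
include D

theorem inner_sum_eq (f g : I → CircL2) :
    inner ℂ (∑ i, D.U i (f i)) (∑ i, D.U i (g i)) = ∑ i, inner ℂ (f i) (g i) := by
  classical
  rw [sum_inner]
  refine Finset.sum_congr rfl fun i _ => ?_
  rw [inner_sum, Finset.sum_eq_single i]
  · exact (D.U i).inner_map_map _ _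
  · intro j _ hj
    exact D.orth i j hj.symm _ _
  · simp

theorem norm_sq_sum (f : I → CircL2) :
    ‖∑ i, D.U i (f i)‖ ^ 2 = ∑ i, ‖f i‖ ^ 2 := by
  have h := D.inner_sum_eq f f
  simp only [inner_self_eq_norm_sq_to_K] at h
  exact_mod_cast h

theorem sum_eq_zero_iff (f : I → CircL2) : ∑ i, D.U i (f i) = 0 ↔ ∀ i, f i = 0 := by
  constructor
  · intro h i
    have h2 := D.norm_sq_sum f
    rw [h, norm_zero, zero_pow two_ne_zero, eq_comm,
      Finset.sum_eq_zero_iff_of_nonneg (fun _ _ => by positivity)] at h2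
    have := h2 i (Finset.mem_univ i)
    simpa using this
  · intro h
    simp [h]

theorem pow_apply (n : ℕ) (i : I) (f : CircL2) :
    (T ^ n) (D.U i f) = D.U i (mulC (ofRealC (D.lam i ^ n)) f) := by
  induction n with
  | zero =>
    rw [pow_zero, one_apply_eq_self]
    congr 1
    refine Lp.ext ?_
    filter_upwards [mulC_ae (ofRealC (D.lam i ^ 0)) f] with θ h
    rw [h]
    simp
  | succ n ih =>
    rw [pow_succ', mul_apply_eq_comp, ih, D.intertwine]
    congr 1
    refine Lp.ext ?_
    filter_upwards [mulC_ae (ofRealC (D.lam i ^ (n + 1))) f,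
      mulC_ae (ofRealC (D.lam i)) (mulC (ofRealC (D.lam i ^ n)) f),
      mulC_ae (ofRealC (D.lam i ^ n)) f] with θ h1 h2 h3
    rw [h1, h2, h3]
    simp [pow_succ]
    ring

theorem sub_smul_apply (x : ℝ) (i : I) (f : CircL2) :
    (T - algebraMap ℂ (E →L[ℂ] E) (x : ℂ)) (D.U i f) =
      D.U i (mulC (ofRealC (D.lam i - ContinuousMap.const _ x)) f) := by
  rw [sub_apply, D.intertwine, Algebra.algebraMap_eq_smul_one,
    smul_apply, one_apply_eq_self, ← (D.U i).map_smul,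
    ← map_sub]
  congr 1
  refine Lp.ext ?_
  filter_upwards [mulC_ae (ofRealC (D.lam i - ContinuousMap.const _ x)) f,
    mulC_ae (ofRealC (D.lam i)) f, Lp.coeFn_sub (mulC (ofRealC (D.lam i)) f)
      ((x : ℂ) • f), Lp.coeFn_smul (x : ℂ) f] with θ h1 h2 h3 h4
  rw [h1, h3, Pi.sub_apply, h2, h4]
  simp
  ring

theorem sub_smul_apply_sum (x : ℝ) (f : I → CircL2) :
    (T - algebraMap ℂ (E →L[ℂ] E) (x : ℂ)) (∑ i, D.U i (f i)) =
      ∑ i, D.U i (mulC (ofRealC (D.lam i - ContinuousMap.const _ x)) (f i)) := by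
  rw [map_sum]
  exact Finset.sum_congr rfl fun i _ => D.sub_smul_apply x i (f i)

/-- Functions supported where the band function is close to its value at `θ₀` are approximate
eigenvectors. That set is open and nonempty, hence of positive Haar measure, so a bounded inverse
cannot exist. -/
theorem mem_realSpectrum_of_lam [CompleteSpace E] (i : I) (θ₀ : UnitAddCircle) :
    D.lam i θ₀ ∈ realSpectrum T := by
  set x := D.lam i θ₀ with hx
  have key : ¬ IsUnit (T - algebraMap ℂ (E →L[ℂ] E) (x : ℂ)) := by
    intro hu
    obtain ⟨u, hu⟩ := hu
    set R : E →L[ℂ] E := ((u⁻¹ : (E →L[ℂ] E)ˣ) : E →L[ℂ] E)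
    have hR : ∀ y, R ((T - algebraMap ℂ (E →L[ℂ] E) (x : ℂ)) y) = y := by
      intro y
      have : R * (T - algebraMap ℂ (E →L[ℂ] E) (x : ℂ)) = 1 := by
        rw [← hu]; exact u.inv_mul
      exact congrArg (fun S : E →L[ℂ] E => S y) this
    -- The tolerance is chosen so that `‖R‖ * c < 1`, which contradicts `‖f‖ ≤ ‖R‖ * c * ‖f‖`.
    set c : ℝ := 1 / (2 * (‖R‖ + 1)) with hc
    have hcpos : 0 < c := by positivity
    set O : Set UnitAddCircle := {θ | |D.lam i θ - x| < c} with hO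
    have hOo : IsOpen O := by
      have : Continuous fun θ => |D.lam i θ - x| := by fun_prop
      exact isOpen_lt this continuous_const
    have hOn : O.Nonempty := ⟨θ₀, by simp [hO, hx, hcpos]⟩
    have hOm : haarAddCircle O ≠ 0 := (hOo.measure_pos _ hOn).ne'
    set f : CircL2 := indicatorConstLp 2 hOo.measurableSet (measure_ne_top _ _) (1 : ℂ) with hf
    have hfn : f ≠ 0 := by
      intro h0
      have h1 := norm_indicatorConstLp (p := 2) (hs := hOo.measurableSet)
        (hμs := measure_ne_top haarAddCircle O) (c := (1 : ℂ)) (by norm_num) (by norm_num)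
      rw [← hf, h0] at h1
      simp at h1
      have h2 : 0 < haarAddCircle.real O :=
        (ENNReal.toReal_pos_iff.2 ⟨pos_iff_ne_zero.2 hOm, (measure_lt_top _ _)⟩)
      have h3 := Real.rpow_pos_of_pos h2 (2⁻¹)
      linarith
    have hle : ‖mulC (ofRealC (D.lam i - ContinuousMap.const _ x)) f‖ ≤ c * ‖f‖ := by
      refine Lp.norm_le_mul_norm_of_ae_le_mul ?_
      filter_upwards [mulC_ae (ofRealC (D.lam i - ContinuousMap.const _ x)) f,
        indicatorConstLp_coeFn (p := 2) (hs := hOo.measurableSet)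
        (hμs := measure_ne_top haarAddCircle O) (c := (1 : ℂ))] with θ h1 h2
      rw [h1, h2]
      by_cases hθ : θ ∈ O
      · have h3 : |D.lam i θ - x| < c := hθ
        rw [norm_mul]
        gcongr
        rw [ofRealC_apply, Complex.norm_real]
        exact h3.le
      · simp [hθ]
    have h1 := hR (D.U i f)
    rw [D.sub_smul_apply] at h1
    have h2 : ‖f‖ ≤ ‖R‖ * (c * ‖f‖) := by
      calc ‖f‖ = ‖D.U i f‖ := ((D.U i).norm_map f).symm
        _ ≤ ‖R‖ * ‖D.U i (mulC (ofRealC (D.lam i - ContinuousMap.const _ x)) f)‖ := by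
          conv_lhs => rw [← h1]
          exact R.le_opNorm _
        _ ≤ _ := by
          rw [(D.U i).norm_map]
          gcongr
    have h3 : 0 < ‖f‖ := norm_pos_iff.2 hfn
    have h4 : ‖R‖ * c < 1 := by
      rw [hc, mul_one_div, div_lt_one (by positivity)]
      linarith [norm_nonneg R]
    nlinarith
  intro h
  apply key
  change IsUnit (algebraMap ℂ (E →L[ℂ] E) (x : ℂ) - T) at h
  rwa [← neg_sub, IsUnit.neg_iff] at h

/-- Away from the ranges, the functions `1 / (lam i - x)` are continuous on the circle, and
multiplication by them inverts `T - x` on each summand. Bijectivity suffices for invertibility by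
the open mapping theorem. -/
theorem realSpectrum_eq [CompleteSpace E] : realSpectrum T = ⋃ i, range (D.lam i) := by
  refine Subset.antisymm (fun x hx => ?_) ?_
  · by_contra hn
    have hne : ∀ i θ, (D.lam i - ContinuousMap.const UnitAddCircle x) θ ≠ 0 := by
      intro i θ h
      refine hn (mem_iUnion.2 ⟨i, θ, ?_⟩)
      simpa [sub_eq_zero] using h
    apply hx
    change IsUnit (algebraMap ℂ (E →L[ℂ] E) (x : ℂ) - T)
    rw [← neg_sub, IsUnit.neg_iff, ContinuousLinearMap.isUnit_iff_bijective]
    constructor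
    · rw [injective_iff_map_eq_zero]
      intro u hu
      obtain ⟨f, rfl⟩ := D.complete u
      rw [D.sub_smul_apply_sum, D.sum_eq_zero_iff] at hu
      rw [D.sum_eq_zero_iff]
      exact fun i => mulC_eq_zero _ (hne i) _ (hu i)
    · intro u
      obtain ⟨f, rfl⟩ := D.complete u
      let w : I → C(UnitAddCircle, ℂ) := fun i =>
        ⟨fun θ => (((D.lam i - ContinuousMap.const UnitAddCircle x) θ : ℝ) : ℂ)⁻¹,
          Continuous.inv₀ (Complex.continuous_ofReal.comp (ContinuousMap.continuous _))
            (fun θ => Complex.ofReal_ne_zero.2 (hne i θ))⟩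
      refine ⟨∑ i, D.U i (mulC (w i) (f i)), ?_⟩
      rw [D.sub_smul_apply_sum]
      refine Finset.sum_congr rfl fun i _ => ?_
      congr 1
      refine Lp.ext ?_
      filter_upwards [mulC_ae (ofRealC (D.lam i - ContinuousMap.const _ x)) (mulC (w i) (f i)),
        mulC_ae (w i) (f i)] with θ h1 h2
      rw [h1, h2, ← mul_assoc]
      have : ofRealC (D.lam i - ContinuousMap.const _ x) θ * w i θ = 1 :=
        mul_inv_cancel₀ (Complex.ofReal_ne_zero.2 (hne i θ))
      rw [this, one_mul]
  · refine iUnion_subset fun i => ?_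
    rintro _ ⟨θ, rfl⟩
    exact D.mem_realSpectrum_of_lam i θ

/-- A constant band embeds a whole copy of `L²` of the circle in the eigenspace, and the Fourier
characters are infinitely many independent vectors there. -/
theorem infinite_eigenspace (i : I) (x : ℝ) (h : ∀ θ, D.lam i θ = x) :
    ¬ FiniteDimensional ℂ (Module.End.eigenspace (T : E →ₗ[ℂ] E) (x : ℂ)) := by
  intro hfin
  have hmem : ∀ f, D.U i f ∈ Module.End.eigenspace (T : E →ₗ[ℂ] E) (x : ℂ) := by
    intro f
    rw [Module.End.mem_eigenspace_iff, ContinuousLinearMap.coe_coe, D.intertwine,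
      ← (D.U i).map_smul]
    congr 1
    refine Lp.ext ?_
    filter_upwards [mulC_ae (ofRealC (D.lam i)) f, Lp.coeFn_smul (x : ℂ) f] with θ h1 h2
    rw [h1, h2]
    simp [h]
  let L : CircL2 →ₗ[ℂ] Module.End.eigenspace (T : E →ₗ[ℂ] E) (x : ℂ) :=
    (D.U i).toLinearMap.codRestrict _ hmem
  have hL : Function.Injective L := fun f g hfg => (D.U i).injective (congrArg Subtype.val hfg)
  have : FiniteDimensional ℂ CircL2 := FiniteDimensional.of_injective L hL
  have hli := (orthonormal_fourier (T := (1 : ℝ))).linearIndependent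
  exact (inferInstance : Infinite ℤ).not_finite hli.finite

/-! ### Spectral measures -/

theorem inner_pow (f : I → CircL2) (n : ℕ) :
    inner ℂ (∑ i, D.U i (f i)) ((T ^ n) (∑ i, D.U i (f i))) =
      ((∑ i, ∫ θ, (D.lam i θ) ^ n * ‖f i θ‖ ^ 2 ∂haarAddCircle : ℝ) : ℂ) := by
  rw [map_sum]
  simp_rw [D.pow_apply]
  rw [D.inner_sum_eq, Complex.ofReal_sum]
  refine Finset.sum_congr rfl fun i _ => ?_
  rw [inner_mulC, ← integral_complex_ofReal]
  refine integral_congr_ae (Eventually.of_forall fun θ => ?_)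
  simp [inner_self_eq_norm_sq_to_K]

/-- The spectral measure of `∑ U_i f_i`. -/
def specMeasure (f : I → CircL2) : Measure ℝ :=
  ∑ i, (haarAddCircle.withDensity fun θ => ENNReal.ofReal (‖f i θ‖ ^ 2)).map (D.lam i)

theorem specMeasure_compl (f : I → CircL2) (S : Set ℝ) (hS : MeasurableSet S)
    (h : ∀ i, f i ≠ 0 → ∀ θ, D.lam i θ ∈ S) : D.specMeasure f Sᶜ = 0 := by
  rw [specMeasure, Measure.coe_finsetSum, Finset.sum_apply]
  refine Finset.sum_eq_zero fun i _ => ?_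
  rw [Measure.map_apply (D.lam i).continuous.measurable hS.compl]
  by_cases hf : f i = 0
  · have : (fun θ => ENNReal.ofReal (‖f i θ‖ ^ 2)) =ᵐ[haarAddCircle] 0 := by
      rw [hf]
      exact Eventually.of_forall fun θ => by simp
    rw [withDensity_congr_ae this]
    simp
  · have : (D.lam i) ⁻¹' Sᶜ = ∅ := by
      ext θ
      simp [h i hf θ]
    rw [this, measure_empty]

theorem isSpectralMeasure_specMeasure (f : I → CircL2) :
    IsSpectralMeasure T (∑ i, D.U i (f i)) (D.specMeasure f) := by
  have hfin : ∀ i, IsFiniteMeasure ((haarAddCircle.withDensity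
      fun θ => ENNReal.ofReal (‖f i θ‖ ^ 2)).map (D.lam i)) := fun i => by
    have := isFiniteMeasure_density (f i)
    infer_instance
  refine ⟨?_, ?_, ?_⟩
  · unfold specMeasure
    infer_instance
  · refine ⟨∑ i, ‖D.lam i‖, D.specMeasure_compl f _ measurableSet_Icc fun i _ θ => ?_⟩
    have h1 : |D.lam i θ| ≤ ‖D.lam i‖ := (D.lam i).norm_coe_le_norm θ
    have h2 : ‖D.lam i‖ ≤ ∑ i, ‖D.lam i‖ :=
      Finset.single_le_sum (f := fun i => ‖D.lam i‖) (fun _ _ => norm_nonneg _)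
        (Finset.mem_univ i)
    exact abs_le.1 (h1.trans h2)
  · intro n
    rw [D.inner_pow]
    congr 1
    have hi : ∀ i, AEMeasurable (fun θ => (‖f i θ‖ ^ 2)) haarAddCircle := fun i =>
      (Lp.aestronglyMeasurable (f i)).norm.aemeasurable.pow_const 2
    have hlt : ∀ i, ∀ᵐ θ ∂haarAddCircle, ENNReal.ofReal (‖f i θ‖ ^ 2) < ⊤ := fun i =>
      Eventually.of_forall fun θ => ENNReal.ofReal_lt_top
    rw [specMeasure, integral_finsetSum_measure]
    · refine Finset.sum_congr rfl fun i _ => ?_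
      rw [integral_map (D.lam i).continuous.aemeasurable (by fun_prop),
        integral_withDensity_eq_integral_toReal_smul₀ (hi i).ennreal_ofReal (hlt i)]
      refine integral_congr_ae (Eventually.of_forall fun θ => ?_)
      simp [mul_comm]
    · intro i _
      rw [integrable_map_measure (by fun_prop) (D.lam i).continuous.aemeasurable,
        integrable_withDensity_iff_integrable_smul₀' (hi i).ennreal_ofReal (hlt i)]
      refine (integrable_mul_norm_sq (fun θ => D.lam i θ ^ n) (by fun_prop) (f i)).congr ?_
      refine Eventually.of_forall fun θ => ?_
      simp [mul_comm]

/-- Only the moments of `μ` are prescribed, and linearity carries them to all polynomials. This is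
enough below, so uniqueness of the spectral measure is never needed. -/
theorem integral_polynomial_eq (f : I → CircL2) (μ : Measure ℝ)
    (hμ : IsSpectralMeasure T (∑ i, D.U i (f i)) μ) (q : Polynomial ℝ) :
    Integrable (fun x => q.eval x) μ ∧
    ∫ x, q.eval x ∂μ = ∑ i, ∫ θ, q.eval (D.lam i θ) * ‖f i θ‖ ^ 2 ∂haarAddCircle := by
  obtain ⟨hfin, ⟨R, hR⟩, hm⟩ := hμ
  have hint : ∀ q : Polynomial ℝ, Integrable (fun x => q.eval x) μ := by
    intro q
    have h1 : IntegrableOn (fun x => q.eval x) (Icc (-R) R) μ :=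
      q.continuous.continuousOn.integrableOn_compact isCompact_Icc
    rwa [IntegrableOn, Measure.restrict_eq_self_of_ae_mem] at h1
    exact hR
  refine ⟨hint q, ?_⟩
  induction q using Polynomial.induction_on' with
  | add q r hq hr =>
    simp only [Polynomial.eval_add]
    rw [integral_add (hint q) (hint r), hq, hr, ← Finset.sum_add_distrib]
    refine Finset.sum_congr rfl fun i _ => ?_
    rw [← integral_add]
    · simp only [add_mul]
    · exact integrable_mul_norm_sq (fun θ => q.eval (D.lam i θ)) (by fun_prop) (f i)
    · exact integrable_mul_norm_sq (fun θ => r.eval (D.lam i θ)) (by fun_prop) (f i)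
  | monomial n c =>
    have h := hm n
    rw [D.inner_pow] at h
    have h' := Complex.ofReal_injective h
    simp only [Polynomial.eval_monomial]
    rw [integral_const_mul, ← h', Finset.mul_sum]
    refine Finset.sum_congr rfl fun i _ => ?_
    rw [← integral_const_mul]
    simp only [mul_assoc]

/-- High even moments about the centre `c` of the interval separate the two sides. A measure on `[a,
b]` gives at most `r ^ (2n)` times its mass, while a band staying at distance `R > r` from `c`
contributes at least `R ^ (2n) * ‖f i‖ ^ 2`. Letting `n → ∞` forces `f i = 0`. -/
theorem eq_zero_of_mem_spectralSubspace (f : I → CircL2) (a b : ℝ)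
    (h : ∑ i, D.U i (f i) ∈ spectralSubspace T (Icc a b)) (i : I)
    (hi : ∀ θ, D.lam i θ ∉ Icc a b) : f i = 0 := by
  obtain ⟨μ, hμ, hS⟩ := h
  have hfin := hμ.1
  -- For an empty interval `μ = 0`, and the zeroth moment already gives the claim.
  by_cases hab : b < a
  · have h0 := D.integral_polynomial_eq f μ hμ 1
    have hμ0 : μ = 0 := by
      rw [← Measure.measure_univ_eq_zero]
      rwa [Icc_eq_empty (not_le.2 hab), compl_empty] at hS
    rw [hμ0] at h0
    have h1 := h0.2
    simp only [Polynomial.eval_one, one_mul, integral_zero_measure] at h1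
    simp_rw [← norm_sq_circL2] at h1
    rw [eq_comm, Finset.sum_eq_zero_iff_of_nonneg (fun _ _ => by positivity)] at h1
    simpa using h1 i (Finset.mem_univ i)
  push Not at hab
  set c := (a + b) / 2
  set r := (b - a) / 2
  have hr : 0 ≤ r := by simp only [r]; linarith
  have hmem : ∀ x : ℝ, x ∈ Icc a b ↔ |x - c| ≤ r := by
    intro x
    rw [abs_le, mem_Icc]
    constructor
    · rintro ⟨h1, h2⟩
      constructor <;> simp only [c, r] <;> linarith
    · rintro ⟨h1, h2⟩
      simp only [c, r] at h1 h2
      constructor <;> linarith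
  -- Compactness of the circle turns pointwise avoidance of `[a, b]` into the uniform distance `R >
  -- r`.
  obtain ⟨θ₀, -, hmin⟩ := isCompact_univ.exists_isMinOn (univ_nonempty (α := UnitAddCircle))
    (show ContinuousOn (fun θ => |D.lam i θ - c|) univ by fun_prop)
  set R := |D.lam i θ₀ - c|
  have hR : r < R := by
    by_contra hcon
    exact hi θ₀ ((hmem _).2 (not_lt.1 hcon))
  have hRpos : 0 < R := lt_of_le_of_lt hr hR
  have key : ∀ n : ℕ, R ^ (2 * n) * ‖f i‖ ^ 2 ≤ r ^ (2 * n) * μ.real univ := by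
    intro n
    have hq := D.integral_polynomial_eq f μ hμ ((Polynomial.X - Polynomial.C c) ^ (2 * n))
    simp only [Polynomial.eval_pow, Polynomial.eval_sub, Polynomial.eval_X,
      Polynomial.eval_C] at hq
    have h1 : ∫ x, (x - c) ^ (2 * n) ∂μ ≤ r ^ (2 * n) * μ.real univ := by
      calc ∫ x, (x - c) ^ (2 * n) ∂μ ≤ ∫ x, r ^ (2 * n) ∂μ := by
            refine integral_mono_ae hq.1 (integrable_const _) ?_
            have : ∀ᵐ x ∂μ, x ∈ Icc a b := hS
            filter_upwards [this] with x hx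
            rw [pow_mul, pow_mul, ← sq_abs (x - c)]
            have := (hmem x).1 hx
            gcongr
        _ = _ := by rw [integral_const, smul_eq_mul, mul_comm]
    have hnn : ∀ j, 0 ≤ ∫ θ, (D.lam j θ - c) ^ (2 * n) * ‖f j θ‖ ^ 2 ∂haarAddCircle :=
      fun j => integral_nonneg fun θ =>
        mul_nonneg (by rw [pow_mul]; positivity) (by positivity)
    have h2 : R ^ (2 * n) * ‖f i‖ ^ 2 ≤
        ∫ θ, (D.lam i θ - c) ^ (2 * n) * ‖f i θ‖ ^ 2 ∂haarAddCircle := by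
      rw [norm_sq_circL2, ← integral_const_mul]
      refine integral_mono ((integrable_norm_sq _).const_mul _)
        (integrable_mul_norm_sq (fun θ => (D.lam i θ - c) ^ (2 * n)) (by fun_prop) (f i)) ?_
      intro θ
      simp only
      rw [pow_mul, pow_mul, ← sq_abs (D.lam i θ - c)]
      have : R ≤ |D.lam i θ - c| := hmin (mem_univ θ)
      gcongr
    refine h2.trans (le_trans ?_ h1)
    rw [hq.2]
    exact Finset.single_le_sum
      (f := fun j => ∫ θ, (D.lam j θ - c) ^ (2 * n) * ‖f j θ‖ ^ 2 ∂haarAddCircle)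
      (fun j _ => hnn j) (Finset.mem_univ i)
  have hlim : Tendsto (fun n : ℕ => ((r / R) ^ 2) ^ n * μ.real univ) atTop
      (nhds (0 * μ.real univ)) := by
    refine Tendsto.mul_const _ (tendsto_pow_atTop_nhds_zero_of_lt_one (by positivity) ?_)
    have : r / R < 1 := (div_lt_one hRpos).2 hR
    have h0 : 0 ≤ r / R := by positivity
    nlinarith
  have hle : ‖f i‖ ^ 2 ≤ 0 := by
    have := ge_of_tendsto' hlim (b := ‖f i‖ ^ 2) (fun n => ?_)
    · simpa using this
    · have hk := key n
      rw [← pow_mul, div_pow, div_mul_eq_mul_div, le_div_iff₀ (by positivity)]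
      linarith
  have : ‖f i‖ = 0 := by nlinarith [norm_nonneg (f i)]
  exact norm_eq_zero.1 this

theorem mem_spectralSubspace_iff (f : I → CircL2) (a b : ℝ) (P : I → Prop)
    (hin : ∀ i, P i → ∀ θ, D.lam i θ ∈ Icc a b)
    (hout : ∀ i, ¬ P i → ∀ θ, D.lam i θ ∉ Icc a b) :
    ∑ i, D.U i (f i) ∈ spectralSubspace T (Icc a b) ↔ ∀ i, ¬ P i → f i = 0 := by
  constructor
  · intro h i hi
    exact D.eq_zero_of_mem_spectralSubspace f a b h i (hout i hi)
  · intro h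
    refine ⟨D.specMeasure f, D.isSpectralMeasure_specMeasure f,
      D.specMeasure_compl f _ measurableSet_Icc fun i hi θ => ?_⟩
    by_contra hcon
    by_cases hP : P i
    · exact hcon (hin i hP θ)
    · exact hi (h i hP)

end DiagModel
end Model
end
end Nanotube

namespace Nanotube
noncomputable section
open AddCircle

/-! ### Even bands have multiplicity two -/

/-- `cos (2πθ)` on the circle `ℝ/ℤ`. -/
def circCos : C(UnitAddCircle, ℝ) :=
  ⟨fun θ => (fourier 1 θ : ℂ).re, Complex.continuous_re.comp (fourier 1).continuous⟩

/-- `sin (2πθ)` on the circle `ℝ/ℤ`. -/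
def circSin : C(UnitAddCircle, ℝ) :=
  ⟨fun θ => (fourier 1 θ : ℂ).im, Complex.continuous_im.comp (fourier 1).continuous⟩

theorem circCos_coe (x : ℝ) : circCos (x : UnitAddCircle) = Real.cos (2 * Real.pi * x) := by
  have h : circCos (x : UnitAddCircle) = (fourier 1 (x : UnitAddCircle) : ℂ).re := rfl
  rw [h, fourier_coe_apply]
  have : (2 * Real.pi * Complex.I * (1 : ℤ) * x / (1 : ℝ) : ℂ) =
      ((2 * Real.pi * x : ℝ) : ℂ) * Complex.I := by
    push_cast; ring
  rw [this, Complex.exp_ofReal_mul_I_re]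

theorem circSin_coe (x : ℝ) : circSin (x : UnitAddCircle) = Real.sin (2 * Real.pi * x) := by
  have h : circSin (x : UnitAddCircle) = (fourier 1 (x : UnitAddCircle) : ℂ).im := rfl
  rw [h, fourier_coe_apply]
  have : (2 * Real.pi * Complex.I * (1 : ℤ) * x / (1 : ℝ) : ℂ) =
      ((2 * Real.pi * x : ℝ) : ℂ) * Complex.I := by
    push_cast; ring
  rw [this, Complex.exp_ofReal_mul_I_im]

theorem circCos_neg (θ : UnitAddCircle) : circCos (-θ) = circCos θ := by
  induction θ using QuotientAddGroup.induction_on with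
  | H x =>
    change circCos (((-x : ℝ)) : UnitAddCircle) = circCos (x : UnitAddCircle)
    rw [circCos_coe, circCos_coe, mul_neg, Real.cos_neg]

theorem circSin_neg (θ : UnitAddCircle) : circSin (-θ) = -circSin θ := by
  induction θ using QuotientAddGroup.induction_on with
  | H x =>
    change circSin (((-x : ℝ)) : UnitAddCircle) = -circSin (x : UnitAddCircle)
    rw [circSin_coe, circSin_coe, mul_neg, Real.sin_neg]

theorem circCos_mem (θ : UnitAddCircle) : circCos θ ∈ Icc (-1 : ℝ) 1 := by
  induction θ using QuotientAddGroup.induction_on with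
  | H x =>
    exact circCos_coe x ▸ Real.cos_mem_Icc _

/-- The point of the upper half circle with a given cosine. -/
def circArccos (x : ℝ) : UnitAddCircle := ((Real.arccos x / (2 * Real.pi) : ℝ) : UnitAddCircle)

theorem measurable_circArccos : Measurable circArccos := by
  have h : Measurable fun x : ℝ => Real.arccos x / (2 * Real.pi) :=
    Real.continuous_arccos.measurable.div_const _
  exact (AddCircle.continuous_mk' (1 : ℝ)).measurable.comp h

theorem circCos_circArccos {x : ℝ} (hx : x ∈ Icc (-1 : ℝ) 1) : circCos (circArccos x) = x := by
  rw [circArccos, circCos_coe, mul_div_cancel₀ _ (by positivity), Real.cos_arccos hx.1 hx.2]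

theorem circSin_circArccos_nonneg (x : ℝ) : 0 ≤ circSin (circArccos x) := by
  rw [circArccos, circSin_coe, mul_div_cancel₀ _ (by positivity)]
  exact Real.sin_nonneg_of_nonneg_of_le_pi (Real.arccos_nonneg _) (Real.arccos_le_pi _)

theorem eq_or_eq_neg_of_circCos_eq {θ η : UnitAddCircle} (h : circCos θ = circCos η) :
    θ = η ∨ θ = -η := by
  induction θ using QuotientAddGroup.induction_on with
  | H x =>
  induction η using QuotientAddGroup.induction_on with
  | H y =>
    change circCos (x : UnitAddCircle) = circCos (y : UnitAddCircle) at h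
    change (x : UnitAddCircle) = (y : UnitAddCircle) ∨ (x : UnitAddCircle) = -(y : UnitAddCircle)
    rw [circCos_coe, circCos_coe, Real.cos_eq_cos_iff] at h
    obtain ⟨k, hk | hk⟩ := h
    · left
      have : y = x + k • (1 : ℝ) := by
        have hpi := Real.pi_pos
        have h2 : 2 * Real.pi * y = 2 * Real.pi * (x + k) := by rw [hk]; ring
        have := mul_left_cancel₀ (by positivity) h2
        simp [this]
      rw [this, AddCircle.coe_add, AddCircle.coe_zsmul, AddCircle.coe_period]
      simp
    · right
      have : y = -x + k • (1 : ℝ) := by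
        have hpi := Real.pi_pos
        have h2 : 2 * Real.pi * y = 2 * Real.pi * (-x + k) := by rw [hk]; ring
        have := mul_left_cancel₀ (by positivity) h2
        simp [this]
      rw [this, AddCircle.coe_add, AddCircle.coe_zsmul, AddCircle.coe_period]
      simp

theorem neg_eq_self_of_circSin_eq_zero {θ : UnitAddCircle} (hθ : circSin θ = 0) : -θ = θ := by
  induction θ using QuotientAddGroup.induction_on with
  | H x =>
  change circSin (x : UnitAddCircle) = 0 at hθ
  change -(x : UnitAddCircle) = (x : UnitAddCircle)
  rw [circSin_coe, Real.sin_eq_zero_iff] at hθ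
  obtain ⟨k, hk⟩ := hθ
  have : x = -x + k • (1 : ℝ) := by
    have hpi := Real.pi_pos
    have h2 : Real.pi * x = Real.pi * (-x + k) := by linarith
    have := mul_left_cancel₀ (by positivity) h2
    simpa using this
  conv_rhs => rw [this]
  rw [AddCircle.coe_add, AddCircle.coe_zsmul, AddCircle.coe_period]
  simp

/-- The zeros of the sine are 2-torsion points, so there are finitely many of them, and Haar measure
has no atoms. -/
theorem haar_circSin_eq_zero : haarAddCircle {θ : UnitAddCircle | circSin θ = 0} = 0 := by
  have hsub : {θ : UnitAddCircle | circSin θ = 0} ⊆ {u | 2 • u = 0} := by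
    intro θ hθ
    change 2 • θ = 0
    rw [two_nsmul]
    nth_rewrite 1 [← neg_eq_self_of_circSin_eq_zero hθ]
    simp
  have hfin : {u : UnitAddCircle | 2 • u = 0}.Finite := AddCircle.finite_torsion 1 two_pos
  have hna : NullSingletonClass (haarAddCircle : Measure UnitAddCircle) := by
    refine ⟨fun x => ?_⟩
    -- For period one, Haar measure is Lebesgue measure, so a point lies in balls of arbitrarily
    -- small measure.
    have hv : (volume : Measure UnitAddCircle) = haarAddCircle := by
      rw [volume_eq_smul_haarAddCircle]; simp
    rw [← hv, ← nonpos_iff_eq_zero]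
    refine ENNReal.le_of_forall_pos_le_add fun ε hε _ => ?_
    calc volume {x} ≤ volume (Metric.closedBall x ((ε : ℝ) / 2)) :=
          measure_mono (singleton_subset_iff.2 (Metric.mem_closedBall_self (by positivity)))
      _ ≤ ENNReal.ofReal (2 * ((ε : ℝ) / 2)) := by
          rw [AddCircle.volume_closedBall]
          exact ENNReal.ofReal_le_ofReal (min_le_right _ _)
      _ = 0 + ε := by
          rw [mul_div_cancel₀ _ two_ne_zero, ENNReal.ofReal_coe_nnreal, zero_add]
  exact measure_mono_null hsub (hfin.measure_zero _)

/-- The sign of `sin (2πθ)`, or the constant `1`. -/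
def circSign (b : Bool) (θ : UnitAddCircle) : ℂ :=
  if b then (if 0 < circSin θ then 1 else if circSin θ < 0 then -1 else 0) else 1

theorem measurable_circSign (b : Bool) : Measurable (circSign b) := by
  cases b
  · exact measurable_const
  · change Measurable fun θ => if 0 < circSin θ then (1 : ℂ) else if circSin θ < 0 then -1 else 0
    refine Measurable.ite ?_ measurable_const (Measurable.ite ?_ measurable_const measurable_const)
    · exact measurableSet_lt measurable_const circSin.continuous.measurable
    · exact measurableSet_lt circSin.continuous.measurable measurable_const

theorem norm_circSign_le (b : Bool) (θ : UnitAddCircle) : ‖circSign b θ‖ ≤ 1 := by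
  unfold circSign
  split_ifs <;> simp

theorem circSign_true_neg (θ : UnitAddCircle) : circSign true (-θ) = -circSign true θ := by
  simp only [circSign, circSin_neg, if_true]
  rcases lt_trichotomy (circSin θ) 0 with h | h | h
  · simp [h, h.not_gt]
  · simp [h]
  · simp [h, h.not_gt]

theorem conj_circSign (b : Bool) (θ : UnitAddCircle) :
    (starRingEnd ℂ) (circSign b θ) = circSign b θ := by
  unfold circSign
  split_ifs <;> simp

theorem circSign_mul_self_ae (b : Bool) :
    ∀ᵐ θ ∂haarAddCircle, circSign b θ * circSign b θ = 1 := by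
  have h : ∀ᵐ θ : UnitAddCircle ∂haarAddCircle, ¬ circSin θ = 0 := by
    rw [ae_iff]
    simpa using haar_circSin_eq_zero
  filter_upwards [h] with θ hθ
  unfold circSign
  rcases lt_or_gt_of_ne hθ with h | h
  · cases b <;> simp [h, h.not_gt]
  · cases b <;> simp [h]

section Pullback

variable (l : C(UnitAddCircle, ℝ))

theorem memLp_pullback (b : Bool) (F : Lp ℂ 2 ((haarAddCircle : Measure UnitAddCircle).map l)) :
    MemLp (fun θ => circSign b θ * F (l θ)) 2 (haarAddCircle : Measure UnitAddCircle) := by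
  have hmp : MeasurePreserving l haarAddCircle ((haarAddCircle : Measure UnitAddCircle).map l) :=
    ⟨l.continuous.measurable, rfl⟩
  have h := (Lp.memLp F).comp_measurePreserving hmp
  refine MemLp.of_le_mul (c := 1) h ?_ ?_
  · exact (measurable_circSign b).aestronglyMeasurable.mul h.aestronglyMeasurable
  · refine Eventually.of_forall fun θ => ?_
    rw [norm_mul]
    gcongr
    · exact norm_circSign_le b θ
    · rfl

/-- `F ↦ F ∘ l` or `F ↦ sgn(sin) F ∘ l`, from `L²` of the law of `l` to `L²` of the circle. -/
def pullbackFun (b : Bool) (F : Lp ℂ 2 ((haarAddCircle : Measure UnitAddCircle).map l)) :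
    CircL2 := (memLp_pullback l b F).toLp _

theorem pullbackFun_ae (b : Bool)
    (F : Lp ℂ 2 ((haarAddCircle : Measure UnitAddCircle).map l)) :
    pullbackFun l b F =ᵐ[haarAddCircle] fun θ => circSign b θ * F (l θ) := MemLp.coeFn_toLp _

theorem ae_comp {P : ℝ → Prop}
    (h : ∀ᵐ x ∂((haarAddCircle : Measure UnitAddCircle).map l), P x) :
    ∀ᵐ θ ∂haarAddCircle, P (l θ) := ae_of_ae_map l.continuous.aemeasurable h

theorem inner_pullbackFun_self (b : Bool)
    (F G : Lp ℂ 2 ((haarAddCircle : Measure UnitAddCircle).map l)) :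
    inner ℂ (pullbackFun l b F) (pullbackFun l b G) = inner ℂ F G := by
  rw [L2.inner_def, L2.inner_def, integral_map l.continuous.aemeasurable]
  · refine integral_congr_ae ?_
    filter_upwards [pullbackFun_ae l b F, pullbackFun_ae l b G, circSign_mul_self_ae b]
      with θ h1 h2 h3
    rw [h1, h2, RCLike.inner_apply, RCLike.inner_apply, map_mul, conj_circSign]
    linear_combination (G (l θ) * (starRingEnd ℂ) (F (l θ))) * h3
  · exact (Lp.aestronglyMeasurable F).inner (Lp.aestronglyMeasurable G)

/-- The integrand is the odd sign function times an even function, so reflection of the circle shows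
that its integral equals its own negative. -/
theorem inner_pullbackFun_ne (hl : ∀ θ, l (-θ) = l θ) {b b' : Bool} (hb : b ≠ b')
    (F G : Lp ℂ 2 ((haarAddCircle : Measure UnitAddCircle).map l)) :
    inner ℂ (pullbackFun l b F) (pullbackFun l b' G) = 0 := by
  rw [L2.inner_def]
  have h : ∫ θ, inner ℂ (pullbackFun l b F θ) (pullbackFun l b' G θ) ∂haarAddCircle =
      ∫ θ, circSign true θ * inner ℂ (F (l θ)) (G (l θ)) ∂haarAddCircle := by
    refine integral_congr_ae ?_
    filter_upwards [pullbackFun_ae l b F, pullbackFun_ae l b' G] with θ h1 h2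
    rw [h1, h2, RCLike.inner_apply, RCLike.inner_apply, map_mul, conj_circSign]
    cases b <;> cases b' <;> first | exact absurd rfl hb | skip
    · have : circSign false θ = 1 := rfl
      rw [this]; ring
    · have : circSign false θ = 1 := rfl
      rw [this]; ring
  rw [h]
  have h2 := integral_neg_eq_self
    (fun θ => circSign true θ * inner ℂ (F (l θ)) (G (l θ))) haarAddCircle
  simp only [circSign_true_neg, hl, neg_mul] at h2
  rw [integral_neg] at h2
  exact self_eq_neg.1 h2.symm

/-- `pullbackFun` as a linear isometry. -/
def pullback (b : Bool) :
    Lp ℂ 2 ((haarAddCircle : Measure UnitAddCircle).map l) →ₗᵢ[ℂ] CircL2 where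
  toFun := pullbackFun l b
  map_add' F G := by
    refine Lp.ext ?_
    filter_upwards [pullbackFun_ae l b (F + G), pullbackFun_ae l b F, pullbackFun_ae l b G,
      ae_comp l (Lp.coeFn_add F G), Lp.coeFn_add (pullbackFun l b F) (pullbackFun l b G)]
      with θ h1 h2 h3 h4 h5
    rw [h1, h5, Pi.add_apply, h2, h3, h4, Pi.add_apply, mul_add]
  map_smul' c F := by
    refine Lp.ext ?_
    filter_upwards [pullbackFun_ae l b (c • F), pullbackFun_ae l b F,
      ae_comp l (Lp.coeFn_smul c F), Lp.coeFn_smul c (pullbackFun l b F)]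
      with θ h1 h2 h3 h4
    rw [h1, RingHom.id_apply, h4, Pi.smul_apply, h2, h3, Pi.smul_apply, smul_eq_mul, smul_eq_mul]
    ring
  norm_map' F := by
    have h := inner_pullbackFun_self l b F F
    simp only [inner_self_eq_norm_sq_to_K] at h
    have h2 : ‖pullbackFun l b F‖ ^ 2 = ‖F‖ ^ 2 := by exact_mod_cast h
    exact (pow_left_inj₀ (norm_nonneg _) (norm_nonneg _) two_ne_zero).1 h2

theorem pullback_ae (b : Bool)
    (F : Lp ℂ 2 ((haarAddCircle : Measure UnitAddCircle).map l)) :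
    pullback l b F =ᵐ[haarAddCircle] fun θ => circSign b θ * F (l θ) := pullbackFun_ae l b F

/-- If `cos` is a measurable function of `l`, every function is a sum of an even and an odd one,
which are functions of `l` up to the sign of `sin`. -/
theorem exists_pullback (G : ℝ → ℝ) (hG : Measurable G)
    (hGl : ∀ θ, G (l θ) = circCos θ) (f : CircL2) :
    ∃ F : Bool → Lp ℂ 2 ((haarAddCircle : Measure UnitAddCircle).map l),
      f = ∑ b, pullback l b (F b) := by
  -- A measurable representative makes reflection and composition meaningful pointwise rather than
  -- almost everywhere.
  obtain ⟨f', hf'm, hf'⟩ := (Lp.aestronglyMeasurable f).aemeasurable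
  have hf'L : MemLp f' 2 (haarAddCircle : Measure UnitAddCircle) :=
    (memLp_congr_ae hf').1 (Lp.memLp f)
  have hf'N : MemLp (fun θ => f' (-θ)) 2 (haarAddCircle : Measure UnitAddCircle) :=
    hf'L.comp_measurePreserving (Measure.measurePreserving_neg haarAddCircle)
  let e : Bool → UnitAddCircle → ℂ := fun b θ =>
    if b then (f' θ - f' (-θ)) / 2 else (f' θ + f' (-θ)) / 2
  have hem : ∀ b, Measurable (e b) := by
    intro b
    cases b
    · exact ((hf'm.add (hf'm.comp measurable_neg)).div_const 2)
    · exact ((hf'm.sub (hf'm.comp measurable_neg)).div_const 2)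
  have heL : ∀ b, MemLp (e b) 2 (haarAddCircle : Measure UnitAddCircle) := by
    intro b
    cases b
    · simpa [e, div_eq_inv_mul] using (hf'L.add hf'N).const_mul (2⁻¹ : ℂ)
    · simpa [e, div_eq_inv_mul] using (hf'L.sub hf'N).const_mul (2⁻¹ : ℂ)
  -- An even or odd function is determined by its values on the upper half circle, whose point is
  -- recovered from `cos θ = G (l θ)`. The identity holds even where the sign is `0`: there `-η =
  -- η`, so the odd part vanishes.
  have key : ∀ b θ, circSign b θ * e b (circArccos (G (l θ))) = e b θ := by
    intro b θ
    have hc : circCos θ = circCos (circArccos (circCos θ)) :=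
      (circCos_circArccos (circCos_mem θ)).symm
    rw [hGl]
    set η := circArccos (circCos θ) with hη
    have hs : 0 ≤ circSin η := circSin_circArccos_nonneg _
    have hη1 : circSign true η * e true η = e true η := by
      rcases hs.eq_or_lt with h0 | h0
      · simp [e, neg_eq_self_of_circSin_eq_zero h0.symm]
      · simp [circSign, h0]
    rcases eq_or_eq_neg_of_circCos_eq hc with h | h
    · cases b
      · simp [circSign, ← h]
      · rw [h, hη1]
    · cases b
      · simp [circSign, e, h, add_comm]
      · rw [h, circSign_true_neg, neg_mul, hη1]
        simp only [e, if_true, neg_neg]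
        ring
  let F' : Bool → ℝ → ℂ := fun b x => e b (circArccos (G x))
  have hF'm : ∀ b, Measurable (F' b) := fun b => (hem b).comp (measurable_circArccos.comp hG)
  have hF'L : ∀ b, MemLp (F' b) 2 ((haarAddCircle : Measure UnitAddCircle).map l) := by
    intro b
    rw [memLp_map_measure_iff (hF'm b).aestronglyMeasurable l.continuous.aemeasurable]
    refine MemLp.of_le_mul (c := 1) (heL b)
      ((hF'm b).comp l.continuous.measurable).aestronglyMeasurable ?_
    filter_upwards [circSign_mul_self_ae b] with θ hθ
    have h1 : F' b (l θ) = circSign b θ * e b θ := by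
      rw [← key b θ, ← mul_assoc, hθ, one_mul]
    rw [Function.comp_apply, h1, norm_mul]
    gcongr
    exact norm_circSign_le b θ
  refine ⟨fun b => (hF'L b).toLp _, Lp.ext ?_⟩
  rw [Fintype.sum_bool]
  filter_upwards [hf', Lp.coeFn_add (pullback l true ((hF'L true).toLp _))
    (pullback l false ((hF'L false).toLp _)), pullback_ae l true ((hF'L true).toLp _),
    pullback_ae l false ((hF'L false).toLp _), ae_comp l (hF'L true).coeFn_toLp,
    ae_comp l (hF'L false).coeFn_toLp] with θ h1 h2 h3 h4 h5 h6
  rw [h2, Pi.add_apply, h3, h4, h5, h6, h1, key, key]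
  simp only [e, if_true, Bool.false_eq_true, if_false]
  ring

end Pullback

/-! ### The spectral multiplicity of a band -/

section Components

variable {α : Type} [MeasurableSpace α] {μ : Measure α} {m : ℕ}

/-- The `j`-th component of a vector-valued `L²` function. -/
def compL (j : Fin m) : Lp (EuclideanSpace ℂ (Fin m)) 2 μ →ₗ[ℂ] Lp ℂ 2 μ :=
  ((EuclideanSpace.proj j : EuclideanSpace ℂ (Fin m) →L[ℂ] ℂ).compLpL 2 μ).toLinearMap

theorem compL_ae (j : Fin m) (F : Lp (EuclideanSpace ℂ (Fin m)) 2 μ) :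
    compL j F =ᵐ[μ] fun x => F x j := by
  filter_upwards [(EuclideanSpace.proj j : EuclideanSpace ℂ (Fin m) →L[ℂ] ℂ).coeFn_compLpL F]
    with x hx
  exact hx

theorem norm_sq_eq_sum_compL (F : Lp (EuclideanSpace ℂ (Fin m)) 2 μ) :
    ‖F‖ ^ 2 = ∑ j, ‖compL j F‖ ^ 2 := by
  have h1 : (inner ℂ F F : ℂ) = ∑ j, inner ℂ (compL j F) (compL j F) := by
    simp_rw [L2.inner_def]
    rw [← integral_finsetSum _ fun j _ => L2.integrable_inner (compL j F) (compL j F)]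
    refine integral_congr_ae ?_
    have : ∀ᵐ x ∂μ, ∀ j, compL j F x = F x j := ae_all_iff.2 fun j => compL_ae j F
    filter_upwards [this] with x hx
    rw [PiLp.inner_apply]
    simp only [hx]
  simp only [inner_self_eq_norm_sq_to_K] at h1
  exact_mod_cast h1

theorem exists_compL_eq (f : Fin m → Lp ℂ 2 μ) :
    ∃ F : Lp (EuclideanSpace ℂ (Fin m)) 2 μ, ∀ j, compL j F = f j := by
  have hm : MemLp (fun x => (WithLp.toLp 2 fun j => f j x : EuclideanSpace ℂ (Fin m))) 2 μ := by
    have h : (fun x => (WithLp.toLp 2 fun j => f j x : EuclideanSpace ℂ (Fin m))) =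
        ∑ j, fun x => f j x • EuclideanSpace.single j (1 : ℂ) := by
      funext x
      ext i
      simp [Finset.sum_apply, Pi.single_apply]
    rw [h]
    refine memLp_finsetSum' _ fun j _ => ?_
    exact (ContinuousLinearMap.toSpanSingleton ℂ (EuclideanSpace.single j (1 : ℂ))).comp_memLp'
      (Lp.memLp (f j))
  refine ⟨hm.toLp _, fun j => Lp.ext ?_⟩
  filter_upwards [compL_ae j (hm.toLp _), hm.coeFn_toLp] with x h1 h2
  rw [h1, h2]

end Components

namespace DiagModel

variable {E : Type} [NormedAddCommGroup E] [InnerProductSpace ℂ E]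
variable {T : E →L[ℂ] E} {I : Type} [Fintype I] (D : DiagModel T I)

/-- The measure is the law of `l` under Haar measure. Each band in `J` contributes two copies of
`L²(μ)`, one from even and one from odd functions. The function `G` expresses that `l` determines
the cosine, without which these copies would not exhaust `L²` of the circle. -/
theorem hasSpectralMultiplicity (a b : ℝ) (J : Finset I)
    (l : C(UnitAddCircle, ℝ)) (hlJ : ∀ i ∈ J, D.lam i = l) (hin : ∀ θ, l θ ∈ Icc a b)
    (hout : ∀ i ∉ J, ∀ θ, D.lam i θ ∉ Icc a b) (hl : ∀ θ, l (-θ) = l θ)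
    (G : ℝ → ℝ) (hG : Measurable G) (hGl : ∀ θ, G (l θ) = circCos θ) :
    HasSpectralMultiplicity T (Icc a b) (2 * J.card) := by
  classical
  set μ : Measure ℝ := (haarAddCircle : Measure UnitAddCircle).map l with hμ
  have hprob : IsProbabilityMeasure μ := Measure.isProbabilityMeasure_map
    l.continuous.aemeasurable
  let e : Fin (2 * J.card) ≃ J × Bool :=
    (Fintype.equivFinOfCardEq (by simp [mul_comm])).symm
  let L : Lp (EuclideanSpace ℂ (Fin (2 * J.card))) 2 μ →ₗ[ℂ] E :=
    ∑ j, (D.U (e j).1).toLinearMap ∘ₗ (pullback l (e j).2).toLinearMap ∘ₗ compL j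
  have hL : ∀ F, L F = ∑ j, D.U (e j).1 (pullback l (e j).2 (compL j F)) := by
    intro F
    simp [L, LinearMap.sum_apply]
  let φ : Lp (EuclideanSpace ℂ (Fin (2 * J.card))) 2 μ → I → CircL2 := fun F i =>
    if h : i ∈ J then ∑ c, pullback l c (compL (e.symm (⟨i, h⟩, c)) F) else 0
  have hLφ : ∀ F, L F = ∑ i, D.U i (φ F i) := by
    intro F
    rw [hL, ← e.symm.sum_comp, Fintype.sum_prod_type]
    simp only [Equiv.apply_symm_apply]
    have h1 : ∀ i : J, ∑ c, D.U i (pullback l c (compL (e.symm (i, c)) F)) = D.U i (φ F i) := by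
      intro i
      simp only [φ, i.2, dif_pos, map_sum]
    simp_rw [h1]
    rw [Finset.sum_coe_sort J (fun i => D.U i (φ F i))]
    refine Finset.sum_subset (Finset.subset_univ J) fun i _ hi => ?_
    simp [φ, hi]
  have hnorm : ∀ F, ‖L F‖ = ‖F‖ := by
    intro F
    have hpb : ∀ f : Bool → Lp ℂ 2 μ, ‖∑ c, pullback l c (f c)‖ ^ 2 = ∑ c, ‖f c‖ ^ 2 := by
      intro f
      rw [Fintype.sum_bool, Fintype.sum_bool, @norm_add_sq ℂ,
        show inner ℂ (pullback l true (f true)) (pullback l false (f false)) = 0 from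
          inner_pullbackFun_ne l hl (by simp) _ _, LinearIsometry.norm_map,
        LinearIsometry.norm_map]
      simp
    have h1 : ‖L F‖ ^ 2 = ‖F‖ ^ 2 := by
      rw [hLφ, D.norm_sq_sum, norm_sq_eq_sum_compL F, ← e.symm.sum_comp, Fintype.sum_prod_type]
      rw [← Finset.sum_subset (Finset.subset_univ J), ← Finset.sum_coe_sort J]
      · refine Finset.sum_congr rfl fun i _ => ?_
        rw [← hpb]
        simp only [φ, i.2, dif_pos]
      · intro i _ hi
        simp [φ, hi]
    exact (pow_left_inj₀ (norm_nonneg _) (norm_nonneg _) two_ne_zero).1 h1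
  have hcrit := fun f => D.mem_spectralSubspace_iff f a b (· ∈ J)
    (fun i hi θ => by rw [hlJ i hi]; exact hin θ) hout
  refine ⟨μ, inferInstance, ?_, ?_, ⟨L, hnorm⟩, ?_, ?_⟩
  · exact IsProbabilityMeasure.ne_zero μ
  · rw [hμ, Measure.map_apply l.continuous.measurable measurableSet_Icc.compl]
    have : l ⁻¹' (Icc a b)ᶜ = ∅ := by
      ext θ
      simpa using hin θ
    rw [this, measure_empty]
  · ext u
    constructor
    · rintro ⟨F, rfl⟩
      change L F ∈ _
      rw [hLφ, hcrit]
      intro i hi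
      simp [φ, hi]
    · intro hu
      obtain ⟨f, rfl⟩ := D.complete u
      rw [hcrit] at hu
      choose F hF using fun i => exists_pullback l G hG hGl (f i)
      obtain ⟨K, hK⟩ := exists_compL_eq (fun j => F (e j).1 (e j).2)
      refine ⟨K, ?_⟩
      change L K = _
      rw [hLφ]
      refine Finset.sum_congr rfl fun i _ => ?_
      congr 1
      by_cases hi : i ∈ J
      · simp only [φ, hi, dif_pos, hK, Equiv.apply_symm_apply]
        exact (hF i).symm
      · simp [φ, hi, hu i hi]
  · intro F K hFK
    change T (L F) = L K
    rw [hL, hL, map_sum]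
    refine Finset.sum_congr rfl fun j _ => ?_
    rw [D.intertwine, hlJ _ (e j).1.2]
    congr 1
    refine Lp.ext ?_
    filter_upwards [mulC_ae (ofRealC l) (pullback l (e j).2 (compL j F)),
      pullback_ae l (e j).2 (compL j F), pullback_ae l (e j).2 (compL j K),
      ae_comp l (compL_ae j F), ae_comp l (compL_ae j K), ae_comp l hFK] with θ h1 h2 h3 h4 h5 h6
    rw [h1, h2, h3, h4, h5, h6]
    simp
    ring

end DiagModel

end
end Nanotube

namespace Nanotube
noncomputable section

/-! ### Determinants of cyclic tridiagonal matrices -/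

section Corner

open Matrix

variable {R : Type} [CommRing R]

/-- Multilinearity of the determinant in the first and last rows: the coefficients linear in one
corner are cofactors, and the mixed one depends only on the product `x * y`. -/
theorem det_update_corners {n : ℕ} (hn : n ≠ 0) (M : Matrix (Fin (n + 1)) (Fin (n + 1)) R)
    (x y : R) :
    ((M.updateRow 0 (M 0 + x • Pi.single (Fin.last n) 1)).updateRow (Fin.last n)
      (M (Fin.last n) + y • Pi.single 0 1)).det =
    M.det + x * M.adjugate (Fin.last n) 0 + y * M.adjugate 0 (Fin.last n) +
      x * y * ((M.updateRow 0 (Pi.single (Fin.last n) 1)).updateRow (Fin.last n)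
        (Pi.single 0 1)).det := by
  have hne : (Fin.last n) ≠ 0 := by
    intro h
    exact hn (by simpa using congrArg Fin.val h)
  have h1 : ∀ w, (M.updateRow 0 w).updateRow (Fin.last n) (M (Fin.last n)) = M.updateRow 0 w := by
    intro w
    have : M (Fin.last n) = (M.updateRow 0 w) (Fin.last n) := by
      rw [updateRow_ne hne]
    rw [this, updateRow_eq_self]
  rw [det_updateRow_add, det_updateRow_smul, h1, det_updateRow_add, det_updateRow_smul,
    updateRow_eq_self, updateRow_comm _ hne.symm, det_updateRow_add, det_updateRow_smul,
    ← updateRow_comm _ hne.symm, updateRow_eq_self, adjugate_apply, adjugate_apply,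
    updateRow_comm _ hne.symm]
  ring

/-- Deleting the relevant row and column leaves a triangular matrix with the subdiagonal of `M` on
its diagonal. The cofactor sign `(-1) ^ n` is distributed over the `n` factors. -/
theorem adjugate_last_zero {n : ℕ} (M : Matrix (Fin (n + 1)) (Fin (n + 1)) R)
    (h : ∀ i j : Fin (n + 1), (j : ℕ) + 1 < i → M i j = 0) :
    M.adjugate (Fin.last n) 0 = ∏ i : Fin n, -M i.succ i.castSucc := by
  rw [adjugate_fin_succ_eq_det_submatrix, det_of_isUpperTriangular, Finset.prod_neg]
  · simp
  · intro i j hij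
    have hij' : (j : ℕ) < i := hij
    simp only [submatrix_apply, Fin.succAbove_zero, Fin.succAbove_last]
    exact h _ _ (by simpa using hij')

theorem adjugate_zero_last {n : ℕ} (M : Matrix (Fin (n + 1)) (Fin (n + 1)) R)
    (h : ∀ i j : Fin (n + 1), (i : ℕ) + 1 < j → M i j = 0) :
    M.adjugate 0 (Fin.last n) = ∏ i : Fin n, -M i.castSucc i.succ := by
  rw [adjugate_fin_succ_eq_det_submatrix, det_of_isLowerTriangular, Finset.prod_neg]
  · simp
  · intro i j hij
    have hij' : (i : ℕ) < j := hij
    simp only [submatrix_apply, Fin.succAbove_zero, Fin.succAbove_last]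
    exact h _ _ (by simpa using hij')

end Corner

/-- The cyclic successor. -/
def cycNext {m : ℕ} (i : Fin m) : Fin m :=
  if h : (i : ℕ) + 1 < m then ⟨i + 1, h⟩ else ⟨0, i.pos⟩

/-- The cyclic predecessor. -/
def cycPrev {m : ℕ} (i : Fin m) : Fin m :=
  ⟨if (i : ℕ) = 0 then m - 1 else i - 1, by split_ifs <;> omega⟩

theorem cycNext_val {m : ℕ} (i : Fin m) :
    ((cycNext i : Fin m) : ℕ) = if (i : ℕ) + 1 = m then 0 else (i : ℕ) + 1 := by
  unfold cycNext
  have := i.2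
  split_ifs with h1 h2 h2
  · omega
  · rfl
  · rfl
  · omega

theorem cycPrev_val {m : ℕ} (i : Fin m) :
    ((cycPrev i : Fin m) : ℕ) = if (i : ℕ) = 0 then m - 1 else (i : ℕ) - 1 := rfl

/-- The matrix of `a_{n-1} y_{n-1} + a_n y_{n+1} + u_n y_n` on sequences with
`y_{n+m} = τ y_n`. -/
def cycMatrix {𝕜 : Type} [Field 𝕜] (m : ℕ) (a u : ℤ → 𝕜) (τ : 𝕜) :
    Matrix (Fin m) (Fin m) 𝕜 := fun i j =>
  (if i = j then u ((i : ℕ) + 1) else 0) +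
    (if j = cycNext i then a ((i : ℕ) + 1) * (if (i : ℕ) + 1 = m then τ else 1) else 0) +
    (if j = cycPrev i then a (i : ℕ) * (if (i : ℕ) = 0 then τ⁻¹ else 1) else 0)

theorem floquetMatrix_eq_cycMatrix {m : ℕ} (hm : 2 ≤ m) (a u : ℤ → ℝ) (τ : ℝ) :
    floquetMatrix m a u τ = cycMatrix m a u τ := by
  ext i j
  have hi := i.2
  have hj := j.2
  simp only [floquetMatrix, cycMatrix, Fin.ext_iff, cycNext_val, cycPrev_val]
  rcases Nat.eq_zero_or_pos (i : ℕ) with h0 | h0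
  · have e1 : ¬ ((i : ℕ) + 1 = m) := by omega
    have e2 : ¬ ((i : ℕ) = j + 1) := by omega
    have e3 : ((j : ℕ) + 1 = m) ↔ ((j : ℕ) = m - 1) := by omega
    have e4 : ¬ (0 + 1 = m) := by omega
    simp only [h0, e3, e4, true_and, false_and, if_true, if_false, mul_one, h0 ▸ e2]
    split_ifs <;> simp [mul_comm]
  · have e0 : ¬ ((i : ℕ) = 0) := by omega
    have e2 : ((i : ℕ) = j + 1) ↔ (j : ℕ) = i - 1 := by omega
    rcases Nat.lt_or_ge ((i : ℕ) + 1) m with h1 | h1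
    · have e1 : ¬ ((i : ℕ) + 1 = m) := by omega
      simp only [e0, e1, e2, false_and, if_false, mul_one, add_zero]
    · have e1 : (i : ℕ) + 1 = m := by omega
      have e3 : ¬ ((j : ℕ) = i + 1) := by omega
      have e4 : ((i : ℤ) + 1) = m := by omega
      have e5 : ¬ ((j : ℕ) = m) := by omega
      simp only [e0, e1, e2, e4, e5, false_and, true_and, if_false, if_true, mul_one, add_zero]
      rw [add_right_comm, mul_comm τ]

/-- The product of the off-diagonal coefficients over a period. -/
def cycProd {𝕜 : Type} [Field 𝕜] (m : ℕ) (a : ℤ → 𝕜) : 𝕜 := ∏ i : Fin m, a (i : ℕ)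

/-- The corners are `-a 0 * τ⁻¹` and `-a 0 * τ`. Their product does not involve `τ`, and each linear
cofactor is the product of the remaining off-diagonal coefficients, so the dependence on `τ` is
`-cycProd m a * (τ + τ⁻¹)`. -/
theorem det_sub_cycMatrix {𝕜 : Type} [Field 𝕜] {m : ℕ} (hm : 3 ≤ m) (a u : ℤ → 𝕜)
    (ha : a m = a 0) (z τ : 𝕜) (hτ : τ ≠ 0) :
    (Matrix.scalar (Fin m) z - cycMatrix m a u τ).det =
      (Matrix.scalar (Fin m) z - cycMatrix m a u 1).det + cycProd m a * (2 - τ - τ⁻¹) := by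
  obtain ⟨n, rfl⟩ : ∃ n, m = n + 1 := ⟨m - 1, by omega⟩
  have hn : 2 ≤ n := by omega
  set M : Matrix (Fin (n + 1)) (Fin (n + 1)) 𝕜 := fun i j =>
    (if i = j then z - u ((i : ℕ) + 1) else 0) -
    (if (j : ℕ) = i + 1 then a ((i : ℕ) + 1) else 0) -
    (if (i : ℕ) = j + 1 then a (i : ℕ) else 0) with hM
  have key : ∀ σ : 𝕜, Matrix.scalar (Fin (n + 1)) z - cycMatrix (n + 1) a u σ =
      ((M.updateRow 0 (M 0 + (-(a 0 * σ⁻¹)) • Pi.single (Fin.last n) 1)).updateRow (Fin.last n)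
      (M (Fin.last n) + (-(a 0 * σ)) • Pi.single 0 1)) := by
    intro σ
    ext i j
    have hi := i.2
    have hj := j.2
    rw [Matrix.sub_apply, Matrix.scalar_apply, Matrix.diagonal_apply, Matrix.updateRow_apply,
      Matrix.updateRow_apply]
    simp only [cycMatrix, hM, Fin.ext_iff, cycNext_val, cycPrev_val, Fin.val_last, Fin.val_zero,
      Pi.add_apply, Pi.smul_apply, Pi.single_apply, smul_eq_mul]
    rcases Nat.eq_zero_or_pos (i : ℕ) with h0 | h0
    · have e1 : ¬ ((i : ℕ) = n) := by omega
      have e2 : ¬ ((i : ℕ) = j + 1) := by omega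
      have e4 : ¬ (0 + 1 = n + 1) := by omega
      have e5 : ¬ (0 = n) := by omega
      have e6 : ¬ (0 = (j : ℕ) + 1) := by omega
      simp only [h0, e4, e5, e6, if_true, if_false, mul_one, Nat.cast_zero, Nat.add_sub_cancel]
      split_ifs <;> first | (exfalso; omega) | ring
    · have e0 : ¬ ((i : ℕ) = 0) := by omega
      have e2 : ((i : ℕ) = j + 1) ↔ (j : ℕ) = i - 1 := by omega
      rcases Nat.lt_or_ge ((i : ℕ) + 1) (n + 1) with h1 | h1
      · have e1 : ¬ ((i : ℕ) + 1 = n + 1) := by omega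
        have e3 : ¬ ((i : ℕ) = n) := by omega
        simp only [e0, e1, e2, e3, if_false, mul_one]
        split_ifs <;> ring
      · have e1 : (i : ℕ) = n := by omega
        have e5 : ¬ (n = 0) := by omega
        have e6 : ¬ ((j : ℕ) = n + 1) := by omega
        have e7 : (n = j + 1) ↔ (j : ℕ) = n - 1 := by omega
        have e8 : a ((n : ℤ) + 1) = a 0 := by rw [← ha]; push_cast; rfl
        simp only [e1, e5, e6, e7, e8, if_false, if_true, mul_one]
        split_ifs <;> first | (exfalso; omega) | ring
  have h1 : M.adjugate (Fin.last n) 0 = ∏ i : Fin n, a ((i : ℕ) + 1) := by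
    rw [adjugate_last_zero]
    · refine Finset.prod_congr rfl fun i _ => ?_
      have e1 : ¬ ((i : ℕ) = i + 1 + 1) := by omega
      simp [hM, Fin.ext_iff, e1]
    · intro i j hij
      have e1 : ¬ (i = j) := by rintro rfl; omega
      have e2 : ¬ ((j : ℕ) = i + 1) := by omega
      have e3 : ¬ ((i : ℕ) = j + 1) := by omega
      simp [hM, e1, e2, e3]
  have h2 : M.adjugate 0 (Fin.last n) = ∏ i : Fin n, a ((i : ℕ) + 1) := by
    rw [adjugate_zero_last]
    · refine Finset.prod_congr rfl fun i _ => ?_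
      have e1 : ¬ ((i : ℕ) = i + 1 + 1) := by omega
      simp [hM, Fin.ext_iff, e1]
    · intro i j hij
      have e1 : ¬ (i = j) := by rintro rfl; omega
      have e2 : ¬ ((j : ℕ) = i + 1) := by omega
      have e3 : ¬ ((i : ℕ) = j + 1) := by omega
      simp [hM, e1, e2, e3]
  have h3 : cycProd (n + 1) a = a 0 * ∏ i : Fin n, a ((i : ℕ) + 1) := by
    rw [cycProd, Fin.prod_univ_succ]
    simp
  rw [key, key, det_update_corners (by omega), det_update_corners (by omega), h1, h2, h3]
  field_simp
  ring

end
end Nanotube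

/-! ### Gershgorin localization and the energy levels of a separated periodic Jacobi operator. -/

namespace Nanotube
noncomputable section

open Matrix

theorem cycMatrix_mulVec {𝕜 : Type} [Field 𝕜] {m : ℕ} (a u : ℤ → 𝕜) (τ : 𝕜) (f : Fin m → 𝕜)
    (i : Fin m) :
    (cycMatrix m a u τ *ᵥ f) i = u ((i : ℕ) + 1) * f i +
      a ((i : ℕ) + 1) * (if (i : ℕ) + 1 = m then τ else 1) * f (cycNext i) +
      a (i : ℕ) * (if (i : ℕ) = 0 then τ⁻¹ else 1) * f (cycPrev i) := by
  simp only [Matrix.mulVec, dotProduct, cycMatrix, add_mul, Finset.sum_add_distrib, ite_mul,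
    zero_mul, Finset.sum_ite_eq, Finset.sum_ite_eq', Finset.mem_univ, if_true]

theorem scalar_sub_mulVec {𝕜 : Type} [Field 𝕜] {m : ℕ} (A : Matrix (Fin m) (Fin m) 𝕜) (z : 𝕜)
    (f : Fin m → 𝕜) : (Matrix.scalar (Fin m) z - A) *ᵥ f = z • f - A *ᵥ f := by
  rw [Matrix.sub_mulVec]
  congr 1
  ext i
  simp [Matrix.scalar_apply, Matrix.mulVec_diagonal]

/-- Gershgorin's argument, stated for a single row at which `f` has maximal modulus. Only the
equation of that row is needed, which allows its use for matrices in which another row has been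
replaced. -/
theorem norm_sub_le_of_row {𝕜 : Type} [NormedField 𝕜] {m : ℕ} (a u : ℤ → 𝕜) (τ : 𝕜)
    (hτ : ‖τ‖ = 1) (ha : ∀ n, ‖a n‖ + ‖a (n + 1)‖ ≤ 3) (z : 𝕜) (f : Fin m → 𝕜) (k : Fin m)
    (hk : ∀ j, ‖f j‖ ≤ ‖f k‖) (hfk : f k ≠ 0) (h : (cycMatrix m a u τ *ᵥ f) k = z * f k) :
    ‖z - u ((k : ℕ) + 1)‖ ≤ 3 := by
  rw [cycMatrix_mulVec] at h
  have h1 : (z - u ((k : ℕ) + 1)) * f k =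
      a ((k : ℕ) + 1) * (if (k : ℕ) + 1 = m then τ else 1) * f (cycNext k) +
      a (k : ℕ) * (if (k : ℕ) = 0 then τ⁻¹ else 1) * f (cycPrev k) := by
    linear_combination -h
  have hpos : 0 < ‖f k‖ := norm_pos_iff.2 hfk
  have e1 : ‖(if (k : ℕ) + 1 = m then τ else 1)‖ = 1 := by split_ifs <;> simp [hτ]
  have e2 : ‖(if (k : ℕ) = 0 then τ⁻¹ else 1)‖ = 1 := by split_ifs <;> simp [hτ]
  have h2 : ‖z - u ((k : ℕ) + 1)‖ * ‖f k‖ ≤ 3 * ‖f k‖ := by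
    rw [← norm_mul, h1]
    refine (norm_add_le _ _).trans ?_
    rw [norm_mul, norm_mul, norm_mul, norm_mul, e1, e2, mul_one, mul_one]
    calc _ ≤ ‖a ((k : ℕ) + 1)‖ * ‖f k‖ + ‖a (k : ℕ)‖ * ‖f k‖ := by
          gcongr
          · exact hk _
          · exact hk _
      _ = (‖a (k : ℕ)‖ + ‖a ((k : ℕ) + 1)‖) * ‖f k‖ := by ring
      _ ≤ _ := by gcongr; exact ha _
  exact le_of_mul_le_mul_right h2 hpos

theorem det_ne_zero_of_far {𝕜 : Type} [NormedField 𝕜] {m : ℕ} (hm : m ≠ 0) (a u : ℤ → 𝕜) (τ : 𝕜)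
    (hτ : ‖τ‖ = 1) (ha : ∀ n, ‖a n‖ + ‖a (n + 1)‖ ≤ 3) (z : 𝕜)
    (hz : ∀ k : Fin m, 3 < ‖z - u ((k : ℕ) + 1)‖) :
    (Matrix.scalar (Fin m) z - cycMatrix m a u τ).det ≠ 0 := by
  intro h0
  obtain ⟨f, hf, hfz⟩ := Matrix.exists_mulVec_eq_zero_iff.2 h0
  rw [scalar_sub_mulVec, sub_eq_zero] at hfz
  have : Nonempty (Fin m) := ⟨⟨0, Nat.pos_of_ne_zero hm⟩⟩
  obtain ⟨k, hk⟩ := Finite.exists_max fun j => ‖f j‖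
  have hfk : f k ≠ 0 := by
    intro hk0
    refine hf (funext fun j => ?_)
    have := hk j
    rw [hk0, norm_zero] at this
    exact norm_le_zero_iff.1 this
  have := norm_sub_le_of_row a u τ hτ ha z f k hk hfk (by rw [← hfz]; rfl)
  exact absurd (hz k) (not_lt.2 this)

/-- A periodic Jacobi operator whose potential is strongly separated. -/
structure SepJacobi (m : ℕ) (a u : ℤ → ℝ) : Prop where
  hm : 3 ≤ m
  a_per : Function.Periodic a (m : ℤ)
  u_per : Function.Periodic u (m : ℤ)
  a_nonneg : ∀ n, 0 ≤ a n
  a_add_le : ∀ n, a n + a (n + 1) ≤ 3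
  -- Levels lie within `4` of their sites, slightly more than the Gershgorin radius `3`. A
  -- separation of `20` keeps levels of different sites at least `12 = 20 - 4 - 4` apart.
  sep : ∀ i j : Fin m, i ≠ j → 20 ≤ |u ((i : ℕ) + 1) - u ((j : ℕ) + 1)|

/-- The characteristic polynomial at quasi-momentum `θ`, as a function of `x = cos θ`. -/
def levelPoly (m : ℕ) (a u : ℤ → ℝ) (x : ℝ) : Polynomial ℝ :=
  (cycMatrix m a u 1).charpoly + Polynomial.C (2 * cycProd m a * (1 - x))

/-- The energy level near `u_{i+1}`. -/
def level (m : ℕ) (a u : ℤ → ℝ) (i : Fin m) (x : ℝ) : ℝ :=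
  Classical.epsilon fun z => |z - u ((i : ℕ) + 1)| < 4 ∧ (levelPoly m a u x).eval z = 0

namespace SepJacobi

variable {m : ℕ} {a u : ℤ → ℝ} (h : SepJacobi m a u)
include h

theorem norm_add_le (n : ℤ) : ‖a n‖ + ‖a (n + 1)‖ ≤ 3 := by
  rw [Real.norm_of_nonneg (h.a_nonneg n), Real.norm_of_nonneg (h.a_nonneg _)]
  exact h.a_add_le n

theorem a_m : a m = a 0 := by
  have := h.a_per 0
  rwa [zero_add] at this

theorem cycProd_nonneg : 0 ≤ cycProd m a := Finset.prod_nonneg fun _ _ => h.a_nonneg _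

theorem charpoly_cycMatrix (τ : ℝ) (hτ : τ ≠ 0) :
    (cycMatrix m a u τ).charpoly = levelPoly m a u ((τ + τ⁻¹) / 2) := by
  refine Polynomial.funext fun z => ?_
  rw [levelPoly, Polynomial.eval_add, Polynomial.eval_C, Matrix.eval_charpoly,
    Matrix.eval_charpoly, det_sub_cycMatrix h.hm a u h.a_m z τ hτ]
  ring

/-- On the unit circle `τ⁻¹` is the conjugate of `τ`, so `τ + τ⁻¹` is twice the real part and the
determinant is real. -/
theorem det_complex (z : ℝ) (τ : ℂ) (hτ : ‖τ‖ = 1) :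
    (Matrix.scalar (Fin m) (z : ℂ) -
      cycMatrix m (fun n => (a n : ℂ)) (fun n => (u n : ℂ)) τ).det =
      (((levelPoly m a u τ.re).eval z : ℝ) : ℂ) := by
  have hτ0 : τ ≠ 0 := by
    rintro rfl
    simp at hτ
  rw [det_sub_cycMatrix h.hm _ _ (by simp [h.a_m]) _ τ hτ0, levelPoly, Polynomial.eval_add,
    Polynomial.eval_C, Matrix.eval_charpoly]
  have h1 : (Matrix.scalar (Fin m) (z : ℂ) -
      cycMatrix m (fun n => (a n : ℂ)) (fun n => (u n : ℂ)) 1) =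
      (Matrix.scalar (Fin m) z - cycMatrix m a u 1).map Complex.ofRealHom := by
    ext i j
    simp only [Matrix.sub_apply, Matrix.map_apply, Matrix.scalar_apply, Matrix.diagonal_apply,
      cycMatrix, inv_one, ite_self, mul_one]
    simp only [map_sub, map_add, apply_ite Complex.ofRealHom, map_zero, Complex.ofRealHom_eq_coe]
  have h2 : cycProd m (fun n => (a n : ℂ)) = ((cycProd m a : ℝ) : ℂ) := by
    simp [cycProd]
  have h3 : τ⁻¹ = (starRingEnd ℂ) τ := by
    rw [Complex.inv_def, Complex.normSq_eq_norm_sq, hτ]; simp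
  have h4 : τ + τ⁻¹ = ((2 * τ.re : ℝ) : ℂ) := by
    rw [h3, Complex.add_conj]
  rw [h1, ← RingHom.mapMatrix_apply, ← RingHom.map_det, h2, sub_sub, h4]
  simp
  ring

theorem levelPoly_monic (x : ℝ) : (levelPoly m a u x).Monic := by
  refine (Matrix.charpoly_monic _).add_of_left ?_
  refine Polynomial.degree_C_le.trans_lt ?_
  rw [Matrix.charpoly_degree_eq_dim, Fintype.card_fin]
  have := h.hm
  exact_mod_cast (by omega : 0 < m)

omit h in
theorem levelPoly_natDegree (x : ℝ) : (levelPoly m a u x).natDegree = m := by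
  rw [levelPoly, Polynomial.natDegree_add_C, Matrix.charpoly_natDegree_eq_dim, Fintype.card_fin]

/-- Outside the windows the sign of the characteristic polynomial is that of the diagonal one. -/
theorem charpoly_sign (τ : ℝ) (hτ : ‖τ‖ = 1) (z : ℝ)
    (hz : ∀ k : Fin m, 3 < |z - u ((k : ℕ) + 1)|) :
    0 < (cycMatrix m a u τ).charpoly.eval z * ∏ k : Fin m, (z - u ((k : ℕ) + 1)) := by
  -- Homotopy: the off-diagonal coefficients are scaled by `s ∈ [0, 1]`. Gershgorin's bound keeps
  -- the determinant nonzero throughout, so its sign at `s = 1` is the one at `s = 0`, where the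
  -- matrix is diagonal.
  set f : ℝ → ℝ := fun s => (Matrix.scalar (Fin m) z - cycMatrix m (fun n => s * a n) u τ).det
    with hf
  have hcont : Continuous f := by
    refine Continuous.matrix_det (continuous_matrix fun i j => ?_)
    simp only [Matrix.sub_apply, cycMatrix]
    refine continuous_const.sub ((continuous_const.add ?_).add ?_) <;>
    · split_ifs <;> fun_prop
  have hne : ∀ s ∈ Icc (0 : ℝ) 1, f s ≠ 0 := by
    intro s hs
    refine det_ne_zero_of_far (by have := h.hm; omega) _ u τ hτ (fun n => ?_) z hz
    have h1 := h.norm_add_le n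
    have h2 : ‖s‖ ≤ 1 := by rw [Real.norm_of_nonneg hs.1]; exact hs.2
    rw [norm_mul, norm_mul, ← mul_add]
    have := norm_nonneg (a n)
    have := norm_nonneg (a (n + 1))
    nlinarith [norm_nonneg s]
  have h0 : f 0 = ∏ k : Fin m, (z - u ((k : ℕ) + 1)) := by
    have : Matrix.scalar (Fin m) z - cycMatrix m (fun n => (0 : ℝ) * a n) u τ =
        Matrix.diagonal fun k : Fin m => z - u ((k : ℕ) + 1) := by
      ext i j
      rw [Matrix.sub_apply, Matrix.scalar_apply, Matrix.diagonal_apply, Matrix.diagonal_apply]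
      simp only [cycMatrix, zero_mul, ite_self, add_zero]
      split_ifs <;> simp
    simp only [hf]
    rw [this, Matrix.det_diagonal]
  have h1 : f 1 = (cycMatrix m a u τ).charpoly.eval z := by
    simp only [hf, one_mul, Matrix.eval_charpoly]
  rw [← h0, ← h1]
  by_contra hcon
  push Not at hcon
  have hz0 : (0 : ℝ) ∈ uIcc (f 0) (f 1) := by
    rw [mem_uIcc]
    rcases le_total (f 0) 0 with h2 | h2
    · rcases le_total 0 (f 1) with h3 | h3
      · exact Or.inl ⟨h2, h3⟩
      · have := hne 0 (by simp)
        have := hne 1 (by simp)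
        have : 0 < f 1 * f 0 := mul_pos_of_neg_of_neg (lt_of_le_of_ne h3 ‹_›)
          (lt_of_le_of_ne h2 ‹_›)
        linarith
    · rcases le_total 0 (f 1) with h3 | h3
      · have := hne 0 (by simp)
        have := hne 1 (by simp)
        have : 0 < f 1 * f 0 := mul_pos (lt_of_le_of_ne h3 (Ne.symm ‹_›))
          (lt_of_le_of_ne h2 (Ne.symm ‹_›))
        linarith
      · exact Or.inr ⟨h3, h2⟩
  obtain ⟨s, hs, hs0⟩ := intermediate_value_uIcc (a := (0 : ℝ)) (b := 1) hcont.continuousOn hz0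
  rw [uIcc_of_le zero_le_one] at hs
  exact hne s hs hs0

/-- The value of `levelPoly` at `z` is affine in `x`, so it suffices to know the sign at `x = 1` and
`x = -1`, the periodic and antiperiodic cases. -/
theorem levelPoly_sign (x : ℝ) (hx : x ∈ Icc (-1 : ℝ) 1) (z : ℝ)
    (hz : ∀ k : Fin m, 3 < |z - u ((k : ℕ) + 1)|) :
    0 < (levelPoly m a u x).eval z * ∏ k : Fin m, (z - u ((k : ℕ) + 1)) := by
  have h1 := h.charpoly_sign 1 (by simp) z hz
  have h2 := h.charpoly_sign (-1) (by simp) z hz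
  rw [h.charpoly_cycMatrix (-1) (by norm_num)] at h2
  simp only [levelPoly, Polynomial.eval_add, Polynomial.eval_C] at h2 ⊢
  norm_num at h2
  obtain ⟨hx1, hx2⟩ := hx
  rcases hx1.eq_or_lt with rfl | hx1
  · convert h2 using 2; ring
  · nlinarith

/-- The points at distance `4` on either side of a site avoid all discs of radius `3`, and the
diagonal product changes sign between them. The intermediate value theorem then gives a root. -/
theorem exists_level (x : ℝ) (hx : x ∈ Icc (-1 : ℝ) 1) (i : Fin m) :
    ∃ z, |z - u ((i : ℕ) + 1)| < 4 ∧ (levelPoly m a u x).eval z = 0 := by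
  have hsep : ∀ k : Fin m, k ≠ i → 20 ≤ |u ((i : ℕ) + 1) - u ((k : ℕ) + 1)| :=
    fun k hk => h.sep i k hk.symm
  set c := u ((i : ℕ) + 1) with hc
  have hfar : ∀ s : ℝ, |s| = 4 → ∀ k : Fin m, 3 < |c + s - u ((k : ℕ) + 1)| := by
    intro s hs k
    by_cases hk : k = i
    · subst hk
      rw [← hc, add_sub_cancel_left, hs]; norm_num
    · have := hsep k hk
      have h2 := abs_sub_abs_le_abs_sub (c - u ((k : ℕ) + 1)) (-s)
      rw [abs_neg, hs, show c - u ((k : ℕ) + 1) - -s = c + s - u ((k : ℕ) + 1) by ring] at h2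
      linarith
  have hp := h.levelPoly_sign x hx (c + 4) (hfar 4 (by norm_num))
  have hn := h.levelPoly_sign x hx (c + -4) (hfar (-4) (by norm_num))
  -- Paired over the two points, the factor of site `i` is `4 * (-4)`, while every other one is `d ^
  -- 2 - 16` with `|d| ≥ 20`.
  have hprod : (∏ k : Fin m, (c + 4 - u ((k : ℕ) + 1))) *
      (∏ k : Fin m, (c + -4 - u ((k : ℕ) + 1))) < 0 := by
    rw [← Finset.prod_mul_distrib, ← Finset.mul_prod_erase _ _ (Finset.mem_univ i)]
    refine mul_neg_of_neg_of_pos ?_ (Finset.prod_pos fun k hk => ?_)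
    · rw [← hc]; ring_nf; norm_num
    · have h1 := hsep k (Finset.ne_of_mem_erase hk)
      have h2 : (20 : ℝ) ^ 2 ≤ (c - u ((k : ℕ) + 1)) ^ 2 := by
        rw [← sq_abs (c - u ((k : ℕ) + 1))]
        gcongr
      nlinarith
  set f : ℝ → ℝ := fun z => (levelPoly m a u x).eval z with hf
  have hcont : Continuous f := (levelPoly m a u x).continuous
  have hprod2 : f (c + 4) * f (c + -4) < 0 := by
    have := mul_pos hp hn
    by_contra hcon
    push Not at hcon
    nlinarith
  have hz0 : (0 : ℝ) ∈ uIcc (f (c + -4)) (f (c + 4)) := by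
    rw [mem_uIcc]
    rcases mul_neg_iff.1 hprod2 with h3 | h3
    · exact Or.inl ⟨h3.2.le, h3.1.le⟩
    · exact Or.inr ⟨h3.1.le, h3.2.le⟩
  obtain ⟨z, hz, hzero⟩ := intermediate_value_uIcc hcont.continuousOn hz0
  rw [uIcc_of_le (by linarith)] at hz
  refine ⟨z, ?_, hzero⟩
  have hne1 : z ≠ c + -4 := by
    rintro rfl
    rw [hzero] at hprod2; simp at hprod2
  have hne2 : z ≠ c + 4 := by
    rintro rfl
    rw [hzero] at hprod2; simp at hprod2
  have h1 := lt_of_le_of_ne hz.1 hne1.symm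
  have h2 := lt_of_le_of_ne hz.2 hne2
  rw [abs_lt]
  constructor <;> linarith

theorem level_spec (x : ℝ) (hx : x ∈ Icc (-1 : ℝ) 1) (i : Fin m) :
    |level m a u i x - u ((i : ℕ) + 1)| < 4 ∧ (levelPoly m a u x).eval (level m a u i x) = 0 :=
  Classical.epsilon_spec (p := fun z => |z - u ((i : ℕ) + 1)| < 4 ∧
    (levelPoly m a u x).eval z = 0) (h.exists_level x hx i)

theorem level_sub_far {x x' : ℝ} (hx : x ∈ Icc (-1 : ℝ) 1) (hx' : x' ∈ Icc (-1 : ℝ) 1)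
    {i j : Fin m} (hij : i ≠ j) : 12 ≤ |level m a u i x - level m a u j x'| := by
  have h1 := (h.level_spec x hx i).1
  have h2 := (h.level_spec x' hx' j).1
  have h3 := h.sep i j hij
  rw [abs_lt] at h1 h2
  rcases le_abs'.1 h3 with h4 | h4
  · exact le_abs'.2 (Or.inl (by linarith))
  · exact le_abs'.2 (Or.inr (by linarith))

theorem level_sub_sign {x x' : ℝ} (hx : x ∈ Icc (-1 : ℝ) 1) (hx' : x' ∈ Icc (-1 : ℝ) 1)
    {i j : Fin m} (hij : i ≠ j) :
    0 < (level m a u i x - level m a u j x') * (u ((i : ℕ) + 1) - u ((j : ℕ) + 1)) := by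
  have h1 := (h.level_spec x hx i).1
  have h2 := (h.level_spec x' hx' j).1
  have h3 := h.sep i j hij
  rw [abs_lt] at h1 h2
  rcases le_abs'.1 h3 with h4 | h4
  · exact mul_pos_of_neg_of_neg (by linarith) (by linarith)
  · exact mul_pos (by linarith) (by linarith)

theorem level_injective {x : ℝ} (hx : x ∈ Icc (-1 : ℝ) 1) :
    Function.Injective fun i => level m a u i x := by
  intro i j hij
  by_contra hne
  have := h.level_sub_far hx hx hne
  rw [show level m a u i x = level m a u j x from hij, sub_self, abs_zero] at this
  linarith

/-- The levels are `m` distinct roots of a monic polynomial of degree `m`. In particular the choice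
made in `level` is unique for these `x`. -/
theorem levelPoly_eq_prod {x : ℝ} (hx : x ∈ Icc (-1 : ℝ) 1) :
    levelPoly m a u x = ∏ j, (Polynomial.X - Polynomial.C (level m a u j x)) := by
  refine Polynomial.eq_of_monic_of_dvd_of_natDegree_le
    (Polynomial.monic_prod_of_monic _ _ fun j _ => Polynomial.monic_X_sub_C _)
    (h.levelPoly_monic x) ?_ ?_
  · refine Finset.prod_dvd_of_coprime ?_ fun j _ => ?_
    · exact (Polynomial.pairwise_coprime_X_sub_C (h.level_injective hx)).set_pairwise _
    · rw [Polynomial.dvd_iff_isRoot]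
      exact (h.level_spec x hx j).2
  · rw [levelPoly_natDegree, Polynomial.natDegree_prod_of_monic _ _
      fun j _ => Polynomial.monic_X_sub_C _]
    simp

theorem roots_levelPoly {x : ℝ} (hx : x ∈ Icc (-1 : ℝ) 1) :
    (levelPoly m a u x).roots = Finset.univ.val.map fun j => level m a u j x := by
  rw [h.levelPoly_eq_prod hx, Finset.prod_eq_multiset_prod]
  have := Polynomial.roots_multiset_prod_X_sub_C
    ((Finset.univ : Finset (Fin m)).val.map fun j => level m a u j x)
  rwa [Multiset.map_map] at this

/-- The comparison of a level at different quasi-momenta. -/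
theorem level_sub_mul_prod {x x' : ℝ} (hx : x ∈ Icc (-1 : ℝ) 1) (hx' : x' ∈ Icc (-1 : ℝ) 1)
    (i : Fin m) :
    (level m a u i x' - level m a u i x) *
      ∏ j ∈ Finset.univ.erase i, (level m a u i x' - level m a u j x) =
      2 * cycProd m a * (x' - x) := by
  rw [Finset.mul_prod_erase Finset.univ (fun j => level m a u i x' - level m a u j x)
    (Finset.mem_univ i)]
  -- The polynomials for `x` and `x'` differ by the constant `2 * cycProd m a * (x' - x)`.
  -- Evaluation of the first at a root of the second gives the identity.
  have h1 : (levelPoly m a u x).eval (level m a u i x') =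
      ∏ j, (level m a u i x' - level m a u j x) := by
    rw [h.levelPoly_eq_prod hx, Polynomial.eval_prod]
    simp
  have h2 := (h.level_spec x' hx' i).2
  rw [← h1]
  simp only [levelPoly, Polynomial.eval_add, Polynomial.eval_C] at h2 ⊢
  linarith

/-- All factors of the product in `level_sub_mul_prod` have modulus at least `12`, so dropping them
is harmless. This gives continuity of the bands, and their constancy when `cycProd m a = 0`. -/
theorem abs_level_sub_le {x x' : ℝ} (hx : x ∈ Icc (-1 : ℝ) 1) (hx' : x' ∈ Icc (-1 : ℝ) 1)
    (i : Fin m) :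
    |level m a u i x' - level m a u i x| ≤ 2 * cycProd m a * |x' - x| := by
  have h1 := congrArg abs (h.level_sub_mul_prod hx hx' i)
  rw [abs_mul, abs_mul, abs_of_nonneg (mul_nonneg zero_le_two h.cycProd_nonneg),
    Finset.abs_prod] at h1
  rw [← h1]
  refine le_mul_of_one_le_right (abs_nonneg _) ?_
  rw [← Finset.prod_const_one (s := Finset.univ.erase i)]
  refine Finset.prod_le_prod (fun _ _ => zero_le_one) fun j hj => ?_
  linarith [h.level_sub_far hx' hx (Finset.ne_of_mem_erase hj).symm]

/-- The sign of the product is that of the corresponding product over the sites, independent of `x`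
and `x'`. With `level_sub_mul_prod` this makes each level monotone in `x`, so its extremes occur at
`x = ±1`. -/
theorem level_sub_sign_prod {x x' : ℝ} (hx : x ∈ Icc (-1 : ℝ) 1) (hx' : x' ∈ Icc (-1 : ℝ) 1)
    (i : Fin m) :
    0 < (∏ j ∈ Finset.univ.erase i, (level m a u i x' - level m a u j x)) *
      ∏ j ∈ Finset.univ.erase i, (u ((i : ℕ) + 1) - u ((j : ℕ) + 1)) := by
  rw [← Finset.prod_mul_distrib]
  exact Finset.prod_pos fun j hj => h.level_sub_sign hx' hx (Finset.ne_of_mem_erase hj).symm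

theorem level_mem_uIcc {x : ℝ} (hx : x ∈ Icc (-1 : ℝ) 1) (i : Fin m) :
    level m a u i x ∈ uIcc (level m a u i (-1)) (level m a u i 1) := by
  have hm1 : (-1 : ℝ) ∈ Icc (-1 : ℝ) 1 := by simp
  have h1 : (1 : ℝ) ∈ Icc (-1 : ℝ) 1 := by simp
  have e1 := h.level_sub_mul_prod hm1 hx i
  have e2 := h.level_sub_mul_prod hx h1 i
  have s1 := h.level_sub_sign_prod hm1 hx i
  have s2 := h.level_sub_sign_prod hx h1 i
  have hP := h.cycProd_nonneg
  have p1 : 0 ≤ 2 * cycProd m a * (x - -1) := mul_nonneg (by positivity) (by linarith [hx.1])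
  have p2 : 0 ≤ 2 * cycProd m a * (1 - x) := mul_nonneg (by positivity) (by linarith [hx.2])
  rw [← e1] at p1
  rw [← e2] at p2
  rw [mem_uIcc]
  rcases pos_and_pos_or_neg_and_neg_of_mul_pos s1 with ⟨a1, b1⟩ | ⟨a1, b1⟩
  · have a2 := (pos_iff_pos_of_mul_pos s2).2 b1
    left
    have := nonneg_of_mul_nonneg_left p1 a1
    have := nonneg_of_mul_nonneg_left p2 a2
    constructor <;> linarith
  · right
    have a2 : (∏ j ∈ Finset.univ.erase i, (level m a u i 1 - level m a u j x)) < 0 := by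
      by_contra hcon
      push Not at hcon
      nlinarith
    constructor <;> nlinarith

/-- The band function of the energy level near `u_{i+1}`. -/
def levelC (i : Fin m) : C(UnitAddCircle, ℝ) :=
  ⟨fun θ => level m a u i (circCos θ), by
    refine continuous_iff_continuousAt.2 fun θ₀ => ?_
    rw [ContinuousAt, tendsto_iff_dist_tendsto_zero]
    refine squeeze_zero (g := fun θ => 2 * cycProd m a * |circCos θ - circCos θ₀|)
      (fun _ => dist_nonneg)
      (fun θ => h.abs_level_sub_le (circCos_mem θ₀) (circCos_mem θ) i) ?_
    have hc : Continuous fun θ => 2 * cycProd m a * |circCos θ - circCos θ₀| := by fun_prop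
    simpa using hc.tendsto θ₀⟩

@[simp] theorem levelC_apply (i : Fin m) (θ : UnitAddCircle) :
    h.levelC i θ = level m a u i (circCos θ) := rfl

theorem range_levelC (i : Fin m) :
    range (h.levelC i) = uIcc (level m a u i (-1)) (level m a u i 1) := by
  refine Subset.antisymm ?_ ?_
  · rintro _ ⟨θ, rfl⟩
    exact h.level_mem_uIcc (circCos_mem θ) i
  · have hconn : IsPreconnected (range (h.levelC i)) :=
      isPreconnected_range (h.levelC i).continuous
    have h1 : level m a u i 1 ∈ range (h.levelC i) :=
      ⟨circArccos 1, by rw [levelC_apply, circCos_circArccos (by simp)]⟩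
    have h2 : level m a u i (-1) ∈ range (h.levelC i) :=
      ⟨circArccos (-1), by rw [levelC_apply, circCos_circArccos (by simp)]⟩
    exact hconn.ordConnected.uIcc_subset h2 h1

/-- The equation of a level is linear in the cosine and can be solved for it. This supplies the
function `G` required for the multiplicity count and is where a nonzero product of coefficients is
used. -/
theorem circCos_eq_of_level (hP : cycProd m a ≠ 0) (i : Fin m) (θ : UnitAddCircle) :
    1 + (cycMatrix m a u 1).charpoly.eval (h.levelC i θ) / (2 * cycProd m a) = circCos θ := by
  have h2 := (h.level_spec (circCos θ) (circCos_mem θ) i).2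
  simp only [levelPoly, Polynomial.eval_add, Polynomial.eval_C] at h2
  rw [levelC_apply, eq_neg_of_add_eq_zero_left h2]
  field_simp
  ring

end SepJacobi

end
end Nanotube

namespace Nanotube
noncomputable section

open Matrix AddCircle

/-! ### Bloch vectors -/

theorem norm_fourier_apply (n : ℤ) (θ : UnitAddCircle) : ‖(fourier n θ : ℂ)‖ = 1 := by
  rw [fourier_apply]; exact Circle.norm_coe _

theorem fourier_ne_zero (n : ℤ) (θ : UnitAddCircle) : (fourier n θ : ℂ) ≠ 0 := by
  intro h
  have := norm_fourier_apply n θ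
  rw [h, norm_zero] at this
  exact zero_ne_one this

theorem cycNext_eq_iff {m : ℕ} (i j : Fin m) : j = cycNext i ↔ i = cycPrev j := by
  have hi := i.2
  have hj := j.2
  rw [Fin.ext_iff, Fin.ext_iff, cycNext_val, cycPrev_val]
  split_ifs <;> omega

namespace SepJacobi

variable {m : ℕ} {a u : ℤ → ℝ} (h : SepJacobi m a u)
include h

/-- The Floquet matrix at quasi-momentum `θ`. -/
def fiber (_h : SepJacobi m a u) (θ : UnitAddCircle) : Matrix (Fin m) (Fin m) ℂ :=
  cycMatrix m (fun n => (a n : ℂ)) (fun n => (u n : ℂ)) (fourier 1 θ)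

theorem continuous_fiber : Continuous h.fiber := by
  have h1 : Continuous fun θ : UnitAddCircle => (fourier 1 θ : ℂ)⁻¹ :=
    (fourier 1).continuous.inv₀ (fourier_ne_zero 1)
  have h2 : Continuous fun θ : UnitAddCircle => (fourier 1 θ : ℂ) := (fourier 1).continuous
  refine continuous_matrix fun i j => ?_
  simp only [fiber, cycMatrix]
  refine (continuous_const.add ?_).add ?_ <;>
  · split_ifs <;> fun_prop

theorem isHermitian_fiber (θ : UnitAddCircle) : (h.fiber θ).IsHermitian := by
  have hτ : (fourier 1 θ : ℂ)⁻¹ = (starRingEnd ℂ) (fourier 1 θ) := by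
    rw [Complex.inv_def, Complex.normSq_eq_norm_sq, norm_fourier_apply]; simp
  ext i j
  have hi := i.2
  have hj := j.2
  simp only [fiber, conjTranspose_apply, cycMatrix, star_add, RCLike.star_def, hτ,
    apply_ite (starRingEnd ℂ), map_mul, Complex.conj_ofReal, map_zero, map_one, Complex.conj_conj]
  rw [add_right_comm]
  congr 1
  · congr 1
    · by_cases hij : i = j
      · simp [hij]
      · simp [hij, Ne.symm hij]
    · by_cases hij : j = cycNext i
      · have h1 := (cycNext_eq_iff i j).1 hij
        rw [if_pos hij, if_pos h1]
        have h2 : (j : ℕ) = _ := (congrArg Fin.val hij).trans (cycNext_val i)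
        by_cases h3 : (i : ℕ) + 1 = m
        · rw [if_pos h3] at h2
          rw [if_pos h3, if_pos h2]
          have : ((i : ℤ) + 1) = m := by omega
          rw [this, h.a_m, h2]
          rfl
        · rw [if_neg h3] at h2
          rw [if_neg h3, if_neg (by omega), h2]
          push_cast; rfl
      · have h1 := mt (cycNext_eq_iff i j).2 hij
        rw [if_neg hij, if_neg h1]
  · by_cases hij : i = cycNext j
    · have h1 := (cycNext_eq_iff j i).1 hij
      rw [if_pos hij, if_pos h1]
      have h2 : (i : ℕ) = _ := (congrArg Fin.val hij).trans (cycNext_val j)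
      by_cases h3 : (j : ℕ) + 1 = m
      · rw [if_pos h3] at h2
        rw [if_pos h3, if_pos h2]
        have : ((j : ℤ) + 1) = m := by omega
        rw [this, h.a_m, h2]
        rfl
      · rw [if_neg h3] at h2
        rw [if_neg h3, if_neg (by omega), h2]
        push_cast; rfl
    · have h1 := mt (cycNext_eq_iff j i).2 hij
      rw [if_neg hij, if_neg h1]

/-- A column of the adjugate matrix: an eigenvector. -/
def blochCol (i : Fin m) (θ : UnitAddCircle) (k : Fin m) : ℂ :=
  (Matrix.scalar (Fin m) ((h.levelC i θ : ℝ) : ℂ) - h.fiber θ).adjugate k i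

theorem continuous_blochCol (i k : Fin m) : Continuous fun θ => h.blochCol i θ k := by
  have h1 : Continuous fun θ => Matrix.scalar (Fin m) ((h.levelC i θ : ℝ) : ℂ) - h.fiber θ := by
    refine Continuous.sub ?_ h.continuous_fiber
    refine continuous_matrix fun i' j' => ?_
    simp only [Matrix.scalar_apply, Matrix.diagonal_apply]
    split_ifs <;> fun_prop
  exact (h1.matrix_adjugate).matrix_elem k i

/-- At an eigenvalue the determinant vanishes, so the matrix annihilates every column of its
adjugate. -/
theorem fiber_mulVec_blochCol (i : Fin m) (θ : UnitAddCircle) :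
    h.fiber θ *ᵥ h.blochCol i θ = ((h.levelC i θ : ℝ) : ℂ) • h.blochCol i θ := by
  set Q := Matrix.scalar (Fin m) ((h.levelC i θ : ℝ) : ℂ) - h.fiber θ with hQ
  have hdet : Q.det = 0 := by
    rw [hQ, fiber, h.det_complex _ _ (norm_fourier_apply 1 θ)]
    have := (h.level_spec (circCos θ) (circCos_mem θ) i).2
    rw [levelC_apply]
    exact_mod_cast this
  have h1 : Q *ᵥ h.blochCol i θ = 0 := by
    have h2 := Q.mul_adjugate
    rw [hdet, zero_smul] at h2
    funext k
    exact congrFun (congrFun h2 k) i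
  rw [hQ, scalar_sub_mulVec, sub_eq_zero] at h1
  exact h1.symm

/-- This entry is the determinant of the matrix with row `i` replaced by a unit row. A kernel vector
would attain its maximum at another site `k`, placing the level within `3` of `u_{k+1}`, although it
is within `4` of `u_{i+1}`. A global continuous eigenvector results, with no choice of phase. -/
theorem blochCol_ne_zero (i : Fin m) (θ : UnitAddCircle) : h.blochCol i θ i ≠ 0 := by
  unfold blochCol
  rw [Matrix.adjugate_apply]
  intro h0
  obtain ⟨f, hf, hfz⟩ := Matrix.exists_mulVec_eq_zero_iff.2 h0
  obtain ⟨k, hk⟩ := @Finite.exists_max _ _ _ ⟨i⟩ _ (fun j => ‖f j‖)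
  have hfk : f k ≠ 0 := by
    intro hk0
    refine hf (funext fun j => ?_)
    have := hk j
    rw [hk0, norm_zero] at this
    exact norm_le_zero_iff.1 this
  have hki : k ≠ i := by
    rintro rfl
    have := congrFun hfz k
    rw [Matrix.mulVec, Matrix.updateRow_self, single_one_dotProduct] at this
    exact hfk this
  have hrow : (Matrix.scalar (Fin m) ((h.levelC i θ : ℝ) : ℂ) *ᵥ f - h.fiber θ *ᵥ f) k = 0 := by
    have := congrFun hfz k
    rw [Matrix.mulVec, Matrix.updateRow_ne hki] at this
    rw [← Matrix.sub_mulVec]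
    exact this
  have hrow2 : (h.fiber θ *ᵥ f) k = ((h.levelC i θ : ℝ) : ℂ) * f k := by
    rw [Pi.sub_apply, Matrix.scalar_apply, Matrix.mulVec_diagonal, sub_eq_zero] at hrow
    exact hrow.symm
  have hle := norm_sub_le_of_row (fun n => (a n : ℂ)) (fun n => (u n : ℂ)) (fourier 1 θ)
    (norm_fourier_apply 1 θ) (fun n => by
      simpa only [Complex.norm_real] using h.norm_add_le n) _ f k hk hfk hrow2
  rw [← Complex.ofReal_sub, Complex.norm_real, Real.norm_eq_abs, levelC_apply] at hle
  have h1 := (h.level_spec (circCos θ) (circCos_mem θ) i).1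
  have h2 := h.sep i k hki.symm
  have h3 := abs_sub_le (u ((i : ℕ) + 1)) (level m a u i (circCos θ)) (u ((k : ℕ) + 1))
  rw [abs_sub_comm (u _) (level _ _ _ _ _)] at h3
  linarith

/-- The squared length of the eigenvector. -/
def blochNormSq (i : Fin m) (θ : UnitAddCircle) : ℝ := ∑ k, ‖h.blochCol i θ k‖ ^ 2

theorem blochNormSq_pos (i : Fin m) (θ : UnitAddCircle) : 0 < h.blochNormSq i θ :=
  Finset.sum_pos' (fun _ _ => by positivity)
    ⟨i, Finset.mem_univ i, by have := norm_pos_iff.2 (h.blochCol_ne_zero i θ); positivity⟩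

/-- The normalized eigenvector, as a continuous function of the quasi-momentum. -/
def blochVec (i k : Fin m) : C(UnitAddCircle, ℂ) :=
  ⟨fun θ => ((Real.sqrt (h.blochNormSq i θ))⁻¹ : ℝ) * h.blochCol i θ k, by
    have h1 : Continuous fun θ => h.blochNormSq i θ := by
      unfold blochNormSq
      exact continuous_finsetSum _ fun k _ => (h.continuous_blochCol i k).norm.pow 2
    have h2 : Continuous fun θ => (Real.sqrt (h.blochNormSq i θ))⁻¹ :=
      (Real.continuous_sqrt.comp h1).inv₀
        fun θ => (Real.sqrt_pos.2 (h.blochNormSq_pos i θ)).ne'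
    exact (Complex.continuous_ofReal.comp h2).mul (h.continuous_blochCol i k)⟩

theorem fiber_mulVec_blochVec (i : Fin m) (θ : UnitAddCircle) :
    h.fiber θ *ᵥ (fun k => h.blochVec i k θ) =
      ((h.levelC i θ : ℝ) : ℂ) • fun k => h.blochVec i k θ := by
  have h1 : (fun k => h.blochVec i k θ) =
      (((Real.sqrt (h.blochNormSq i θ))⁻¹ : ℝ) : ℂ) • h.blochCol i θ := rfl
  rw [h1, Matrix.mulVec_smul, h.fiber_mulVec_blochCol, smul_comm]

/-- The fibre is Hermitian and its levels are pairwise distinct at every `θ`, so the normalized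
eigenvectors are orthonormal pointwise. -/
theorem blochVec_orthonormal (i j : Fin m) (θ : UnitAddCircle) :
    ∑ k, (starRingEnd ℂ) (h.blochVec i k θ) * h.blochVec j k θ = if i = j then 1 else 0 := by
  split_ifs with hij
  · subst hij
    have h1 : ∀ k, (starRingEnd ℂ) (h.blochVec i k θ) * h.blochVec i k θ =
        (((h.blochNormSq i θ)⁻¹ * ‖h.blochCol i θ k‖ ^ 2 : ℝ) : ℂ) := by
      intro k
      rw [mul_comm, Complex.mul_conj, Complex.normSq_eq_norm_sq]
      congr 1
      change ‖(((Real.sqrt (h.blochNormSq i θ))⁻¹ : ℝ) : ℂ) * h.blochCol i θ k‖ ^ 2 = _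
      rw [norm_mul, mul_pow, Complex.norm_real, Real.norm_eq_abs, sq_abs, inv_pow,
        Real.sq_sqrt (h.blochNormSq_pos i θ).le]
    simp_rw [h1]
    rw [← Complex.ofReal_sum, ← Finset.mul_sum]
    change (((h.blochNormSq i θ)⁻¹ * h.blochNormSq i θ : ℝ) : ℂ) = 1
    rw [inv_mul_cancel₀ (h.blochNormSq_pos i θ).ne', Complex.ofReal_one]
  · set A := h.fiber θ
    set v : Fin m → ℂ := fun k => h.blochVec i k θ with hv
    set w : Fin m → ℂ := fun k => h.blochVec j k θ with hw
    have hAv : A *ᵥ v = ((h.levelC i θ : ℝ) : ℂ) • v := h.fiber_mulVec_blochVec i θ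
    have hAw : A *ᵥ w = ((h.levelC j θ : ℝ) : ℂ) • w := h.fiber_mulVec_blochVec j θ
    have h1 : star v ⬝ᵥ (A *ᵥ w) = ((h.levelC j θ : ℝ) : ℂ) * (star v ⬝ᵥ w) := by
      rw [hAw, dotProduct_smul, smul_eq_mul]
    have h2 : star v ⬝ᵥ (A *ᵥ w) = ((h.levelC i θ : ℝ) : ℂ) * (star v ⬝ᵥ w) := by
      have h3 := congrArg star hAv
      rw [Matrix.star_mulVec, (h.isHermitian_fiber θ).eq, star_smul] at h3
      rw [Matrix.dotProduct_mulVec, h3, smul_dotProduct, smul_eq_mul]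
      simp
    have h4 : (((h.levelC i θ : ℝ) : ℂ) - ((h.levelC j θ : ℝ) : ℂ)) * (star v ⬝ᵥ w) = 0 := by
      rw [sub_mul, ← h1, ← h2, sub_self]
    rcases mul_eq_zero.1 h4 with h5 | h5
    · exfalso
      rw [sub_eq_zero] at h5
      exact hij (h.level_injective (circCos_mem θ) (Complex.ofReal_injective h5))
    · simpa [dotProduct, hv, hw] using h5

theorem blochVec_complete (k l : Fin m) (θ : UnitAddCircle) :
    ∑ i, h.blochVec i k θ * (starRingEnd ℂ) (h.blochVec i l θ) = if k = l then 1 else 0 := by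
  let W : Matrix (Fin m) (Fin m) ℂ := fun k i => h.blochVec i k θ
  have h1 : Wᴴ * W = 1 := by
    ext i j
    rw [Matrix.mul_apply, Matrix.one_apply, ← h.blochVec_orthonormal i j θ]
    rfl
  have h1' : W * Wᴴ = 1 := mul_eq_one_comm.1 h1
  have h2 := congrFun (congrFun h1' k) l
  rw [Matrix.mul_apply, Matrix.one_apply] at h2
  exact h2

end SepJacobi

end
end Nanotube

namespace Nanotube
noncomputable section

open AddCircle

/-! ### The Bloch transform -/

/-- The sites of `ℤ`, ordered by residue and period. -/
def siteEquiv (m : ℕ) [NeZero m] : Fin m × ℤ ≃ ℤ :=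
  ((Equiv.prodComm _ _).trans (Int.divModEquiv m).symm).trans (Equiv.addRight 1)

theorem siteEquiv_apply (m : ℕ) [NeZero m] (k : Fin m) (q : ℤ) :
    siteEquiv m (k, q) = q * m + (k : ℕ) + 1 := rfl

theorem siteEquiv_add_one (m : ℕ) [NeZero m] (k : Fin m) (q : ℤ) :
    siteEquiv m (k, q) + 1 = siteEquiv m (cycNext k, if (k : ℕ) + 1 = m then q + 1 else q) := by
  rw [siteEquiv_apply, siteEquiv_apply, cycNext_val]
  split_ifs with h
  · have : (m : ℤ) = (k : ℕ) + 1 := by omega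
    rw [this]; push_cast; ring
  · push_cast; ring

theorem siteEquiv_sub_one (m : ℕ) [NeZero m] (k : Fin m) (q : ℤ) :
    siteEquiv m (k, q) - 1 = siteEquiv m (cycPrev k, if (k : ℕ) = 0 then q - 1 else q) := by
  rw [siteEquiv_apply, siteEquiv_apply, cycPrev_val]
  split_ifs with h
  · have : ((m - 1 : ℕ) : ℤ) = m - 1 := by have := k.2; omega
    rw [this, h]; push_cast; ring
  · have : (((k : ℕ) - 1 : ℕ) : ℤ) = (k : ℕ) - 1 := by omega
    rw [this]; ring

theorem hasSum_siteEquiv {m : ℕ} [NeZero m] {f : ℤ → ℂ} {s : Fin m → ℂ} (hf : Summable f)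
    (h : ∀ k, HasSum (fun q => f (siteEquiv m (k, q))) (s k)) : ∑' n, f n = ∑ k, s k := by
  have h1 : Summable (fun x : Fin m × ℤ => f (siteEquiv m x)) := (siteEquiv m).summable_iff.2 hf
  rw [← (siteEquiv m).tsum_eq f, h1.tsum_prod' fun k => (h k).summable, tsum_fintype]
  exact Finset.sum_congr rfl fun k _ => (h k).tsum_eq

theorem memLp_siteEquiv {m : ℕ} [NeZero m] {f : ℤ → ℂ}
    (h : ∀ k, Summable (fun q => ‖f (siteEquiv m (k, q))‖ ^ 2)) :
    Memℓp (E := fun _ : ℤ => ℂ) f 2 := by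
  have h1 : Summable (fun n => ‖f n‖ ^ 2) := by
    rw [← (siteEquiv m).summable_iff]
    exact (summable_prod_of_nonneg fun _ => sq_nonneg _).2
      ⟨h, Summable.of_finite⟩
  exact memℓp_gen (by simpa using h1)

theorem summable_norm_sq_repr (g : CircL2) :
    Summable (fun q : ℤ => ‖fourierBasis.repr g (-q)‖ ^ 2) := by
  have h := (lp.memℓp (fourierBasis.repr g)).summable (by norm_num)
  simp only [ENNReal.toReal_ofNat, Real.rpow_ofNat] at h
  exact (Equiv.neg ℤ).summable_iff.2 h

theorem repr_neg_eq_integral (g : CircL2) (q : ℤ) :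
    fourierBasis.repr g (-q) = ∫ θ, fourier q θ * g θ ∂haarAddCircle := by
  rw [fourierBasis_repr, fourierCoeff]
  simp

theorem integrable_circL2 (g : CircL2) : Integrable g haarAddCircle :=
  (Lp.memLp g).integrable (by norm_num)

theorem mulC_add (w : C(UnitAddCircle, ℂ)) (f g : CircL2) :
    mulC w (f + g) = mulC w f + mulC w g := by
  refine Lp.ext ?_
  filter_upwards [mulC_ae w (f + g), mulC_ae w f, mulC_ae w g, Lp.coeFn_add f g,
    Lp.coeFn_add (mulC w f) (mulC w g)] with θ h1 h2 h3 h4 h5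
  rw [h1, h5, Pi.add_apply, h2, h3, h4, Pi.add_apply, mul_add]

theorem mulC_smul (w : C(UnitAddCircle, ℂ)) (c : ℂ) (f : CircL2) :
    mulC w (c • f) = c • mulC w f := by
  refine Lp.ext ?_
  filter_upwards [mulC_ae w (c • f), mulC_ae w f, Lp.coeFn_smul c f,
    Lp.coeFn_smul c (mulC w f)] with θ h1 h2 h3 h4
  rw [h1, h4, Pi.smul_apply, h2, h3, Pi.smul_apply, smul_eq_mul, smul_eq_mul]
  ring

namespace SepJacobi

variable {m : ℕ} {a u : ℤ → ℝ} (h : SepJacobi m a u)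

/-- The Bloch wave. -/
def blochWave [NeZero m] (i : Fin m) (n : ℤ) (θ : UnitAddCircle) : ℂ :=
  fourier ((siteEquiv m).symm n).2 θ * h.blochVec i ((siteEquiv m).symm n).1 θ

theorem blochWave_site [NeZero m] (i k : Fin m) (q : ℤ) (θ : UnitAddCircle) :
    h.blochWave i (siteEquiv m (k, q)) θ = fourier q θ * h.blochVec i k θ := by
  rw [blochWave, Equiv.symm_apply_apply]

include h in
theorem periodic_site [NeZero m] (k : Fin m) (q : ℤ) :
    a (siteEquiv m (k, q)) = a ((k : ℕ) + 1) ∧ a (siteEquiv m (k, q) - 1) = a (k : ℕ) ∧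
      u (siteEquiv m (k, q)) = u ((k : ℕ) + 1) := by
  have h1 := h.a_per.int_mul q
  have h2 := h.u_per.int_mul q
  have e1 : siteEquiv m (k, q) = ((k : ℕ) + 1 : ℤ) + q * m := by
    rw [siteEquiv_apply]; ring
  have e2 : siteEquiv m (k, q) - 1 = ((k : ℕ) : ℤ) + q * m := by
    rw [siteEquiv_apply]; ring
  refine ⟨?_, ?_, ?_⟩
  · rw [e1]; exact h1 _
  · rw [e2]; exact h1 _
  · rw [e1]; exact h2 _

theorem blochWave_eq [NeZero m] (i : Fin m) (n : ℤ) (θ : UnitAddCircle) :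
    (a (n - 1) : ℂ) * h.blochWave i (n - 1) θ + (a n : ℂ) * h.blochWave i (n + 1) θ +
      (u n : ℂ) * h.blochWave i n θ = ((h.levelC i θ : ℝ) : ℂ) * h.blochWave i n θ := by
  obtain ⟨⟨k, q⟩, rfl⟩ := (siteEquiv m).surjective n
  obtain ⟨e1, e2, e3⟩ := h.periodic_site k q
  rw [e1, e2, e3, siteEquiv_add_one, siteEquiv_sub_one, blochWave_site, blochWave_site,
    blochWave_site]
  have h1 := congrFun (h.fiber_mulVec_blochVec i θ) k
  rw [fiber, cycMatrix_mulVec, Pi.smul_apply, smul_eq_mul] at h1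
  have f1 : (fourier (if (k : ℕ) + 1 = m then q + 1 else q) θ : ℂ) =
      fourier q θ * (if (k : ℕ) + 1 = m then fourier 1 θ else 1) := by
    split_ifs
    · exact fourier_add
    · rw [mul_one]
  have f2 : (fourier (if (k : ℕ) = 0 then q - 1 else q) θ : ℂ) =
      fourier q θ * (if (k : ℕ) = 0 then (fourier 1 θ)⁻¹ else 1) := by
    split_ifs
    · rw [eq_mul_inv_iff_mul_eq₀ (fourier_ne_zero 1 θ), ← fourier_add, sub_add_cancel]
    · rw [mul_one]
  rw [f1, f2]
  linear_combination (fourier q θ : ℂ) * h1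

/-- The sequence with Bloch coefficients `f` in the band `i`. -/
def blochFun [NeZero m] (i : Fin m) (f : CircL2) (n : ℤ) : ℂ :=
  fourierBasis.repr (mulC (h.blochVec i ((siteEquiv m).symm n).1) f) (-((siteEquiv m).symm n).2)

theorem blochFun_site [NeZero m] (i : Fin m) (f : CircL2) (k : Fin m) (q : ℤ) :
    h.blochFun i f (siteEquiv m (k, q)) = fourierBasis.repr (mulC (h.blochVec i k) f) (-q) := by
  rw [blochFun, Equiv.symm_apply_apply]

theorem blochFun_eq_integral [NeZero m] (i : Fin m) (f : CircL2) (n : ℤ) :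
    h.blochFun i f n = ∫ θ, h.blochWave i n θ * f θ ∂haarAddCircle := by
  rw [blochFun, repr_neg_eq_integral]
  refine integral_congr_ae ?_
  filter_upwards [mulC_ae (h.blochVec i ((siteEquiv m).symm n).1) f] with θ h1
  rw [h1, blochWave, mul_assoc]

theorem integrable_blochWave_mul [NeZero m] (i : Fin m) (n : ℤ) (f : CircL2) :
    Integrable (fun θ => h.blochWave i n θ * f θ) haarAddCircle := by
  have h1 := integrable_circL2
    (mulC (fourier ((siteEquiv m).symm n).2 * h.blochVec i ((siteEquiv m).symm n).1) f)
  refine h1.congr ?_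
  filter_upwards [mulC_ae (fourier ((siteEquiv m).symm n).2 *
    h.blochVec i ((siteEquiv m).symm n).1) f] with θ h2
  rw [h2]
  rfl

/-- `blochFun` as an element of `ℓ²`. -/
def blochL2 [NeZero m] (i : Fin m) (f : CircL2) : Ell2 ℤ :=
  ⟨h.blochFun i f, memLp_siteEquiv (m := m) fun k => by
    simp_rw [blochFun_site]
    exact summable_norm_sq_repr _⟩

theorem blochL2_apply [NeZero m] (i : Fin m) (f : CircL2) (n : ℤ) :
    h.blochL2 i f n = h.blochFun i f n := rfl

/-- Parseval is applied separately on each residue class of sites. Summing over the classes under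
the integral leaves the pointwise inner product of the Bloch vectors. -/
theorem inner_blochL2 [NeZero m] (i j : Fin m) (f g : CircL2) :
    inner ℂ (h.blochL2 i f) (h.blochL2 j g) = if i = j then inner ℂ f g else 0 := by
  rw [lp.inner_eq_tsum (h.blochL2 i f) (h.blochL2 j g), hasSum_siteEquiv (m := m)
    (s := fun k => inner ℂ (mulC (h.blochVec i k) f) (mulC (h.blochVec j k) g))
    (lp.summable_inner (h.blochL2 i f) (h.blochL2 j g))]
  · simp_rw [L2.inner_def]
    rw [← integral_finsetSum _ fun k _ => L2.integrable_inner _ _]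
    have h1 : ∫ θ, ∑ k, inner ℂ (mulC (h.blochVec i k) f θ) (mulC (h.blochVec j k) g θ)
        ∂haarAddCircle = ∫ θ, (if i = j then 1 else 0) * inner ℂ (f θ) (g θ) ∂haarAddCircle := by
      refine integral_congr_ae ?_
      have hf : ∀ᵐ θ ∂haarAddCircle, ∀ k, mulC (h.blochVec i k) f θ = h.blochVec i k θ * f θ :=
        ae_all_iff.2 fun k => mulC_ae _ f
      have hg : ∀ᵐ θ ∂haarAddCircle, ∀ k, mulC (h.blochVec j k) g θ = h.blochVec j k θ * g θ :=
        ae_all_iff.2 fun k => mulC_ae _ g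
      filter_upwards [hf, hg] with θ hf hg
      rw [← h.blochVec_orthonormal i j θ, Finset.sum_mul]
      refine Finset.sum_congr rfl fun k _ => ?_
      rw [hf, hg, RCLike.inner_apply, RCLike.inner_apply, map_mul]
      ring
    rw [h1]
    split_ifs <;> simp
  · intro k
    have h1 := lp.hasSum_inner (𝕜 := ℂ) (G := fun _ : ℤ => ℂ) (fourierBasis.repr (mulC (h.blochVec i k) f) : Ell2 ℤ)
      (fourierBasis.repr (mulC (h.blochVec j k) g) : Ell2 ℤ)
    rw [LinearIsometryEquiv.inner_map_map] at h1
    have h2 := (Equiv.neg ℤ).hasSum_iff.2 h1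
    simp_rw [blochL2_apply, blochFun_site]
    exact h2

/-- The Bloch embedding of the band `i`. -/
def blochU [NeZero m] (i : Fin m) : CircL2 →ₗᵢ[ℂ] Ell2 ℤ where
  toFun := h.blochL2 i
  map_add' f g := by
    ext n
    rw [blochL2_apply, lp.coeFn_add, Pi.add_apply, blochL2_apply, blochL2_apply, blochFun,
      mulC_add, map_add]
    rfl
  map_smul' c f := by
    ext n
    rw [blochL2_apply, RingHom.id_apply, lp.coeFn_smul, Pi.smul_apply, blochL2_apply, blochFun,
      mulC_smul, map_smul]
    rfl
  norm_map' f := by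
    have h1 := h.inner_blochL2 i i f f
    rw [if_pos rfl, inner_self_eq_norm_sq_to_K, inner_self_eq_norm_sq_to_K] at h1
    have h2 : ‖h.blochL2 i f‖ ^ 2 = ‖f‖ ^ 2 := by exact_mod_cast h1
    exact (pow_left_inj₀ (norm_nonneg _) (norm_nonneg _) two_ne_zero).1 h2

theorem blochU_apply [NeZero m] (i : Fin m) (f : CircL2) (n : ℤ) :
    h.blochU i f n = h.blochFun i f n := rfl

/-- The Floquet–Bloch diagonalization of a periodic Jacobi operator. -/
def diagModel [NeZero m] (T : Ell2 ℤ →L[ℂ] Ell2 ℤ)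
    (hT : ∀ y n, T y n = (a (n - 1) : ℂ) * y (n - 1) + (a n : ℂ) * y (n + 1) +
      (u n : ℂ) * y n) : DiagModel T (Fin m) where
  lam := h.levelC
  U := h.blochU
  intertwine i f := by
    ext n
    rw [hT]
    simp only [blochU_apply, blochFun_eq_integral]
    have i1 := (h.integrable_blochWave_mul i (n - 1) f).const_mul (a (n - 1) : ℂ)
    have i2 := (h.integrable_blochWave_mul i (n + 1) f).const_mul (a n : ℂ)
    have i3 := (h.integrable_blochWave_mul i n f).const_mul (u n : ℂ)
    have i12 : Integrable (fun θ => (a (n - 1) : ℂ) * (h.blochWave i (n - 1) θ * f θ) +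
      (a n : ℂ) * (h.blochWave i (n + 1) θ * f θ)) haarAddCircle := i1.add i2
    rw [← integral_const_mul, ← integral_const_mul, ← integral_const_mul,
      ← integral_add i1 i2, ← integral_add i12 i3]
    refine integral_congr_ae ?_
    filter_upwards [mulC_ae (ofRealC (h.levelC i)) f] with θ h1
    rw [h1, ofRealC_apply]
    linear_combination (f θ) * h.blochWave_eq i n θ
  orth i j hij f g := by
    have := h.inner_blochL2 i j f g
    rwa [if_neg hij] at this
  complete y := by
    let F : Fin m → CircL2 := fun k => fourierBasis.repr.symm
      ⟨fun q => y (siteEquiv m (k, -q)), by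
        have h1 := (lp.memℓp y).summable (by norm_num)
        simp only [ENNReal.toReal_ofNat, Real.rpow_ofNat] at h1
        have h2 : Summable (fun q => ‖y (siteEquiv m (k, -q))‖ ^ 2) :=
          h1.comp_injective (i := fun q => siteEquiv m (k, -q)) fun q q' hq => by
            have := (siteEquiv m).injective hq
            simpa using this
        exact memℓp_gen (by simpa using h2)⟩
    have hF : ∀ k q, fourierBasis.repr (F k) (-q) = y (siteEquiv m (k, q)) := by
      intro k q
      simp only [F, LinearIsometryEquiv.apply_symm_apply]
      rw [neg_neg]
    -- The Fourier series of the residue classes are expanded in the Bloch basis at each `θ`, that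
    -- is, the adjoint of the unitary matrix of Bloch vectors is applied.
    let f : Fin m → CircL2 := fun i => ∑ l, mulC (star (h.blochVec i l)) (F l)
    have hf : ∀ k, ∑ i, mulC (h.blochVec i k) (f i) = F k := by
      intro k
      refine Lp.ext ?_
      have h1 : ∀ᵐ θ ∂haarAddCircle, ∀ i, mulC (h.blochVec i k) (f i) θ =
          h.blochVec i k θ * f i θ := ae_all_iff.2 fun i => mulC_ae _ _
      have h2 : ∀ᵐ θ ∂haarAddCircle, ∀ i, f i θ =
          ∑ l, mulC (star (h.blochVec i l)) (F l) θ := ae_all_iff.2 fun i => by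
        filter_upwards [Lp.coeFn_finsetSum Finset.univ
          (fun l => mulC (star (h.blochVec i l)) (F l))] with θ hθ
        rw [hθ, Finset.sum_apply]
      have h3 : ∀ᵐ θ ∂haarAddCircle, ∀ i l, mulC (star (h.blochVec i l)) (F l) θ =
          (starRingEnd ℂ) (h.blochVec i l θ) * F l θ :=
        ae_all_iff.2 fun i => ae_all_iff.2 fun l => mulC_ae _ _
      filter_upwards [Lp.coeFn_finsetSum Finset.univ (fun i => mulC (h.blochVec i k) (f i)),
        h1, h2, h3] with θ g0 g1 g2 g3
      rw [g0, Finset.sum_apply]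
      simp_rw [g1, g2, g3, Finset.mul_sum]
      rw [Finset.sum_comm]
      simp_rw [← mul_assoc, ← Finset.sum_mul, h.blochVec_complete]
      simp
    refine ⟨f, ?_⟩
    ext n
    obtain ⟨⟨k, q⟩, rfl⟩ := (siteEquiv m).surjective n
    rw [lp.coeFn_sum, Finset.sum_apply]
    simp_rw [blochU_apply, blochFun_site]
    rw [← hF k q, ← hf k, map_sum, lp.coeFn_sum, Finset.sum_apply]

end SepJacobi

end
end Nanotube

namespace Nanotube
noncomputable section

/-! ### Fourier decomposition of the nanotube -/

section Decomposition

variable (N : ℕ) [NeZero N]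

/-- The vertices, by angular position and site on the line. -/
def vertexEquiv : Vertex N ≃ ZMod N × ℤ where
  toFun ω := (ω.2.2, siteEquiv 2 (ω.2.1, ω.1))
  invFun x := (((siteEquiv 2).symm x.2).2, ((siteEquiv 2).symm x.2).1, x.1)
  left_inv ω := by simp
  right_inv x := by simp

/-- The angular characters. -/
def tubeChar (k : ℕ) (l : ZMod N) : ℂ := ZMod.stdAddChar (-(k : ZMod N) * l)

theorem tubeChar_zero (k : ℕ) : tubeChar N k 0 = 1 := by simp [tubeChar]

theorem tubeChar_add (k : ℕ) (l l' : ZMod N) :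
    tubeChar N k (l + l') = tubeChar N k l * tubeChar N k l' := by
  rw [tubeChar, mul_add, AddChar.map_add_eq_mul]; rfl

theorem tubeChar_neg_one (k : ℕ) :
    tubeChar N k (-1) = Complex.exp (Complex.I * (Real.pi * k / N)) ^ 2 := by
  rw [tubeChar, neg_mul_neg, mul_one, ← Complex.exp_nat_mul]
  have := ZMod.stdAddChar_coe (N := N) (k : ℤ)
  rw [Int.cast_natCast] at this
  rw [this]
  congr 1
  push_cast
  ring

theorem conj_tubeChar (k : ℕ) (l : ZMod N) :
    (starRingEnd ℂ) (tubeChar N k l) = tubeChar N k (-l) := by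
  rw [tubeChar, tubeChar, mul_neg, AddChar.map_neg_eq_conj]

theorem sum_stdAddChar (x : ZMod N) :
    ∑ l : ZMod N, (ZMod.stdAddChar (l * x) : ℂ) = if x = 0 then (N : ℂ) else 0 := by
  rw [AddChar.sum_mulShift x (ZMod.isPrimitive_stdAddChar N), ZMod.card]
  split_ifs <;> simp

theorem natCast_bijective :
    Function.Bijective fun k : Finset.Icc 1 N => ((k : ℕ) : ZMod N) := by
  rw [Fintype.bijective_iff_injective_and_card]
  constructor
  · rintro ⟨k, hk⟩ ⟨k', hk'⟩ h
    rw [Finset.mem_Icc] at hk hk'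
    have h1 := (ZMod.natCast_eq_natCast_iff' _ _ _).1 h
    simp only at h1
    refine Subtype.ext ?_
    simp only
    rcases hk.2.eq_or_lt with rfl | h2 <;> rcases hk'.2.eq_or_lt with rfl | h3
    · rfl
    · rw [Nat.mod_self, Nat.mod_eq_of_lt h3] at h1; omega
    · rw [Nat.mod_self, Nat.mod_eq_of_lt h2] at h1; omega
    · rwa [Nat.mod_eq_of_lt h2, Nat.mod_eq_of_lt h3] at h1
  · simp [ZMod.card]

theorem sum_conj_tubeChar_mul (k k' : Finset.Icc 1 N) :
    ∑ l, (starRingEnd ℂ) (tubeChar N k l) * tubeChar N k' l = if k = k' then (N : ℂ) else 0 := by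
  have h1 : ∀ l, (starRingEnd ℂ) (tubeChar N k l) * tubeChar N k' l =
      ZMod.stdAddChar (l * (((k : ℕ) : ZMod N) - ((k' : ℕ) : ZMod N))) := by
    intro l
    rw [conj_tubeChar, tubeChar, tubeChar, ← AddChar.map_add_eq_mul]
    congr 1
    ring
  simp_rw [h1, sum_stdAddChar, sub_eq_zero]
  by_cases h : k = k'
  · rw [if_pos h, h, if_pos rfl]
  · rw [if_neg h, if_neg fun h2 => h ((natCast_bijective N).1 h2)]

theorem sum_tubeChar (l : ZMod N) :
    ∑ k : Finset.Icc 1 N, tubeChar N k l = if l = 0 then (N : ℂ) else 0 := by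
  have h1 : ∀ k : Finset.Icc 1 N, tubeChar N k l =
      (fun x : ZMod N => (ZMod.stdAddChar (x * -l) : ℂ)) ((k : ℕ) : ZMod N) := by
    intro k
    simp only [tubeChar]
    congr 1
    ring
  simp_rw [h1]
  rw [(natCast_bijective N).sum_comp (fun x : ZMod N => (ZMod.stdAddChar (x * -l) : ℂ)),
    sum_stdAddChar]
  simp

variable (b : ℝ)

/-- The longitudinal phase. -/
def tubePhase (k : ℕ) : ℂ :=
  (if 0 ≤ cCoef N b k then 1 else -1) * Complex.exp (Complex.I * (Real.pi * k / N))

omit [NeZero N] in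
theorem norm_tubePhase (k : ℕ) : ‖tubePhase N b k‖ = 1 := by
  have h1 : ‖Complex.exp (Complex.I * (Real.pi * k / N))‖ = 1 := by
    have : (Complex.I * (Real.pi * k / N) : ℂ) = ((Real.pi * k / N : ℝ) : ℂ) * Complex.I := by
      push_cast; ring
    rw [this, Complex.norm_exp_ofReal_mul_I]
  rw [tubePhase, norm_mul, h1]
  split_ifs <;> simp

omit [NeZero N] in
theorem tubePhase_ne_zero (k : ℕ) : tubePhase N b k ≠ 0 := by
  rw [← norm_pos_iff, norm_tubePhase]; exact one_pos

omit [NeZero N] in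
-- The two magnetic edges act on the `k`-th character with total amplitude `2 c_k exp (iπk/N)`. The
-- phase and the sign of `c_k` are absorbed by `tubePhase`, so only `|c_k|` survives in the Jacobi
-- coefficients.
theorem two_cos_eq (k : ℕ) :
    2 * ((|cCoef N b k| : ℝ) : ℂ) * tubePhase N b k =
      Complex.exp (-(Complex.I * b)) +
        Complex.exp (Complex.I * b) * Complex.exp (Complex.I * (Real.pi * k / N)) ^ 2 := by
  have h1 : ((|cCoef N b k| : ℝ) : ℂ) * tubePhase N b k =
      (cCoef N b k : ℂ) * Complex.exp (Complex.I * (Real.pi * k / N)) := by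
    rw [tubePhase]
    split_ifs with h
    · rw [abs_of_nonneg h, one_mul]
    · rw [abs_of_neg (not_le.1 h)]; push_cast; ring
  rw [mul_assoc, h1, cCoef, Complex.ofReal_cos, Complex.cos]
  have e1 : (((b + Real.pi * k / N : ℝ) : ℂ) * Complex.I) =
      Complex.I * b + Complex.I * (Real.pi * k / N) := by push_cast; ring
  have e2 : (-((b + Real.pi * k / N : ℝ) : ℂ) * Complex.I) =
      -(Complex.I * b) + -(Complex.I * (Real.pi * k / N)) := by push_cast; ring
  rw [e1, e2, Complex.exp_add, Complex.exp_add, Complex.exp_neg (Complex.I * (Real.pi * k / N))]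
  field_simp [Complex.exp_ne_zero]
  ring

omit [NeZero N] in
theorem two_cos_eq_conj (k : ℕ) :
    2 * ((|cCoef N b k| : ℝ) : ℂ) =
      (Complex.exp (-(Complex.I * b)) * (Complex.exp (Complex.I * (Real.pi * k / N)) ^ 2)⁻¹ +
        Complex.exp (Complex.I * b)) * tubePhase N b k := by
  have h := two_cos_eq N b k
  have h2 : tubePhase N b k * tubePhase N b k =
      Complex.exp (Complex.I * (Real.pi * k / N)) ^ 2 := by
    rw [tubePhase]; split_ifs <;> ring
  have h3 := tubePhase_ne_zero N b k
  rw [← mul_left_inj' h3, h, mul_assoc, h2]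
  field_simp [Complex.exp_ne_zero]

/-- The amplitude of the embedding of the `k`-th channel. -/
def tubeWeight (k : ℕ) (n : ℤ) (l : ZMod N) : ℂ :=
  ((Real.sqrt N)⁻¹ : ℝ) * (tubePhase N b k ^ n * tubeChar N k l)

theorem norm_tubeChar (k : ℕ) (l : ZMod N) : ‖tubeChar N k l‖ = 1 := AddChar.norm_apply _ _

theorem norm_tubeWeight (k : ℕ) (n : ℤ) (l : ZMod N) :
    ‖tubeWeight N b k n l‖ = (Real.sqrt N)⁻¹ := by
  rw [tubeWeight, norm_mul, norm_mul, norm_zpow, norm_tubePhase, norm_tubeChar, one_zpow, mul_one,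
    mul_one, Complex.norm_real, Real.norm_of_nonneg (by positivity)]

/-- The embedding of the `k`-th channel, as a function. -/
def tubeFun (k : ℕ) (y : ℤ → ℂ) (ω : Vertex N) : ℂ :=
  tubeWeight N b k ω.1 ω.2.2 * y (vertexEquiv N ω).2

theorem memLp_tubeFun (k : ℕ) (y : Ell2 ℤ) : Memℓp (E := fun _ => ℂ) (tubeFun N b k y) 2 := by
  have h1 := (lp.memℓp y).summable (by norm_num)
  simp only [ENNReal.toReal_ofNat, Real.rpow_ofNat] at h1
  have h2 : Summable fun x : ZMod N × ℤ => ((Real.sqrt N)⁻¹ * ‖y x.2‖) ^ 2 := by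
    refine (summable_prod_of_nonneg fun _ => sq_nonneg _).2 ⟨fun l => ?_, Summable.of_finite⟩
    simp_rw [mul_pow]
    exact h1.mul_left _
  have h3 := (vertexEquiv N).summable_iff.2 h2
  refine memℓp_gen ?_
  simp only [tubeFun, norm_mul, norm_tubeWeight, ENNReal.toReal_ofNat, Real.rpow_ofNat]
  exact h3

/-- The embedding of the `k`-th channel, into `ℓ²`. -/
def tubeL2 (k : ℕ) (y : Ell2 ℤ) : Ell2 (Vertex N) := ⟨tubeFun N b k y, memLp_tubeFun N b k y⟩

theorem inner_tubeL2 (k k' : Finset.Icc 1 N) (y y' : Ell2 ℤ) :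
    inner ℂ (tubeL2 N b k y) (tubeL2 N b k' y') = if k = k' then inner ℂ y y' else 0 := by
  have hN : (N : ℂ) ≠ 0 := Nat.cast_ne_zero.2 (NeZero.ne N)
  set c : ℤ → ℂ := fun i => (N : ℂ)⁻¹ *
    ((starRingEnd ℂ) (tubePhase N b k ^ ((siteEquiv 2).symm i).2) *
      tubePhase N b k' ^ ((siteEquiv 2).symm i).2) * inner ℂ (y i) (y' i) with hc
  have hpt : ∀ x : ZMod N × ℤ, inner ℂ (tubeL2 N b k y ((vertexEquiv N).symm x))
      (tubeL2 N b k' y' ((vertexEquiv N).symm x)) =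
      ((starRingEnd ℂ) (tubeChar N k x.1) * tubeChar N k' x.1) * c x.2 := by
    rintro ⟨l, i⟩
    have e1 : ∀ (q : ℕ) (z : Ell2 ℤ), tubeL2 N b q z ((vertexEquiv N).symm (l, i)) =
        tubeWeight N b q ((siteEquiv 2).symm i).2 l * z i := by
      intro q z
      change tubeFun N b q z ((vertexEquiv N).symm (l, i)) = _
      rw [tubeFun, Equiv.apply_symm_apply]
      rfl
    have e2 : (((Real.sqrt N)⁻¹ : ℝ) : ℂ) * (((Real.sqrt N)⁻¹ : ℝ) : ℂ) = (N : ℂ)⁻¹ := by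
      rw [← Complex.ofReal_mul, ← mul_inv, Real.mul_self_sqrt (Nat.cast_nonneg _)]
      push_cast; rfl
    rw [e1, e1, RCLike.inner_apply, hc]
    simp only [RCLike.inner_apply, tubeWeight, map_mul, Complex.conj_ofReal, ← e2]
    ring
  have hs : Summable fun x => inner ℂ (tubeL2 N b k y ((vertexEquiv N).symm x))
      (tubeL2 N b k' y' ((vertexEquiv N).symm x)) := (vertexEquiv N).symm.summable_iff.2
    (lp.summable_inner (𝕜 := ℂ) (G := fun _ : Vertex N => ℂ) (tubeL2 N b k y) (tubeL2 N b k' y'))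
  rw [lp.inner_eq_tsum (tubeL2 N b k y) (tubeL2 N b k' y'), ← (vertexEquiv N).symm.tsum_eq,
    Summable.tsum_prod hs, tsum_fintype]
  simp_rw [hpt, tsum_mul_left]
  rw [← Finset.sum_mul, sum_conj_tubeChar_mul]
  split_ifs with h
  · subst h
    rw [hc]
    simp only
    simp_rw [mul_assoc, tsum_mul_left]
    rw [mul_inv_cancel_left₀ hN, lp.inner_eq_tsum y y']
    refine tsum_congr fun i => ?_
    rw [← mul_assoc, mul_comm ((starRingEnd ℂ) _), Complex.mul_conj, Complex.normSq_eq_norm_sq,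
      norm_zpow, norm_tubePhase]
    simp
  · rw [zero_mul]

/-- The isometric embedding of the `k`-th channel. -/
def tubeU (k : Finset.Icc 1 N) : Ell2 ℤ →ₗᵢ[ℂ] Ell2 (Vertex N) where
  toFun := tubeL2 N b k
  map_add' y y' := by
    ext ω
    exact mul_add _ _ _
  map_smul' c y := by
    ext ω
    exact mul_left_comm _ _ _
  norm_map' y := by
    have h1 := inner_tubeL2 N b k k y y
    rw [if_pos rfl, inner_self_eq_norm_sq_to_K, inner_self_eq_norm_sq_to_K] at h1
    have h2 : ‖tubeL2 N b k y‖ ^ 2 = ‖y‖ ^ 2 := by exact_mod_cast h1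
    exact (pow_left_inj₀ (norm_nonneg _) (norm_nonneg _) two_ne_zero).1 h2

theorem tubeU_apply (k : Finset.Icc 1 N) (y : Ell2 ℤ) (n : ℤ) (j : Fin 2) (l : ZMod N) :
    tubeU N b k y (n, j, l) = tubeWeight N b k n l * y (n * 2 + (j : ℕ) + 1) := rfl

/-- Each crossing between consecutive cells shifts the power of `tubePhase` by one, exactly
cancelling the phase in `two_cos_eq`. Edges inside a cell see no phase and give the coefficient `1`.
-/
theorem hamiltonian_tubeU (v : EllInfty) (t : ℝ) (k : Finset.Icc 1 N) (y : Ell2 ℤ) :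
    hamiltonian N b v t (tubeU N b k y) = tubeU N b k (jacobi N b v t k y) := by
  have hκ := tubePhase_ne_zero N b k
  have hE : Complex.exp (Complex.I * (Real.pi * (k : ℕ) / N)) ≠ 0 := Complex.exp_ne_zero _
  ext ⟨n, j, l⟩
  fin_cases j
  · change hamiltonian N b v t (tubeU N b k y) (n, 0, l) = tubeU N b k (jacobi N b v t k y) (n, 0, l)
    rw [hamiltonian_apply_zero]
    simp only [tubeU_apply, jacobi_apply]
    have i1 : (n - 1) * 2 + ((1 : Fin 2) : ℕ) + 1 = n * 2 := by simp; ring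
    have i2 : n * 2 + ((1 : Fin 2) : ℕ) + 1 = n * 2 + 1 + 1 := by simp
    have i3 : n * 2 + ((0 : Fin 2) : ℕ) + 1 = n * 2 + 1 := by simp
    have a1 : aCoef N b k (n * 2 + 1 - 1) = 2 * |cCoef N b k| := by simp [aCoef]
    have a2 : aCoef N b k (n * 2 + 1) = 1 := by
      rw [aCoef, if_neg]; rw [Int.not_even_iff_odd]; exact ⟨n, by ring⟩
    rw [i1, i2, i3, a1, a2, add_sub_cancel_right, mul_comm 2 n]
    have w1 : tubeWeight N b k n l * (2 * ((|cCoef N b k| : ℝ) : ℂ)) =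
        Complex.exp (-(Complex.I * b)) * tubeWeight N b k (n - 1) l +
        Complex.exp (Complex.I * b) * tubeWeight N b k (n - 1) (l - 1) := by
      have hz : tubePhase N b k ^ n = tubePhase N b k ^ (n - 1) * tubePhase N b k := by
        rw [← zpow_add_one₀ hκ, sub_add_cancel]
      simp only [tubeWeight]
      rw [sub_eq_add_neg l 1, tubeChar_add, tubeChar_neg_one, hz]
      linear_combination (((Real.sqrt N)⁻¹ : ℝ) * tubePhase N b k ^ (n - 1) *
        tubeChar N k l : ℂ) * two_cos_eq N b k
    push_cast
    linear_combination (-y (n * 2)) * w1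
  · change hamiltonian N b v t (tubeU N b k y) (n, 1, l) = tubeU N b k (jacobi N b v t k y) (n, 1, l)
    rw [hamiltonian_apply_one]
    simp only [tubeU_apply, jacobi_apply]
    have i1 : (n + 1) * 2 + ((0 : Fin 2) : ℕ) + 1 = n * 2 + 2 + 1 := by simp; ring
    have i2 : n * 2 + ((1 : Fin 2) : ℕ) + 1 = n * 2 + 2 := by simp; ring
    have i3 : n * 2 + ((0 : Fin 2) : ℕ) + 1 = n * 2 + 2 - 1 := by simp; ring
    have a1 : aCoef N b k (n * 2 + 2) = 2 * |cCoef N b k| := by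
      rw [aCoef, if_pos]; exact ⟨n + 1, by ring⟩
    have a2 : aCoef N b k (n * 2 + 2 - 1) = 1 := by
      rw [aCoef, if_neg]; rw [Int.not_even_iff_odd]; exact ⟨n, by ring⟩
    rw [i1, i2, i3, a1, a2, mul_comm 2 n]
    have w1 : tubeWeight N b k n l * (2 * ((|cCoef N b k| : ℝ) : ℂ)) =
        Complex.exp (-(Complex.I * b)) * tubeWeight N b k (n + 1) (l + 1) +
        Complex.exp (Complex.I * b) * tubeWeight N b k (n + 1) l := by
      have hz : tubePhase N b k ^ (n + 1) = tubePhase N b k ^ n * tubePhase N b k :=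
        zpow_add_one₀ hκ _
      have hone : tubeChar N k 1 = (Complex.exp (Complex.I * (Real.pi * (k : ℕ) / N)) ^ 2)⁻¹ := by
        rw [← tubeChar_neg_one]
        refine eq_inv_of_mul_eq_one_left ?_
        rw [← tubeChar_add, add_neg_cancel, tubeChar_zero]
      simp only [tubeWeight]
      rw [tubeChar_add, hone, hz]
      linear_combination (((Real.sqrt N)⁻¹ : ℝ) * tubePhase N b k ^ n *
        tubeChar N k l : ℂ) * two_cos_eq_conj N b k
    push_cast
    linear_combination (-y (n * 2 + 2 + 1)) * w1

theorem tubeU_complete (x : Ell2 (Vertex N)) :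
    ∃ y : Finset.Icc 1 N → Ell2 ℤ, x = ∑ k, tubeU N b k (y k) := by
  have hmem : ∀ l : ZMod N, Memℓp (E := fun _ : ℤ => ℂ)
      (fun i => x ((vertexEquiv N).symm (l, i))) 2 := by
    intro l
    have h1 := (lp.memℓp x).summable (by norm_num)
    simp only [ENNReal.toReal_ofNat, Real.rpow_ofNat] at h1
    have h2 : Summable fun i : ℤ => ‖x ((vertexEquiv N).symm (l, i))‖ ^ 2 :=
      h1.comp_injective (i := fun i : ℤ => (vertexEquiv N).symm (l, i)) fun i i' hi => by
      have := (vertexEquiv N).symm.injective hi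
      simpa using this
    exact memℓp_gen (by simpa using h2)
  let X : ZMod N → Ell2 ℤ := fun l => ⟨fun i => x ((vertexEquiv N).symm (l, i)), hmem l⟩
  have hw : ∀ (k : Finset.Icc 1 N) (l : ZMod N), ∃ C : ℝ, ∀ i : ℤ,
      ‖(starRingEnd ℂ) (tubeWeight N b k ((siteEquiv 2).symm i).2 l)‖ ≤ C := fun k l =>
    ⟨(Real.sqrt N)⁻¹, fun i => by rw [RCLike.norm_conj, norm_tubeWeight]⟩
  -- The components are the adjoints of the embeddings applied to `x`. Orthogonality of the
  -- characters in the index `k` recovers `x`.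
  refine ⟨fun k => ∑ l, weighted _ (Equiv.refl ℤ) (hw k l) (X l), ?_⟩
  ext ω
  obtain ⟨⟨l, i⟩, rfl⟩ := (vertexEquiv N).symm.surjective ω
  have e1 : ∀ (q : Finset.Icc 1 N) (z : Ell2 ℤ), tubeU N b q z ((vertexEquiv N).symm (l, i)) =
      tubeWeight N b q ((siteEquiv 2).symm i).2 l * z i := by
    intro q z
    change tubeFun N b q z ((vertexEquiv N).symm (l, i)) = _
    rw [tubeFun, Equiv.apply_symm_apply]
    rfl
  rw [lp.coeFn_sum, Finset.sum_apply]
  simp_rw [e1, lp.coeFn_sum, Finset.sum_apply, weighted_apply, Finset.mul_sum]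
  rw [Finset.sum_comm]
  have hN : (N : ℂ) ≠ 0 := Nat.cast_ne_zero.2 (NeZero.ne N)
  have e2 : ∀ (k : Finset.Icc 1 N) (l' : ZMod N),
      tubeWeight N b k ((siteEquiv 2).symm i).2 l *
        ((starRingEnd ℂ) (tubeWeight N b k ((siteEquiv 2).symm i).2 l') *
          X l' ((Equiv.refl ℤ) i)) = (N : ℂ)⁻¹ * tubeChar N k (l - l') * X l' i := by
    intro k l'
    have e3 : (((Real.sqrt N)⁻¹ : ℝ) : ℂ) * (((Real.sqrt N)⁻¹ : ℝ) : ℂ) = (N : ℂ)⁻¹ := by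
      rw [← Complex.ofReal_mul, ← mul_inv, Real.mul_self_sqrt (Nat.cast_nonneg _)]
      push_cast; rfl
    have e4 : tubePhase N b k ^ ((siteEquiv 2).symm i).2 *
        (starRingEnd ℂ) (tubePhase N b k ^ ((siteEquiv 2).symm i).2) = 1 := by
      rw [Complex.mul_conj, Complex.normSq_eq_norm_sq, norm_zpow, norm_tubePhase]
      simp
    rw [sub_eq_add_neg, tubeChar_add, ← conj_tubeChar, ← e3]
    simp only [tubeWeight, map_mul, Complex.conj_ofReal, Equiv.refl_apply]
    linear_combination ((((Real.sqrt N)⁻¹ : ℝ) : ℂ) * (((Real.sqrt N)⁻¹ : ℝ) : ℂ) *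
      tubeChar N k l * (starRingEnd ℂ) (tubeChar N k l') * X l' i) * e4
  simp_rw [e2, ← Finset.sum_mul, ← Finset.mul_sum, sum_tubeChar, sub_eq_zero]
  rw [Finset.sum_eq_single l]
  · rw [if_pos rfl, inv_mul_cancel₀ hN, one_mul]
  · intro l' _ hl'
    rw [if_neg hl'.symm]; simp
  · simp

/-- The diagonalization of the nanotube Hamiltonian. -/
def tubeModel (v : EllInfty) (t : ℝ) {I : Type} [Fintype I]
    (D : ∀ k : Finset.Icc 1 N, DiagModel (jacobi N b v t k) I) :
    DiagModel (hamiltonian N b v t) (Finset.Icc 1 N × I) where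
  lam x := (D x.1).lam x.2
  U x := (tubeU N b x.1).comp ((D x.1).U x.2)
  intertwine x f := by
    change hamiltonian N b v t (tubeU N b x.1 ((D x.1).U x.2 f)) =
      tubeU N b x.1 ((D x.1).U x.2 (mulC (ofRealC ((D x.1).lam x.2)) f))
    rw [hamiltonian_tubeU, (D x.1).intertwine]
  orth x x' hx f g := by
    have h1 := inner_tubeL2 N b x.1 x'.1 ((D x.1).U x.2 f) ((D x'.1).U x'.2 g)
    refine h1.trans ?_
    split_ifs with h
    · obtain ⟨k, i⟩ := x
      obtain ⟨k', i'⟩ := x'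
      simp only at h
      subst h
      exact (D k).orth i i' (fun h => hx (by rw [h])) f g
    · rfl
  complete w := by
    obtain ⟨y, rfl⟩ := tubeU_complete N b w
    choose f hf using fun k => (D k).complete (y k)
    refine ⟨fun x => f x.1 x.2, ?_⟩
    rw [Fintype.sum_prod_type]
    refine Finset.sum_congr rfl fun k _ => ?_
    rw [hf k, map_sum]
    rfl

end Decomposition

end
end Nanotube

namespace Nanotube
noncomputable section

/-! ### Location of the levels -/

/-- One neighbour's contribution in perturbation theory: `g` is the neighbouring component, `d` the
potential difference and `L` the shift of the level. Replacing `L + d` by `d` costs `4 * (4 / Γ)`,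
so `d * g` is within `28 / Γ` of `a`. Multiplication by `a / d`, at most `3 / Γ`, gives `84`. -/
theorem abs_mul_sub_sq_div_le {L d g a Γ : ℝ} (hΓ : 0 < Γ) (hd : Γ ≤ |d|) (hL : |L| ≤ 4)
    (hg : |g| ≤ 4 / Γ) (ha0 : 0 ≤ a) (ha : a ≤ 3) (h : |(L + d) * g - a| ≤ 12 / Γ) :
    |a * g - a ^ 2 / d| ≤ 84 / Γ ^ 2 := by
  have hd0 : d ≠ 0 := by
    rintro rfl
    rw [abs_zero] at hd; linarith
  have h1 : |d * g - a| ≤ 28 / Γ := by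
    calc |d * g - a| = |((L + d) * g - a) - L * g| := by congr 1; ring
      _ ≤ |(L + d) * g - a| + |L * g| := abs_sub _ _
      _ ≤ 12 / Γ + 4 * (4 / Γ) := by rw [abs_mul]; gcongr
      _ = 28 / Γ := by ring
  have h2 : a * g - a ^ 2 / d = a * (d * g - a) / d := by field_simp
  rw [h2, abs_div, abs_mul, abs_of_nonneg ha0, div_le_div_iff₀ (by linarith) (by positivity)]
  have h3 : |d * g - a| * Γ ≤ 28 := by rwa [le_div_iff₀ hΓ] at h1
  have h4 : a * (|d * g - a| * Γ) ≤ 3 * 28 := by gcongr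
  nlinarith

namespace SepJacobi

variable {m : ℕ} {a u : ℤ → ℝ} (h : SepJacobi m a u)
include h

theorem cycNext_coeff (i : Fin m) :
    a ((cycNext i : Fin m) : ℕ) = a ((i : ℕ) + 1) ∧
      u (((cycNext i : Fin m) : ℕ) + 1) = u ((i : ℕ) + 1 + 1) := by
  rw [cycNext_val]
  split_ifs with h1
  · have h2 : ((i : ℕ) + 1 : ℤ) = m := by omega
    have h3 := h.u_per 1
    rw [h2, h.a_m, add_comm (m : ℤ) 1, h3]
    simp
  · push_cast
    exact ⟨rfl, rfl⟩

theorem cycPrev_coeff (i : Fin m) :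
    a (((cycPrev i : Fin m) : ℕ) + 1) = a (i : ℕ) ∧
      u (((cycPrev i : Fin m) : ℕ) + 1) = u (i : ℕ) := by
  have hi := i.2
  rw [cycPrev_val]
  split_ifs with h1
  · have h2 : ((m - 1 : ℕ) : ℤ) + 1 = m := by omega
    have h3 := h.u_per 0
    rw [zero_add] at h3
    rw [h2, h.a_m, h3, h1]
    simp
  · have h2 : (((i : ℕ) - 1 : ℕ) : ℤ) + 1 = (i : ℕ) := by omega
    rw [h2]
    exact ⟨rfl, rfl⟩

/-- With the eigenvector normalized to `1` at its own site, the other components are `O(1/Γ)`. The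
rows of the two neighbours determine their components to order `1/Γ ^ 2`, and insertion into the
central row gives the second-order shift. The error `168` is `84` for each neighbour. -/
theorem level_shift (i : Fin m) {τ : ℝ} (hτ : τ = 1 ∨ τ = -1) {Γ : ℝ} (hΓ : 20 ≤ Γ)
    (hgap : ∀ i j : Fin m, i ≠ j → Γ ≤ |u ((i : ℕ) + 1) - u ((j : ℕ) + 1)|) :
    |level m a u i τ - u ((i : ℕ) + 1) -
      (a (i : ℕ) ^ 2 / (u ((i : ℕ) + 1) - u (i : ℕ)) +
        a ((i : ℕ) + 1) ^ 2 / (u ((i : ℕ) + 1) - u ((i : ℕ) + 1 + 1)))| ≤ 168 / Γ ^ 2 := by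
  have hi := i.2
  have hm := h.hm
  have hΓ0 : 0 < Γ := by linarith
  have hx : τ ∈ Icc (-1 : ℝ) 1 := by rcases hτ with rfl | rfl <;> simp
  have hinv : τ⁻¹ = τ := by rcases hτ with rfl | rfl <;> norm_num
  have hn : ‖τ‖ = 1 := by rcases hτ with rfl | rfl <;> norm_num
  obtain ⟨hclose, hroot⟩ := h.level_spec τ hx i
  set z := level m a u i τ with hz
  have hcp : (cycMatrix m a u τ).charpoly = levelPoly m a u τ := by
    rw [h.charpoly_cycMatrix τ (by rcases hτ with rfl | rfl <;> norm_num), hinv]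
    congr 1; ring
  rw [← hcp, Matrix.eval_charpoly] at hroot
  obtain ⟨f, hf, hfz⟩ := Matrix.exists_mulVec_eq_zero_iff.2 hroot
  rw [scalar_sub_mulVec, sub_eq_zero] at hfz
  obtain ⟨k, hk⟩ := @Finite.exists_max _ _ _ ⟨i⟩ _ (fun j => ‖f j‖)
  have hfk : f k ≠ 0 := by
    intro hk0
    refine hf (funext fun j => ?_)
    have := hk j
    rw [hk0, norm_zero] at this
    exact norm_le_zero_iff.1 this
  -- The eigenvector peaks at its own site: otherwise the level would be within `3` of one site and
  -- within `4` of another.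
  have hki : k = i := by
    by_contra hne
    have h1 := norm_sub_le_of_row a u τ hn h.norm_add_le z f k hk hfk (by rw [← hfz]; rfl)
    rw [Real.norm_eq_abs] at h1
    have h2 := h.sep i k (Ne.symm hne)
    have h3 := abs_sub_le (u ((i : ℕ) + 1)) z (u ((k : ℕ) + 1))
    rw [abs_sub_comm (u _) z] at h3
    linarith
  subst hki
  set g : Fin m → ℝ := fun j => f j / f k with hg
  have hgk : g k = 1 := div_self hfk
  have hg1 : ∀ j, |g j| ≤ 1 := by
    intro j
    rw [hg]
    simp only
    rw [abs_div, div_le_one (abs_pos.2 hfk)]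
    exact hk j
  have hrow : ∀ j : Fin m, (z - u ((j : ℕ) + 1)) * g j =
      a ((j : ℕ) + 1) * (if (j : ℕ) + 1 = m then τ else 1) * g (cycNext j) +
      a (j : ℕ) * (if (j : ℕ) = 0 then τ else 1) * g (cycPrev j) := by
    intro j
    have h1 := congrFun hfz j
    rw [cycMatrix_mulVec, hinv, Pi.smul_apply, smul_eq_mul] at h1
    simp only [hg]
    field_simp
    linear_combination h1
  have hs1 : ∀ j : Fin m, |(if (j : ℕ) + 1 = m then τ else 1)| = 1 := by
    intro j; split_ifs; exacts [hn, abs_one]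
  have hs0 : ∀ j : Fin m, |(if (j : ℕ) = 0 then τ else 1)| = 1 := by
    intro j; split_ifs; exacts [hn, abs_one]
  have ha3 : ∀ n, a n ≤ 3 := fun n => by linarith [h.a_add_le n, h.a_nonneg (n + 1)]
  -- Row `j` gives `3 / (Γ - 4)`, which is at most `4 / Γ` once `Γ ≥ 16`.
  have hgs : ∀ j, j ≠ k → |g j| ≤ 4 / Γ := by
    intro j hj
    have h1 : |z - u ((j : ℕ) + 1)| * |g j| ≤ 3 := by
      rw [← abs_mul, hrow]
      refine (abs_add_le _ _).trans ?_
      rw [abs_mul, abs_mul, abs_mul, abs_mul, hs1, hs0, abs_of_nonneg (h.a_nonneg _),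
        abs_of_nonneg (h.a_nonneg _), mul_one, mul_one]
      have e1 := mul_le_mul_of_nonneg_left (hg1 (cycNext j)) (h.a_nonneg ((j : ℕ) + 1))
      have e2 := mul_le_mul_of_nonneg_left (hg1 (cycPrev j)) (h.a_nonneg (j : ℕ))
      have e3 := h.a_add_le (j : ℕ)
      linarith
    have h2 : Γ - 4 ≤ |z - u ((j : ℕ) + 1)| := by
      have h2 := hgap k j hj.symm
      have h3 := abs_sub_le (u ((k : ℕ) + 1)) z (u ((j : ℕ) + 1))
      rw [abs_sub_comm (u _) z] at h3
      linarith
    rw [le_div_iff₀ hΓ0]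
    have h3 : (Γ - 4) * |g j| ≤ 3 := le_trans (by gcongr) h1
    nlinarith [abs_nonneg (g j)]
  have hnk : cycNext k ≠ k := by
    intro he
    have := congrArg Fin.val he
    rw [cycNext_val] at this
    split_ifs at this <;> omega
  have hpk : cycPrev k ≠ k := by
    intro he
    have := congrArg Fin.val he
    rw [cycPrev_val] at this
    split_ifs at this <;> omega
  -- A second neighbour is not the central site, because `m ≥ 3`. Its component is therefore small
  -- too.
  have hnnk : cycNext (cycNext k) ≠ k := by
    intro he
    have := congrArg Fin.val he
    rw [cycNext_val, cycNext_val] at this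
    split_ifs at this <;> omega
  have hppk : cycPrev (cycPrev k) ≠ k := by
    intro he
    have := congrArg Fin.val he
    rw [cycPrev_val, cycPrev_val] at this
    split_ifs at this <;> omega
  have hpn : cycPrev (cycNext k) = k := ((cycNext_eq_iff k _).1 rfl).symm
  have hnp : cycNext (cycPrev k) = k := ((cycNext_eq_iff _ k).2 rfl).symm
  obtain ⟨an, un⟩ := h.cycNext_coeff k
  obtain ⟨ap, up⟩ := h.cycPrev_coeff k
  have hss : τ * τ = 1 := by rcases hτ with rfl | rfl <;> norm_num
  have sn : (if ((cycNext k : Fin m) : ℕ) = 0 then τ else 1) =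
      if (k : ℕ) + 1 = m then τ else 1 := by
    rw [cycNext_val]
    by_cases h1 : (k : ℕ) + 1 = m <;> simp [h1]
  have sp : (if ((cycPrev k : Fin m) : ℕ) + 1 = m then τ else 1) =
      if (k : ℕ) = 0 then τ else 1 := by
    rw [cycPrev_val]
    by_cases h1 : (k : ℕ) = 0
    · simp only [h1, if_true]
      rw [if_pos (by omega)]
    · simp only [h1, if_false]
      rw [if_neg (by omega)]
  set σ := (if (k : ℕ) + 1 = m then τ else 1) with hσ
  set ρ := (if (k : ℕ) = 0 then τ else 1) with hρ
  -- The boundary sign is met once on leaving the site and once on returning, so it drops out at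
  -- second order: the shift is the same at both band edges.
  have hσ2 : σ * σ = 1 := by rw [hσ]; split_ifs <;> simp [hss]
  have hρ2 : ρ * ρ = 1 := by rw [hρ]; split_ifs <;> simp [hss]
  have hσ1 : |σ| = 1 := hs1 k
  have hρ1 : |ρ| = 1 := hs0 k
  have rn := hrow (cycNext k)
  have rp := hrow (cycPrev k)
  have rk := hrow k
  rw [hgk, mul_one] at rk
  rw [hpn, sn, hgk, an, un] at rn
  rw [hnp, sp, hgk, ap, up] at rp
  have hL : |z - u ((k : ℕ) + 1)| ≤ 4 := hclose.le
  have c1 : |a ((k : ℕ) + 1) * (σ * g (cycNext k)) -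
      a ((k : ℕ) + 1) ^ 2 / (u ((k : ℕ) + 1) - u ((k : ℕ) + 1 + 1))| ≤ 84 / Γ ^ 2 := by
    refine abs_mul_sub_sq_div_le (L := z - u ((k : ℕ) + 1)) hΓ0 ?_ hL ?_ (h.a_nonneg _) (ha3 _) ?_
    · rw [← un]; exact hgap k _ hnk.symm
    · rw [abs_mul, hσ1, one_mul]; exact hgs _ hnk
    · have : (z - u ((k : ℕ) + 1) + (u ((k : ℕ) + 1) - u ((k : ℕ) + 1 + 1))) *
          (σ * g (cycNext k)) - a ((k : ℕ) + 1) =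
          σ * (a (((cycNext k : Fin m) : ℕ) + 1) *
            (if ((cycNext k : Fin m) : ℕ) + 1 = m then τ else 1) *
              g (cycNext (cycNext k))) := by
        linear_combination σ * rn + a ((k : ℕ) + 1) * hσ2
      rw [this, abs_mul, abs_mul, abs_mul, hσ1, hs1, abs_of_nonneg (h.a_nonneg _), one_mul, mul_one]
      calc _ ≤ 3 * (4 / Γ) := by gcongr; exacts [ha3 _, hgs _ hnnk]
        _ = 12 / Γ := by ring
  have c2 : |a (k : ℕ) * (ρ * g (cycPrev k)) -
      a (k : ℕ) ^ 2 / (u ((k : ℕ) + 1) - u (k : ℕ))| ≤ 84 / Γ ^ 2 := by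
    refine abs_mul_sub_sq_div_le (L := z - u ((k : ℕ) + 1)) hΓ0 ?_ hL ?_ (h.a_nonneg _) (ha3 _) ?_
    · rw [← up]; exact hgap k _ hpk.symm
    · rw [abs_mul, hρ1, one_mul]; exact hgs _ hpk
    · have : (z - u ((k : ℕ) + 1) + (u ((k : ℕ) + 1) - u (k : ℕ))) *
          (ρ * g (cycPrev k)) - a (k : ℕ) =
          ρ * (a ((cycPrev k : Fin m) : ℕ) *
            (if ((cycPrev k : Fin m) : ℕ) = 0 then τ else 1) *
              g (cycPrev (cycPrev k))) := by
        linear_combination ρ * rp + a (k : ℕ) * hρ2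
      rw [this, abs_mul, abs_mul, abs_mul, hρ1, hs0, abs_of_nonneg (h.a_nonneg _), one_mul, mul_one]
      calc _ ≤ 3 * (4 / Γ) := by gcongr; exacts [ha3 _, hgs _ hppk]
        _ = 12 / Γ := by ring
  rw [rk]
  calc _ = |(a ((k : ℕ) + 1) * (σ * g (cycNext k)) -
      a ((k : ℕ) + 1) ^ 2 / (u ((k : ℕ) + 1) - u ((k : ℕ) + 1 + 1))) +
      (a (k : ℕ) * (ρ * g (cycPrev k)) -
      a (k : ℕ) ^ 2 / (u ((k : ℕ) + 1) - u (k : ℕ)))| := by congr 1; ring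
    _ ≤ 84 / Γ ^ 2 + 84 / Γ ^ 2 := (abs_add_le _ _).trans (add_le_add c1 c2)
    _ = 168 / Γ ^ 2 := by ring

end SepJacobi

/-! ### The sorted list of band edges -/

section SortedEdges

variable {ι : Type} (lo hi : ι → ℝ)

theorem getD_flatMap_pair (l : List ι) (k : ℕ) (hk : k < l.length) :
    (l.flatMap fun i => [lo i, hi i]).getD (2 * k) 0 = lo l[k] ∧
      (l.flatMap fun i => [lo i, hi i]).getD (2 * k + 1) 0 = hi l[k] := by
  induction l generalizing k with
  | nil => simp at hk
  | cons x l ih =>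
    cases k with
    | zero => simp
    | succ k =>
      have h1 := ih k (by simpa using hk)
      have e : 2 * (k + 1) = 2 * k + 1 + 1 := by ring
      simpa [e] using h1

theorem coe_flatMap_pair (f g : ι → ℝ) (l : List ι) :
    ((l.flatMap fun i => [min (f i) (g i), max (f i) (g i)] : List ℝ) : Multiset ℝ) =
      (l : Multiset ι).map f + (l : Multiset ι).map g := by
  induction l with
  | nil => simp
  | cons x l ih =>
    rw [List.flatMap_cons, ← Multiset.coe_add, ih, ← Multiset.cons_coe x l,
      Multiset.map_cons, Multiset.map_cons]
    have h1 : (([min (f x) (g x), max (f x) (g x)] : List ℝ) : Multiset ℝ) = {f x} + {g x} := by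
      rcases le_total (f x) (g x) with h | h
      · rw [min_eq_left h, max_eq_right h]; rfl
      · rw [min_eq_right h, max_eq_left h, add_comm]; rfl
    rw [h1, ← Multiset.singleton_add, ← Multiset.singleton_add]
    abel

theorem sort_eq_flatMap_pair (f g : ι → ℝ) (l : List ι)
    (hl : l.Pairwise fun i j => max (f i) (g i) ≤ min (f j) (g j)) :
    ((l : Multiset ι).map f + (l : Multiset ι).map g).sort (· ≤ ·) =
      l.flatMap fun i => [min (f i) (g i), max (f i) (g i)] := by
  rw [← coe_flatMap_pair]
  have hs : (l.flatMap fun i => [min (f i) (g i), max (f i) (g i)]).Pairwise (· ≤ ·) := by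
    rw [List.pairwise_flatMap]
    refine ⟨fun i _ => by simp, hl.imp fun {i j} hij => ?_⟩
    simp only [List.mem_cons, List.not_mem_nil, or_false]
    have h1 : min (f i) (g i) ≤ max (f i) (g i) := min_le_max
    have h2 : min (f j) (g j) ≤ max (f j) (g j) := min_le_max
    rintro x (rfl | rfl) y (rfl | rfl)
    · exact h1.trans hij
    · exact (h1.trans hij).trans h2
    · exact hij
    · exact hij.trans h2
  rw [Multiset.coe_sort]
  exact List.mergeSort_eq_self _ hs

end SortedEdges

end
end Nanotube

namespace Nanotube
noncomputable section

/-! ### The channels of the nanotube at large coupling -/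

theorem aCoef_nonneg (N : ℕ) (b : ℝ) (k : ℕ) (n : ℤ) : 0 ≤ aCoef N b k n := by
  unfold aCoef; split_ifs <;> positivity

theorem aCoef_add_le (N : ℕ) (b : ℝ) (k : ℕ) (n : ℤ) :
    aCoef N b k n + aCoef N b k (n + 1) ≤ 3 := by
  have h1 : |cCoef N b k| ≤ 1 := Real.abs_cos_le_one _
  unfold aCoef
  by_cases h : Even n
  · rw [if_pos h, if_neg (by rw [Int.even_add_one]; exact not_not.2 h)]; linarith
  · rw [if_neg h, if_pos (Int.even_add_one.2 h)]; linarith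

theorem aCoef_periodic (N p : ℕ) (b : ℝ) (k : ℕ) :
    Function.Periodic (aCoef N b k) ((2 * p : ℕ) : ℤ) := by
  intro n
  have : Even (n + ((2 * p : ℕ) : ℤ)) ↔ Even n := by
    rw [Int.even_add]
    simp
  simp only [aCoef, this]

theorem cycProd_aCoef (N p : ℕ) (b : ℝ) (k : ℕ) :
    cycProd (2 * p) (aCoef N b k) = |2 * cCoef N b k| ^ p := by
  rw [cycProd, Fin.prod_univ_eq_prod_range (fun i => aCoef N b k (i : ℤ)) (2 * p)]
  induction p with
  | zero => simp
  | succ p ih =>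
    have e1 : aCoef N b k ((2 * p : ℕ) : ℤ) = |2 * cCoef N b k| := by
      rw [aCoef, if_pos (by simp), abs_mul, abs_two]
    have e2 : aCoef N b k ((2 * p + 1 : ℕ) : ℤ) = 1 := by
      rw [aCoef, if_neg]
      rw [Int.not_even_iff_odd]
      exact ⟨p, by push_cast; ring⟩
    rw [mul_add, mul_one, Finset.prod_range_succ, Finset.prod_range_succ, ih, e1, e2, mul_one,
      pow_succ]

theorem aCoef_congr {N : ℕ} {b : ℝ} {k k' : ℕ} (h : |cCoef N b k'| = |cCoef N b k|) :
    aCoef N b k' = aCoef N b k := by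
  funext n
  simp only [aCoef, h]

/-- Equality of the moduli means equality of the cosines of the doubled angles. Either the angles
agree modulo `2π`, forcing `k = k'` since both lie in `1, …, N`, or their sum is a multiple of `2π`,
forcing `b` to be a multiple of `π / (2N)`. -/
theorem abs_cCoef_ne {N : ℕ} (hN : 1 ≤ N) {b : ℝ} (hb : ∀ m : ℤ, b ≠ Real.pi / (2 * N) * m)
    {k k' : ℕ} (hk : k ∈ Finset.Icc 1 N) (hk' : k' ∈ Finset.Icc 1 N) (hne : k ≠ k') :
    |cCoef N b k| ≠ |cCoef N b k'| := by
  intro h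
  have hN0 : (0 : ℝ) < N := by exact_mod_cast hN
  have hpi := Real.pi_pos
  rw [Finset.mem_Icc] at hk hk'
  have h1 : Real.cos (2 * (b + Real.pi * k / N)) = Real.cos (2 * (b + Real.pi * k' / N)) := by
    have h2 : cCoef N b k ^ 2 = cCoef N b k' ^ 2 := (sq_eq_sq_iff_abs_eq_abs _ _).2 h
    rw [Real.cos_two_mul, Real.cos_two_mul]
    unfold cCoef at h2
    rw [h2]
  rw [Real.cos_eq_cos_iff] at h1
  obtain ⟨j, hj | hj⟩ := h1
  · have h2 : (k' : ℝ) = j * N + k := by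
      field_simp at hj
      nlinarith
    have h3 : (k' : ℤ) = j * N + k := by exact_mod_cast h2
    have h4 : j = 0 := by
      by_contra hj0
      rcases lt_or_gt_of_ne hj0 with h5 | h5
      · have : j * (N : ℤ) ≤ -1 * N := by gcongr; omega
        omega
      · have : 1 * (N : ℤ) ≤ j * N := by gcongr; omega
        omega
    rw [h4] at h3
    omega
  · refine hb (j * N - k - k') ?_
    push_cast
    field_simp
    field_simp at hj
    nlinarith

/-- The potential of the channels at coupling `t`. -/
def scaled (v : EllInfty) (t : ℝ) (n : ℤ) : ℝ := t * v n

section Channel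

variable {N p : ℕ} {b : ℝ} {v : EllInfty} {t : ℝ} {k : ℕ}

theorem exists_gap (v : EllInfty) (p : ℕ)
    (hdist : Function.Injective (fun i : Fin (2 * p) => v (((i : ℕ) : ℤ) + 1))) :
    ∃ g : ℝ, 0 < g ∧ ∀ i j : Fin (2 * p), i ≠ j → g ≤ |v ((i : ℕ) + 1) - v ((j : ℕ) + 1)| := by
  have h : ∀ x : Fin (2 * p) × Fin (2 * p), x.1 ≠ x.2 →
      ∃ g : ℝ, 0 < g ∧ g ≤ |v ((x.1 : ℕ) + 1) - v ((x.2 : ℕ) + 1)| := fun x hx =>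
    ⟨_, abs_pos.2 (sub_ne_zero.2 (hdist.ne hx)), le_rfl⟩
  choose! G hG0 hG using h
  -- The element `1` only makes the finite set visibly nonempty, so that its minimum is defined.
  let S := insert 1 (((Finset.univ : Finset (Fin (2 * p) × Fin (2 * p))).filter
    fun x => x.1 ≠ x.2).image G)
  refine ⟨S.min' (Finset.insert_nonempty _ _), ?_, fun i j hij => ?_⟩
  · rw [Finset.lt_min'_iff]
    intro y hy
    rw [Finset.mem_insert, Finset.mem_image] at hy
    rcases hy with rfl | ⟨x, hx, rfl⟩
    · exact one_pos
    · exact hG0 x (Finset.mem_filter.1 hx).2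
  · refine (Finset.min'_le _ _ ?_).trans (hG (i, j) hij)
    exact Finset.mem_insert_of_mem (Finset.mem_image_of_mem _
      (Finset.mem_filter.2 ⟨Finset.mem_univ _, hij⟩))

theorem scaled_gap {g : ℝ}
    (hg : ∀ i j : Fin (2 * p), i ≠ j → g ≤ |v ((i : ℕ) + 1) - v ((j : ℕ) + 1)|) (ht : 0 ≤ t)
    (i j : Fin (2 * p)) (hij : i ≠ j) :
    t * g ≤ |scaled v t ((i : ℕ) + 1) - scaled v t ((j : ℕ) + 1)| := by
  rw [scaled, scaled, ← mul_sub, abs_mul, abs_of_nonneg ht]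
  exact mul_le_mul_of_nonneg_left (hg i j hij) ht

theorem sepJacobi_scaled (N : ℕ) (b : ℝ) (k : ℕ) (hp : 2 ≤ p)
    (hper : Function.Periodic (v : ℤ → ℝ) ((2 * p : ℕ) : ℤ)) {g : ℝ}
    (hg : ∀ i j : Fin (2 * p), i ≠ j → g ≤ |v ((i : ℕ) + 1) - v ((j : ℕ) + 1)|)
    (ht0 : 0 ≤ t) (ht : 20 ≤ t * g) : SepJacobi (2 * p) (aCoef N b k) (scaled v t) where
  hm := by omega
  a_per := aCoef_periodic N p b k
  u_per n := by rw [scaled, hper n]; rfl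
  a_nonneg := aCoef_nonneg N b k
  a_add_le := aCoef_add_le N b k
  sep i j hij := ht.trans (scaled_gap hg ht0 i j hij)

/-- The two edges of the band near `t v_{n+1}`. -/
theorem bandLeft_bandRight (h : SepJacobi (2 * p) (aCoef N b k) (scaled v t)) (ht : 0 < t)
    (α : Equiv.Perm (Fin (2 * p)))
    (hα : StrictMono (fun i : Fin (2 * p) => v (((α i : ℕ) : ℤ) + 1))) (n : Fin (2 * p)) :
    bandLeft N p b v t k (α.symm n) =
      min (level (2 * p) (aCoef N b k) (scaled v t) n 1)
        (level (2 * p) (aCoef N b k) (scaled v t) n (-1)) ∧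
    bandRight N p b v t k (α.symm n) =
      max (level (2 * p) (aCoef N b k) (scaled v t) n 1)
        (level (2 * p) (aCoef N b k) (scaled v t) n (-1)) := by
  have hm := h.hm
  set f : Fin (2 * p) → ℝ := fun i => level (2 * p) (aCoef N b k) (scaled v t) i 1 with hf
  set f' : Fin (2 * p) → ℝ := fun i => level (2 * p) (aCoef N b k) (scaled v t) i (-1) with hf'
  set l : List (Fin (2 * p)) := List.ofFn α with hl
  have h1 : (1 : ℝ) ∈ Icc (-1 : ℝ) 1 := by simp
  have h2 : (-1 : ℝ) ∈ Icc (-1 : ℝ) 1 := by simp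
  have hroots : ∀ τ : ℝ, τ = 1 ∨ τ = -1 →
      (floquetMatrix (2 * p) (aCoef N b k) (fun n => t * v n) τ).charpoly.roots =
        (l : Multiset (Fin (2 * p))).map
          fun i => level (2 * p) (aCoef N b k) (scaled v t) i τ := by
    intro τ hτ
    have hl2 : (l : Multiset (Fin (2 * p))) = Finset.univ.val := by
      have e1 : (l : Multiset (Fin (2 * p))) = Multiset.map α Finset.univ.val := by
        rw [hl, List.ofFn_eq_map]
        rfl
      rw [e1]
      exact congrArg Finset.val (Finset.map_univ_equiv α)
    have hτ1 : τ ∈ Icc (-1 : ℝ) 1 := by rcases hτ with rfl | rfl <;> simp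
    rw [hl2, ← h.roots_levelPoly hτ1, floquetMatrix_eq_cycMatrix (by omega)]
    have e1 := h.charpoly_cycMatrix τ (by rcases hτ with rfl | rfl <;> norm_num)
    have e2 : (τ + τ⁻¹) / 2 = τ := by rcases hτ with rfl | rfl <;> norm_num
    rw [e2] at e1
    exact congrArg Polynomial.roots e1
  -- Both edges of a band lie in the same window of radius `4`, and the windows are ordered as the
  -- potentials are. Listing the sites along `α` therefore sorts the edges in pairs.
  have hpair : l.Pairwise fun i j => max (f i) (f' i) ≤ min (f j) (f' j) := by
    rw [hl, List.pairwise_ofFn]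
    intro i j hij
    have hv : scaled v t ((α i : ℕ) + 1) < scaled v t ((α j : ℕ) + 1) :=
      mul_lt_mul_of_pos_left (hα hij) ht
    have hs := h.sep (α i) (α j) (α.injective.ne hij.ne)
    rw [abs_of_neg (by linarith)] at hs
    have a1 := abs_lt.1 (h.level_spec 1 h1 (α i)).1
    have a2 := abs_lt.1 (h.level_spec (-1) h2 (α i)).1
    have a3 := abs_lt.1 (h.level_spec 1 h1 (α j)).1
    have a4 := abs_lt.1 (h.level_spec (-1) h2 (α j)).1
    simp only [hf, hf']
    refine max_le (le_min ?_ ?_) (le_min ?_ ?_) <;> linarith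
  have hedges : bandEdges N p b v t k =
      l.flatMap fun i => [min (f i) (f' i), max (f i) (f' i)] := by
    rw [bandEdges, hroots 1 (Or.inl rfl), hroots (-1) (Or.inr rfl)]
    exact sort_eq_flatMap_pair f f' l hpair
  have hlen : ((α.symm n : Fin (2 * p)) : ℕ) < l.length := by
    rw [hl, List.length_ofFn]; exact (α.symm n).2
  have hget : l[((α.symm n : Fin (2 * p)) : ℕ)] = n := by
    simp [hl]
  -- The index is within range, so the default value `0` of `getD` is never returned.
  have hd := getD_flatMap_pair (fun i => min (f i) (f' i)) (fun i => max (f i) (f' i)) l _ hlen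
  rw [hget, ← hedges] at hd
  exact hd

theorem band_eq_uIcc (h : SepJacobi (2 * p) (aCoef N b k) (scaled v t)) (ht : 0 < t)
    (α : Equiv.Perm (Fin (2 * p)))
    (hα : StrictMono (fun i : Fin (2 * p) => v (((α i : ℕ) : ℤ) + 1))) (n : Fin (2 * p)) :
    band N p b v t k (α.symm n) =
      uIcc (level (2 * p) (aCoef N b k) (scaled v t) n (-1))
        (level (2 * p) (aCoef N b k) (scaled v t) n 1) := by
  obtain ⟨h1, h2⟩ := bandLeft_bandRight h ht α hα n
  rw [band, h1, h2, uIcc_comm, uIcc]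

/-- The diagonalization of the channel `k`. -/
def channelModel [NeZero (2 * p)] (h : SepJacobi (2 * p) (aCoef N b k) (scaled v t)) :
    DiagModel (jacobi N b v t k) (Fin (2 * p)) :=
  h.diagModel _ (jacobi_apply N b v t k)

/-- This is `level_shift` with gap `Γ = t * g`. The potential differences scale with `t` and appear
with the opposite sign in `shiftC`. -/
theorem level_asymptotic (h : SepJacobi (2 * p) (aCoef N b k) (scaled v t)) (ht : 0 < t) {g : ℝ}
    (hg : ∀ i j : Fin (2 * p), i ≠ j → g ≤ |v ((i : ℕ) + 1) - v ((j : ℕ) + 1)|)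
    (htg : 20 ≤ t * g) (n : Fin (2 * p)) {τ : ℝ} (hτ : τ = 1 ∨ τ = -1) :
    |level (2 * p) (aCoef N b k) (scaled v t) n τ -
      (t * v (((n : ℕ) : ℤ) + 1) - shiftC N b v k (((n : ℕ) : ℤ) + 1) / t)| ≤
      168 / g ^ 2 / t ^ 2 := by
  have h1 := h.level_shift n hτ htg (scaled_gap hg ht.le)
  have e1 : ∀ x y z : ℝ, z / (t * x - t * y) = -(z / (y - x)) / t := by
    intro x y z
    rw [← mul_sub, ← neg_sub y x, mul_neg, div_neg, neg_div, div_div, mul_comm t]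
  rw [div_div, ← mul_pow, mul_comm g t]
  refine le_trans (le_of_eq ?_) h1
  simp only [scaled, shiftC, e1, add_sub_cancel_right]
  congr 1
  ring

end Channel

end
end Nanotube

namespace Nanotube
noncomputable section

/-! ### The length and the position of the bands -/

theorem isBigO_prod_sub_one {ι : Type} (s : Finset ι) (f : ι → ℝ → ℝ)
    (hf : ∀ i ∈ s, (fun t => f i t - 1) =O[atTop] fun t : ℝ => 1 / t) :
    (fun t => ∏ i ∈ s, f i t - 1) =O[atTop] fun t : ℝ => 1 / t := by
  classical
  induction s using Finset.induction_on with
  | empty => simp only [Finset.prod_empty, sub_self]; exact isBigO_zero _ _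
  | insert i s hi ih =>
    have h1 := hf i (Finset.mem_insert_self _ _)
    have h2 := ih fun j hj => hf j (Finset.mem_insert_of_mem hj)
    have h0 : (fun t : ℝ => 1 / t) =O[atTop] fun _ => (1 : ℝ) := by
      simp only [one_div]
      exact tendsto_inv_atTop_zero.isBigO_one ℝ
    have h3 : (fun t => f i t) =O[atTop] fun _ : ℝ => (1 : ℝ) := by
      have := (h1.trans h0).add (isBigO_refl (fun _ : ℝ => (1 : ℝ)) atTop)
      simpa using this
    have h4 := h3.mul h2
    simp only [one_mul] at h4
    refine (h4.add h1).congr_left fun t => ?_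
    rw [Finset.prod_insert hi]
    ring

theorem eventually_div_lt (K : ℝ) {ε : ℝ} (hε : 0 < ε) : ∀ᶠ t : ℝ in atTop, K / t < ε :=
  (tendsto_const_nhds.div_atTop tendsto_id).eventually (gt_mem_nhds hε)

section Final

variable {N p : ℕ} {b : ℝ} {v : EllInfty} {k : ℕ} {g : ℝ}

/-- Taking `x = -1` and `x' = 1` in `level_sub_mul_prod` makes width times distances equal to `4 |2
c_k| ^ p`. Each of the `2p - 1` distances is `t |v_n - v_j|` up to a factor `1 + O(1/t)`. -/
theorem width_isBigO (hp : 2 ≤ p)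
    (hper : Function.Periodic (v : ℤ → ℝ) ((2 * p : ℕ) : ℤ)) (hg0 : 0 < g)
    (hg : ∀ i j : Fin (2 * p), i ≠ j → g ≤ |v ((i : ℕ) + 1) - v ((j : ℕ) + 1)|)
    (hc : cCoef N b k ≠ 0) (n : Fin (2 * p)) :
    (fun t : ℝ => |level (2 * p) (aCoef N b k) (scaled v t) n 1 -
        level (2 * p) (aCoef N b k) (scaled v t) n (-1)| *
        (widthE N p b v k n * t ^ (2 * p - 1)) - 1) =O[atTop] fun t : ℝ => 1 / t := by
  set L : Fin (2 * p) → ℝ → ℝ → ℝ := fun i x t => level (2 * p) (aCoef N b k) (scaled v t) i x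
    with hL
  have hev : ∀ᶠ t : ℝ in atTop, 0 < t ∧ SepJacobi (2 * p) (aCoef N b k) (scaled v t) ∧
      20 ≤ t * g := by
    filter_upwards [eventually_gt_atTop 0, eventually_ge_atTop (20 / g)] with t ht ht2
    have ht3 := (div_le_iff₀ hg0).1 ht2
    exact ⟨ht, sepJacobi_scaled N b k hp hper hg ht.le ht3, ht3⟩
  have m1 : (1 : ℝ) ∈ Icc (-1 : ℝ) 1 := by simp
  have m2 : (-1 : ℝ) ∈ Icc (-1 : ℝ) 1 := by simp
  have hfac : (fun t => ∏ j ∈ Finset.univ.erase n,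
      (t * |v ((n : ℕ) + 1) - v ((j : ℕ) + 1)| / |L n 1 t - L j (-1) t|) - 1)
      =O[atTop] fun t : ℝ => 1 / t := by
    refine isBigO_prod_sub_one _ _ fun j hj => ?_
    -- Distances of levels and of potentials differ by at most `8 = 4 + 4`. The relative error is at
    -- most `8 / (t g - 8)`, which is below `14 / (t g)` for `t g ≥ 20`.
    refine IsBigO.of_bound (14 / g) ?_
    filter_upwards [hev] with t ⟨ht, h, htg⟩
    have hne : n ≠ j := (Finset.ne_of_mem_erase hj).symm
    have a1 := (h.level_spec 1 m1 n).1
    have a2 := (h.level_spec (-1) m2 j).1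
    have a3 := scaled_gap hg ht.le n j hne
    have e1 : t * |v ((n : ℕ) + 1) - v ((j : ℕ) + 1)| =
        |scaled v t ((n : ℕ) + 1) - scaled v t ((j : ℕ) + 1)| := by
      rw [scaled, scaled, ← mul_sub, abs_mul, abs_of_pos ht]
    set D := L n 1 t - L j (-1) t with hD
    set d := scaled v t ((n : ℕ) + 1) - scaled v t ((j : ℕ) + 1) with hd
    have hDd : |d - D| ≤ 8 := by
      rw [abs_le]
      rw [abs_lt] at a1 a2
      constructor <;> simp only [hD, hd, hL] <;> linarith
    have hDl : t * g - 8 ≤ |D| := by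
      have := abs_sub_abs_le_abs_sub d D
      linarith
    have hDpos : 0 < |D| := by linarith
    rw [e1, div_sub_one hDpos.ne', Real.norm_eq_abs, abs_div, abs_abs, Real.norm_eq_abs,
      abs_of_pos (one_div_pos.2 ht), div_mul_div_comm, mul_one, div_le_div_iff₀ hDpos (by positivity)]
    have h8 : |(|d| - |D|)| ≤ 8 := (abs_abs_sub_abs_le_abs_sub d D).trans hDd
    nlinarith
  refine hfac.congr' ?_ EventuallyEq.rfl
  filter_upwards [hev] with t ⟨ht, h, htg⟩
  congr 1
  have h1 := congrArg abs (h.level_sub_mul_prod m2 m1 n)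
  rw [abs_mul, Finset.abs_prod, cycProd_aCoef, abs_of_nonneg
    (a := 2 * |2 * cCoef N b k| ^ p * (1 - -1)) (by norm_num)] at h1
  have hP : 0 < |2 * cCoef N b k| ^ p := by
    have : 2 * cCoef N b k ≠ 0 := mul_ne_zero two_ne_zero hc
    positivity
  have hcard : (Finset.univ.erase n).card = 2 * p - 1 := by
    rw [Finset.card_erase_of_mem (Finset.mem_univ _), Finset.card_univ, Fintype.card_fin]
  have hQ : 0 < ∏ j ∈ Finset.univ.erase n, |L n 1 t - L j (-1) t| := by
    refine Finset.prod_pos fun j hj => ?_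
    have := h.level_sub_far m1 m2 (Finset.ne_of_mem_erase hj).symm
    simp only [hL]
    linarith
  rw [Finset.prod_div_distrib, Finset.prod_mul_distrib, Finset.prod_const, hcard, widthE]
  rw [div_eq_iff hQ.ne']
  set P := |2 * cCoef N b k| ^ p
  set Q := ∏ j ∈ Finset.univ.erase n, |L n 1 t - L j (-1) t|
  set A := |level (2 * p) (aCoef N b k) (scaled v t) n 1 -
        level (2 * p) (aCoef N b k) (scaled v t) n (-1)|
  have h2 : A * Q = 4 * P := by
    rw [show A * Q = 2 * P * (1 - -1) from h1]; ring
  set R := ∏ j ∈ Finset.univ.erase n, |v ((n : ℕ) + 1) - v ((j : ℕ) + 1)|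
  calc t ^ (2 * p - 1) * R = (4 * P) * (1 / (4 * P) * R * t ^ (2 * p - 1)) := by
        field_simp
    _ = _ := by rw [← h2]; ring

theorem exists_succ_site (hp : 2 ≤ p)
    (hper : Function.Periodic (v : ℤ → ℝ) ((2 * p : ℕ) : ℤ)) (n : Fin (2 * p)) :
    ∃ m : Fin (2 * p), m ≠ n ∧ v ((m : ℕ) + 1) = v ((n : ℕ) + 2) := by
  have hn := n.2
  by_cases h : (n : ℕ) + 1 = 2 * p
  · refine ⟨⟨0, by omega⟩, fun e => ?_, ?_⟩
    · have := congrArg Fin.val e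
      simp only at this
      omega
    · have h1 := hper 1
      rw [show ((n : ℕ) : ℤ) + 2 = 1 + ((2 * p : ℕ) : ℤ) by omega, h1]
      simp
  · refine ⟨⟨n + 1, by omega⟩, fun e => ?_, ?_⟩
    · have := congrArg Fin.val e
      simp at this
    · exact congrArg (v : ℤ → ℝ) (by push_cast; ring)

theorem exists_pred_site (hp : 2 ≤ p)
    (hper : Function.Periodic (v : ℤ → ℝ) ((2 * p : ℕ) : ℤ)) (n : Fin (2 * p)) :
    ∃ m : Fin (2 * p), m ≠ n ∧ v ((m : ℕ) + 1) = v (n : ℕ) ∧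
      v ((m : ℕ) + 2) = v ((n : ℕ) + 1) := by
  have hn := n.2
  by_cases h : (n : ℕ) = 0
  · have e1 : ((2 * p - 1 : ℕ) : ℤ) = -1 + ((2 * p : ℕ) : ℤ) := by omega
    refine ⟨⟨2 * p - 1, by omega⟩, fun e => ?_, ?_, ?_⟩
    · have := congrArg Fin.val e
      simp only at this
      omega
    · rw [show ((2 * p - 1 : ℕ) : ℤ) + 1 = 0 + ((2 * p : ℕ) : ℤ) by omega, hper 0, h]
      simp
    · rw [show ((2 * p - 1 : ℕ) : ℤ) + 2 = 1 + ((2 * p : ℕ) : ℤ) by omega, hper 1, h]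
      simp
  · refine ⟨⟨n - 1, by omega⟩, fun e => ?_, ?_, ?_⟩
    · have := congrArg Fin.val e
      simp only at this
      omega
    · exact congrArg (v : ℤ → ℝ) (show (((n : ℕ) - 1 : ℕ) : ℤ) + 1 = (n : ℕ) by omega)
    · exact congrArg (v : ℤ → ℝ) (show (((n : ℕ) - 1 : ℕ) : ℤ) + 2 = (n : ℕ) + 1 by omega)

/-- Consecutive coefficients alternate between `1` and `2 |c_k|`, so exactly one of the two terms of
`shiftC` depends on `k`, and its denominator does not. -/
theorem shiftC_ne (hp : 2 ≤ p)
    (hper : Function.Periodic (v : ℤ → ℝ) ((2 * p : ℕ) : ℤ))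
    (hdist : Function.Injective (fun i : Fin (2 * p) => v (((i : ℕ) : ℤ) + 1)))
    {k' : ℕ} (h : |cCoef N b k| ≠ |cCoef N b k'|) (n : Fin (2 * p)) :
    shiftC N b v k (((n : ℕ) : ℤ) + 1) ≠ shiftC N b v k' (((n : ℕ) : ℤ) + 1) := by
  obtain ⟨m, hmn, hm, -⟩ := exists_pred_site hp hper n
  obtain ⟨l, hln, hl⟩ := exists_succ_site hp hper n
  have hne : (2 * |cCoef N b k|) ^ 2 ≠ (2 * |cCoef N b k'|) ^ 2 := by
    intro e
    rw [sq_eq_sq₀ (by positivity) (by positivity)] at e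
    exact h (by linarith)
  have h1 : v (n : ℕ) - v ((n : ℕ) + 1) ≠ 0 := by
    rw [← hm]; exact sub_ne_zero.2 (hdist.ne hmn)
  have h2 : v ((n : ℕ) + 2) - v ((n : ℕ) + 1) ≠ 0 := by
    rw [← hl]; exact sub_ne_zero.2 (hdist.ne hln)
  have e2 : ((n : ℕ) : ℤ) + 1 + 1 = (n : ℕ) + 2 := by ring
  unfold shiftC
  rw [add_sub_cancel_right, e2]
  by_cases he : Even ((n : ℕ) : ℤ)
  · have ho : ¬ Even (((n : ℕ) : ℤ) + 1) := by rw [Int.even_add_one]; exact not_not.2 he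
    simp only [aCoef, if_pos he, if_neg ho]
    intro e
    exact hne ((div_left_inj' h1).1 (add_right_cancel e))
  · simp only [aCoef, if_neg he, if_pos (Int.even_add_one.2 he)]
    intro e
    exact hne ((div_left_inj' h2).1 (add_left_cancel e))

/-- Of the two adjacent squared coefficients one is `1` and the other at most `4`. The bound is a
sum of total weight at most `5`, each term controlled by the hypothesis at `n` or at the cyclic
predecessor of `n`. -/
theorem abs_shiftC_lt (hp : 2 ≤ p)
    (hper : Function.Periodic (v : ℤ → ℝ) ((2 * p : ℕ) : ℤ)) {δ : ℝ}
    (hδ : ∀ n : Fin (2 * p), 5 / |v (((n : ℕ) : ℤ) + 1) - v (((n : ℕ) : ℤ) + 2)| < δ)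
    (n : Fin (2 * p)) :
    |shiftC N b v k (((n : ℕ) : ℤ) + 1)| < δ := by
  obtain ⟨m, -, hm, hm'⟩ := exists_pred_site hp hper n
  have h1 : 5 * |v (n : ℕ) - v ((n : ℕ) + 1)|⁻¹ < δ := by
    have := hδ m
    rwa [hm, hm', div_eq_mul_inv] at this
  have h2 : 5 * |v ((n : ℕ) + 2) - v ((n : ℕ) + 1)|⁻¹ < δ := by
    have := hδ n
    rwa [abs_sub_comm, div_eq_mul_inv] at this
  set x := |v (n : ℕ) - v ((n : ℕ) + 1)|⁻¹
  set y := |v ((n : ℕ) + 2) - v ((n : ℕ) + 1)|⁻¹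
  have hx : 0 ≤ x := inv_nonneg.2 (abs_nonneg _)
  have hy : 0 ≤ y := inv_nonneg.2 (abs_nonneg _)
  have e2 : ((n : ℕ) : ℤ) + 1 + 1 = (n : ℕ) + 2 := by ring
  have hC : |shiftC N b v k (((n : ℕ) : ℤ) + 1)| ≤
      aCoef N b k (n : ℕ) ^ 2 * x + aCoef N b k ((n : ℕ) + 1) ^ 2 * y := by
    unfold shiftC
    rw [add_sub_cancel_right, e2]
    refine (abs_add_le _ _).trans (le_of_eq ?_)
    rw [abs_div, abs_div, abs_sq, abs_sq, div_eq_mul_inv, div_eq_mul_inv]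
  have hc : (2 * |cCoef N b k|) ^ 2 ≤ 4 := by
    have h3 : |cCoef N b k| ≤ 1 := Real.abs_cos_le_one _
    have h4 := abs_nonneg (cCoef N b k)
    nlinarith
  refine hC.trans_lt ?_
  unfold aCoef
  by_cases he : Even ((n : ℕ) : ℤ)
  · rw [if_pos he, if_neg (by rw [Int.even_add_one]; exact not_not.2 he), one_pow]
    nlinarith [mul_le_mul_of_nonneg_right hc hx]
  · rw [if_neg he, if_pos (Int.even_add_one.2 he), one_pow]
    nlinarith [mul_le_mul_of_nonneg_right hc hy]

end Final

end
end Nanotube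

namespace Nanotube
noncomputable section

/-! ### The clusters -/

section Bands

variable {N p : ℕ} {b : ℝ} {v : EllInfty} {k : ℕ} {g t : ℝ} {α : Equiv.Perm (Fin (2 * p))}

theorem abs_sub_lt_of_mem_band (h : SepJacobi (2 * p) (aCoef N b k) (scaled v t)) (ht : 0 < t)
    (hα : StrictMono (fun i : Fin (2 * p) => v (((α i : ℕ) : ℤ) + 1))) {n : Fin (2 * p)} {x : ℝ}
    (hx : x ∈ band N p b v t k (α.symm n)) : |x - t * v ((n : ℕ) + 1)| < 4 := by
  rw [band_eq_uIcc h ht α hα, ← h.range_levelC] at hx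
  obtain ⟨θ, rfl⟩ := hx
  exact (h.level_spec _ (circCos_mem θ) n).1

theorem abs_sub_le_of_mem_band (h : SepJacobi (2 * p) (aCoef N b k) (scaled v t)) (ht : 0 < t)
    (hg : ∀ i j : Fin (2 * p), i ≠ j → g ≤ |v ((i : ℕ) + 1) - v ((j : ℕ) + 1)|)
    (htg : 20 ≤ t * g)
    (hα : StrictMono (fun i : Fin (2 * p) => v (((α i : ℕ) : ℤ) + 1))) {n : Fin (2 * p)} {x : ℝ}
    (hx : x ∈ band N p b v t k (α.symm n)) :
    |x - (t * v (((n : ℕ) : ℤ) + 1) - shiftC N b v k (((n : ℕ) : ℤ) + 1) / t)| ≤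
      168 / g ^ 2 / t ^ 2 := by
  have h1 := level_asymptotic h ht hg htg n (Or.inl rfl)
  have h2 := level_asymptotic h ht hg htg n (Or.inr rfl)
  rw [← Real.dist_eq, ← Metric.mem_closedBall] at h1 h2 ⊢
  rw [band_eq_uIcc h ht α hα] at hx
  rw [Real.closedBall_eq_Icc] at h1 h2 ⊢
  exact ordConnected_Icc.uIcc_subset h2 h1 hx

/-- Consecutive values `t v_{α(i)}` differ by at least `20`, so the midpoints bounding the intervals
are at distance at least `10` from them, beyond the window of radius `4`. -/
theorem mem_clusterInterval_iff (ht : 0 < t)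
    (hg : ∀ i j : Fin (2 * p), i ≠ j → g ≤ |v ((i : ℕ) + 1) - v ((j : ℕ) + 1)|)
    (htg : 20 ≤ t * g)
    (hα : StrictMono (fun i : Fin (2 * p) => v (((α i : ℕ) : ℤ) + 1))) {n n' : Fin (2 * p)} {x : ℝ}
    (hx : |x - t * v ((n' : ℕ) + 1)| < 4) :
    x ∈ clusterInterval p v α t (α.symm n) ↔ n = n' := by
  obtain ⟨m, rfl⟩ := α.surjective n
  obtain ⟨j, rfl⟩ := α.surjective n'
  rw [α.symm_apply_apply, α.injective.eq_iff]
  have hmono : ∀ i i' : Fin (2 * p), i < i' →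
      t * v ((α i : ℕ) + 1) + 20 ≤ t * v ((α i' : ℕ) + 1) := by
    intro i i' hii
    have h1 := scaled_gap hg ht.le (α i) (α i') (α.injective.ne hii.ne)
    have h2 : scaled v t ((α i : ℕ) + 1) < scaled v t ((α i' : ℕ) + 1) :=
      mul_lt_mul_of_pos_left (hα hii) ht
    rw [abs_of_neg (by linarith)] at h1
    simp only [scaled] at h1
    linarith
  rw [abs_lt] at hx
  constructor
  · rintro ⟨h1, h2⟩
    by_contra hne
    rcases lt_or_gt_of_ne hne with hmj | hmj
    · have hm : (m : ℕ) + 1 < 2 * p := by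
        have := j.2
        have : (m : ℕ) < j := hmj
        omega
      have h3 := h2 ⟨m + 1, hm⟩ rfl
      have h4 := hmono m ⟨m + 1, hm⟩ (Fin.lt_def.2 (Nat.lt_succ_self _))
      have h5 : t * v ((α ⟨m + 1, hm⟩ : ℕ) + 1) ≤ t * v ((α j : ℕ) + 1) :=
        mul_le_mul_of_nonneg_left (hα.monotone (Fin.le_def.2 hmj)) ht.le
      linarith
    · have h0 : (j : ℕ) < m := hmj
      have hm : (m : ℕ) - 1 < 2 * p := by have := m.2; omega
      have h3 := h1 ⟨m - 1, hm⟩ (show (m : ℕ) - 1 + 1 = m by omega)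
      have h4 := hmono ⟨m - 1, hm⟩ m (Fin.lt_def.2 (show (m : ℕ) - 1 < m by omega))
      have h5 : t * v ((α j : ℕ) + 1) ≤ t * v ((α ⟨m - 1, hm⟩ : ℕ) + 1) :=
        mul_le_mul_of_nonneg_left (hα.monotone (Fin.le_def.2
          (show (j : ℕ) ≤ (m : ℕ) - 1 by omega))) ht.le
      linarith
  · rintro rfl
    refine ⟨fun i hi => ?_, fun i hi => ?_⟩
    · have := hmono i m (Fin.lt_def.2 (by omega))
      linarith
    · have := hmono m i (Fin.lt_def.2 (by omega))
      linarith

/-- Two bands lie within `168 / g ^ 2 / t ^ 2` of centres that are `|C - C'| / t` apart. The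
constant `336` is the sum of the two radii before division by `g ^ 2 t ^ 2`. -/
theorem disjoint_band (h : ∀ k, SepJacobi (2 * p) (aCoef N b k) (scaled v t)) (ht : 0 < t)
    (hg : ∀ i j : Fin (2 * p), i ≠ j → g ≤ |v ((i : ℕ) + 1) - v ((j : ℕ) + 1)|)
    (htg : 20 ≤ t * g)
    (hα : StrictMono (fun i : Fin (2 * p) => v (((α i : ℕ) : ℤ) + 1))) (n : Fin (2 * p)) {k' : ℕ}
    (hC : 336 / g ^ 2 / t <
      |shiftC N b v k (((n : ℕ) : ℤ) + 1) - shiftC N b v k' (((n : ℕ) : ℤ) + 1)|) :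
    Disjoint (band N p b v t k (α.symm n)) (band N p b v t k' (α.symm n)) := by
  rw [Set.disjoint_left]
  intro x hx hx'
  have h1 := abs_sub_le_of_mem_band (h k) ht hg htg hα hx
  have h2 := abs_sub_le_of_mem_band (h k') ht hg htg hα hx'
  set A := shiftC N b v k (((n : ℕ) : ℤ) + 1)
  set A' := shiftC N b v k' (((n : ℕ) : ℤ) + 1)
  set w := t * v (((n : ℕ) : ℤ) + 1)
  have h3 : |A - A'| / t ≤ 336 / g ^ 2 / t ^ 2 := by
    have h4 : A / t - A' / t = (x - (w - A / t)) - (x - (w - A' / t)) := by ring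
    rw [← abs_of_pos ht, ← abs_div, abs_of_pos ht, sub_div, h4]
    refine (abs_sub _ _).trans ?_
    have : 336 / g ^ 2 / t ^ 2 = 168 / g ^ 2 / t ^ 2 + 168 / g ^ 2 / t ^ 2 := by ring
    linarith
  have h5 : 336 / g ^ 2 / t ^ 2 = 336 / g ^ 2 / t / t := by rw [div_div _ t t, sq t]
  rw [h5, div_le_div_iff_of_pos_right ht] at h3
  linarith

theorem band_subset_Ioo (h : SepJacobi (2 * p) (aCoef N b k) (scaled v t)) (ht : 0 < t)
    (hg : ∀ i j : Fin (2 * p), i ≠ j → g ≤ |v ((i : ℕ) + 1) - v ((j : ℕ) + 1)|)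
    (htg : 20 ≤ t * g)
    (hα : StrictMono (fun i : Fin (2 * p) => v (((α i : ℕ) : ℤ) + 1))) (n : Fin (2 * p)) {δ : ℝ}
    (hC : 168 / g ^ 2 / t < δ - |shiftC N b v k (((n : ℕ) : ℤ) + 1)|) :
    band N p b v t k (α.symm n) ⊆
      Ioo (v (((n : ℕ) : ℤ) + 1) * t - δ / t) (v (((n : ℕ) : ℤ) + 1) * t + δ / t) := by
  intro x hx
  have h1 := abs_sub_le_of_mem_band h ht hg htg hα hx
  set A := shiftC N b v k (((n : ℕ) : ℤ) + 1)
  set w := v (((n : ℕ) : ℤ) + 1)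
  have h2 : |x - t * w| ≤ 168 / g ^ 2 / t ^ 2 + |A| / t := by
    have e : x - t * w = (x - (t * w - A / t)) - A / t := by ring
    rw [e]
    refine (abs_sub _ _).trans ?_
    rw [abs_div, abs_of_pos ht]
    linarith
  have h5 : 168 / g ^ 2 / t ^ 2 = 168 / g ^ 2 / t / t := by rw [div_div _ t t, sq t]
  have h6 : |x - t * w| < δ / t := by
    refine h2.trans_lt ?_
    rw [h5, ← add_div, div_lt_div_iff_of_pos_right ht]
    linarith
  rw [abs_lt] at h6
  constructor <;> linarith

/-! ### Spectrum, multiplicity and flat bands of the Hamiltonian. -/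

section Spectrum

variable [NeZero N] [NeZero (2 * p)]

/-- The diagonalization of the nanotube Hamiltonian by the channels. -/
def nanotubeModel (h : ∀ k, SepJacobi (2 * p) (aCoef N b k) (scaled v t)) :
    DiagModel (hamiltonian N b v t) (Finset.Icc 1 N × Fin (2 * p)) :=
  tubeModel N b v t fun k => channelModel (h k)

theorem nanotubeModel_lam (h : ∀ k, SepJacobi (2 * p) (aCoef N b k) (scaled v t))
    (x : Finset.Icc 1 N × Fin (2 * p)) :
    (nanotubeModel h).lam x = (h x.1).levelC x.2 := rfl

theorem realSpectrum_inter_clusterInterval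
    (h : ∀ k, SepJacobi (2 * p) (aCoef N b k) (scaled v t)) (ht : 0 < t)
    (hg : ∀ i j : Fin (2 * p), i ≠ j → g ≤ |v ((i : ℕ) + 1) - v ((j : ℕ) + 1)|)
    (htg : 20 ≤ t * g)
    (hα : StrictMono (fun i : Fin (2 * p) => v (((α i : ℕ) : ℤ) + 1))) (n : Fin (2 * p)) :
    realSpectrum (hamiltonian N b v t) ∩ clusterInterval p v α t (α.symm n) =
      ⋃ k ∈ Finset.Icc 1 N, band N p b v t k (α.symm n) := by
  rw [(nanotubeModel h).realSpectrum_eq]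
  ext x
  simp only [mem_inter_iff, mem_iUnion, exists_prop]
  constructor
  · rintro ⟨⟨⟨k, n'⟩, θ, rfl⟩, hx⟩
    obtain rfl := (mem_clusterInterval_iff ht hg htg hα
      ((h k).level_spec _ (circCos_mem θ) n').1).1 hx
    refine ⟨k, k.2, ?_⟩
    rw [band_eq_uIcc (h k) ht α hα, ← (h k).range_levelC]
    exact ⟨θ, rfl⟩
  · rintro ⟨k, hk, hx⟩
    refine ⟨⟨(⟨k, hk⟩, n), ?_⟩, ?_⟩
    · rw [nanotubeModel_lam, (h k).range_levelC, ← band_eq_uIcc (h k) ht α hα]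
      exact hx
    · exact (mem_clusterInterval_iff ht hg htg hα
        (abs_sub_lt_of_mem_band (h k) ht hα hx)).2 rfl

/-- Channels with equal `|c_k|` have identical Jacobi coefficients, hence the same band function.
Every other band misses this one, either by `hdisj` at the same site or by the separation of sites.
-/
theorem hasSpectralMultiplicity_band
    (h : ∀ k, SepJacobi (2 * p) (aCoef N b k) (scaled v t)) (ht : 0 < t)
    (hα : StrictMono (fun i : Fin (2 * p) => v (((α i : ℕ) : ℤ) + 1))) (n : Fin (2 * p))
    (hc : cCoef N b k ≠ 0)
    (hdisj : ∀ k' ∈ Finset.Icc 1 N, |cCoef N b k| ≠ |cCoef N b k'| →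
      Disjoint (band N p b v t k (α.symm n)) (band N p b v t k' (α.symm n))) :
    HasSpectralMultiplicity (hamiltonian N b v t) (band N p b v t k (α.symm n))
      (2 * Set.ncard {k' : ℕ | k' ∈ Finset.Icc 1 N ∧ |cCoef N b k'| = |cCoef N b k|}) := by
  classical
  set J : Finset (Finset.Icc 1 N × Fin (2 * p)) :=
    Finset.univ.filter fun x => x.2 = n ∧ |cCoef N b x.1| = |cCoef N b k| with hJ
  have hcard : Set.ncard {k' : ℕ | k' ∈ Finset.Icc 1 N ∧ |cCoef N b k'| = |cCoef N b k|} =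
      J.card := by
    rw [← Finset.coe_filter, Set.ncard_coe_finset]
    symm
    refine Finset.card_bij (fun x _ => (x.1 : ℕ)) ?_ ?_ ?_
    · intro x hx
      exact Finset.mem_filter.2 ⟨x.1.2, (Finset.mem_filter.1 hx).2.2⟩
    · rintro ⟨x, i⟩ hx ⟨y, j⟩ hy hxy
      have h1 : i = n := (Finset.mem_filter.1 hx).2.1
      have h2 : j = n := (Finset.mem_filter.1 hy).2.1
      have h3 : x = y := Subtype.ext hxy
      rw [h1, h2, h3]
    · intro k' hk'
      rw [Finset.mem_filter] at hk'
      exact ⟨(⟨k', hk'.1⟩, n), Finset.mem_filter.2 ⟨Finset.mem_univ _, rfl, hk'.2⟩, rfl⟩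
  have hP : cycProd (2 * p) (aCoef N b k) ≠ 0 := by
    rw [cycProd_aCoef]
    exact pow_ne_zero _ (abs_ne_zero.2 (mul_ne_zero two_ne_zero hc))
  have hband : ∀ k' (i : Fin (2 * p)) θ, (h k').levelC i θ ∈ band N p b v t k' (α.symm i) := by
    intro k' i θ
    rw [band_eq_uIcc (h k') ht α hα, ← (h k').range_levelC]
    exact ⟨θ, rfl⟩
  rw [hcard]
  refine (nanotubeModel h).hasSpectralMultiplicity _ _ J ((h k).levelC n) ?_ (hband k n) ?_ ?_
    (fun z => 1 + (cycMatrix (2 * p) (aCoef N b k) (scaled v t) 1).charpoly.eval z /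
      (2 * cycProd (2 * p) (aCoef N b k))) ?_ ((h k).circCos_eq_of_level hP n)
  · rintro ⟨k', i⟩ hx
    obtain ⟨h1, h2⟩ := (Finset.mem_filter.1 hx).2
    simp only at h1 h2
    subst h1
    ext θ
    rw [nanotubeModel_lam, SepJacobi.levelC_apply, SepJacobi.levelC_apply, aCoef_congr h2]
  · rintro ⟨k', i⟩ hx θ hmem
    have hmem' : (h k').levelC i θ ∈ band N p b v t k (α.symm n) := hmem
    by_cases hin : i = n
    · subst hin
      refine Set.disjoint_left.1 (hdisj k' k'.2 fun e => hx ?_) hmem' (hband k' i θ)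
      exact Finset.mem_filter.2 ⟨Finset.mem_univ _, rfl, e.symm⟩
    · have h1 := abs_lt.1 (abs_sub_lt_of_mem_band (h k) ht hα hmem')
      have h2 := abs_lt.1 (abs_sub_lt_of_mem_band (h k') ht hα (hband k' i θ))
      have h3 := (h k).sep i n hin
      rw [scaled, scaled, le_abs] at h3
      rcases h3 with h3 | h3 <;> linarith
  · intro θ
    rw [SepJacobi.levelC_apply, SepJacobi.levelC_apply, circCos_neg]
  · exact (measurable_const.add ((Polynomial.continuous _).measurable.div_const _))

/-- A vanishing coefficient makes `cycProd` zero, so the Lipschitz bound of `abs_level_sub_le` says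
that the level does not depend on the quasi-momentum. -/
theorem isFlatBand_band
    (h : ∀ k, SepJacobi (2 * p) (aCoef N b k) (scaled v t)) (ht : 0 < t)
    (hα : StrictMono (fun i : Fin (2 * p) => v (((α i : ℕ) : ℤ) + 1))) (n : Fin (2 * p))
    (hk : k ∈ Finset.Icc 1 N) (hc : cCoef N b k = 0) :
    IsFlatBand (jacobi N b v t k) (band N p b v t k (α.symm n)) ∧
      IsFlatBand (hamiltonian N b v t) (band N p b v t k (α.symm n)) := by
  have hp : p ≠ 0 := by
    rintro rfl
    exact NeZero.ne (2 * 0) rfl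
  have hP : cycProd (2 * p) (aCoef N b k) = 0 := by
    rw [cycProd_aCoef, hc, mul_zero, abs_zero, zero_pow hp]
  have h1 : (1 : ℝ) ∈ Icc (-1 : ℝ) 1 := by simp
  have hconst : ∀ x ∈ Icc (-1 : ℝ) 1, level (2 * p) (aCoef N b k) (scaled v t) n x =
      level (2 * p) (aCoef N b k) (scaled v t) n 1 := by
    intro x hx
    have := (h k).abs_level_sub_le h1 hx n
    rw [hP, mul_zero, zero_mul] at this
    exact sub_eq_zero.1 (abs_nonpos_iff.1 this)
  have hS : band N p b v t k (α.symm n) =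
      {level (2 * p) (aCoef N b k) (scaled v t) n 1} := by
    rw [band_eq_uIcc (h k) ht α hα, hconst (-1) (by simp), uIcc_self]
  have hlam : ∀ θ, (h k).levelC n θ = level (2 * p) (aCoef N b k) (scaled v t) n 1 := fun θ =>
    hconst _ (circCos_mem θ)
  exact ⟨⟨_, hS, (channelModel (h k)).infinite_eigenspace n _ hlam⟩,
    ⟨_, hS, (nanotubeModel h).infinite_eigenspace (⟨k, hk⟩, n) _ hlam⟩⟩

end Spectrum

end Bands

end
end Nanotube

/-! ### Assembly of the claims at large coupling. -/

theorem theorem4 (N p : ℕ) (hN : 1 ≤ N) (hp : 2 ≤ p) (b : ℝ) (v : Nanotube.EllInfty)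
    (hper : Function.Periodic (v : ℤ → ℝ) ((2 * p : ℕ) : ℤ))
    (hdist : Function.Injective (fun i : Fin (2 * p) => v (((i : ℕ) : ℤ) + 1)))
    (α : Equiv.Perm (Fin (2 * p)))
    (hα : StrictMono (fun i : Fin (2 * p) => v (((α i : ℕ) : ℤ) + 1))) :
    -- position and length of the bands
    (∀ k ∈ Finset.Icc 1 N, Nanotube.cCoef N b k ≠ 0 → ∀ n : Fin (2 * p),
      (fun t : ℝ => Nanotube.bandLeft N p b v t k (α.symm n) -
          (t * v (((n : ℕ) : ℤ) + 1) - Nanotube.shiftC N b v k (((n : ℕ) : ℤ) + 1) / t))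
        =O[Filter.atTop] (fun t : ℝ => 1 / t ^ 2) ∧
      (fun t : ℝ => (Nanotube.bandRight N p b v t k (α.symm n) -
            Nanotube.bandLeft N p b v t k (α.symm n)) *
          (Nanotube.widthE N p b v k n * t ^ (2 * p - 1)) - 1)
        =O[Filter.atTop] (fun t : ℝ => 1 / t)) ∧
    -- the clusters
    (∀ᶠ t : ℝ in Filter.atTop, ∀ n : Fin (2 * p),
      Nanotube.realSpectrum (Nanotube.hamiltonian N b v t) ∩
          Nanotube.clusterInterval p v α t (α.symm n) =
        ⋃ k ∈ Finset.Icc 1 N, Nanotube.band N p b v t k (α.symm n)) ∧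
    (∀ δ : ℝ,
      ((∀ k ∈ Finset.Icc 1 N, ∀ n : Fin (2 * p),
          |Nanotube.shiftC N b v k (((n : ℕ) : ℤ) + 1)| < δ) ∨
        (∀ n : Fin (2 * p),
          5 / |v (((n : ℕ) : ℤ) + 1) - v (((n : ℕ) : ℤ) + 2)| < δ)) →
      ∀ᶠ t : ℝ in Filter.atTop, ∀ n : Fin (2 * p),
        (⋃ k ∈ Finset.Icc 1 N, Nanotube.band N p b v t k (α.symm n)) ⊆
          Set.Ioo (v (((n : ℕ) : ℤ) + 1) * t - δ / t) (v (((n : ℕ) : ℤ) + 1) * t + δ / t)) ∧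
    -- disjointness, multiplicity and flat bands
    (∀ᶠ t : ℝ in Filter.atTop, ∀ k ∈ Finset.Icc 1 N, ∀ n : Fin (2 * p),
      (∀ k' ∈ Finset.Icc 1 N,
        ((k ≠ k' ∧ ∀ m : ℤ, b ≠ Real.pi / (2 * N) * m) ∨
          |Nanotube.cCoef N b k| ≠ |Nanotube.cCoef N b k'|) →
        Disjoint (Nanotube.band N p b v t k (α.symm n))
          (Nanotube.band N p b v t k' (α.symm n))) ∧
      (Nanotube.cCoef N b k ≠ 0 →
        Nanotube.HasSpectralMultiplicity (Nanotube.hamiltonian N b v t)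
          (Nanotube.band N p b v t k (α.symm n))
          (2 * Set.ncard {k' : ℕ | k' ∈ Finset.Icc 1 N ∧
            |Nanotube.cCoef N b k'| = |Nanotube.cCoef N b k|})) ∧
      (Nanotube.cCoef N b k ≠ 0 → (∀ m : ℤ, b ≠ Real.pi / (2 * N) * m) →
        Nanotube.HasSpectralMultiplicity (Nanotube.hamiltonian N b v t)
          (Nanotube.band N p b v t k (α.symm n)) 2) ∧
      (Nanotube.cCoef N b k = 0 →
        Nanotube.IsFlatBand (Nanotube.jacobi N b v t k)
            (Nanotube.band N p b v t k (α.symm n)) ∧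
          Nanotube.IsFlatBand (Nanotube.hamiltonian N b v t)
            (Nanotube.band N p b v t k (α.symm n)))) := by
  have hN' : NeZero N := ⟨by omega⟩
  have hp' : NeZero (2 * p) := ⟨by omega⟩
  obtain ⟨g, hg0, hg⟩ := Nanotube.exists_gap v p hdist
  have hev : ∀ᶠ t : ℝ in atTop, 0 < t ∧ 20 ≤ t * g ∧
      ∀ k, Nanotube.SepJacobi (2 * p) (Nanotube.aCoef N b k) (Nanotube.scaled v t) := by
    filter_upwards [eventually_gt_atTop 0, eventually_ge_atTop (20 / g)] with t ht ht2
    have ht3 := (div_le_iff₀ hg0).1 ht2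
    exact ⟨ht, ht3, fun k => Nanotube.sepJacobi_scaled N b k hp hper hg ht.le ht3⟩
  refine ⟨fun k _ hc n => ⟨?_, ?_⟩, ?_, fun δ hδ => ?_, ?_⟩
  · refine IsBigO.of_bound (168 / g ^ 2) ?_
    filter_upwards [hev] with t ⟨ht, htg, h⟩
    rw [Real.norm_eq_abs, Real.norm_eq_abs, abs_of_pos (by positivity : 0 < 1 / t ^ 2), mul_one_div]
    refine Nanotube.abs_sub_le_of_mem_band (h k) ht hg htg hα ?_
    obtain ⟨h1, h2⟩ := Nanotube.bandLeft_bandRight (h k) ht α hα n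
    refine Set.left_mem_Icc.2 ?_
    rw [h1, h2]
    exact min_le_max
  · refine (Nanotube.width_isBigO hp hper hg0 hg hc n).congr' ?_ EventuallyEq.rfl
    filter_upwards [hev] with t ⟨ht, htg, h⟩
    obtain ⟨h1, h2⟩ := Nanotube.bandLeft_bandRight (h k) ht α hα n
    rw [h1, h2, max_sub_min_eq_abs, abs_sub_comm]
  · filter_upwards [hev] with t ⟨ht, htg, h⟩ n
    exact Nanotube.realSpectrum_inter_clusterInterval h ht hg htg hα n
  · have hδ' : ∀ k ∈ Finset.Icc 1 N, ∀ n : Fin (2 * p),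
        |Nanotube.shiftC N b v k (((n : ℕ) : ℤ) + 1)| < δ := by
      rcases hδ with hδ | hδ
      · exact hδ
      · exact fun k _ n => Nanotube.abs_shiftC_lt hp hper hδ n
    have hfar : ∀ᶠ t : ℝ in atTop, ∀ k ∈ Finset.Icc 1 N, ∀ n : Fin (2 * p),
        168 / g ^ 2 / t < δ - |Nanotube.shiftC N b v k (((n : ℕ) : ℤ) + 1)| :=
      (eventually_all_finset _).2 fun k hk => eventually_all.2 fun n =>
        Nanotube.eventually_div_lt _ (sub_pos.2 (hδ' k hk n))
    filter_upwards [hev, hfar] with t ⟨ht, htg, h⟩ hC n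
    exact iUnion₂_subset fun k hk => Nanotube.band_subset_Ioo (h k) ht hg htg hα n (hC k hk n)
  -- There are finitely many channels and sites, so one threshold for `t` makes the error smaller
  -- than every nonzero difference of shift constants.
  · have hfar : ∀ᶠ t : ℝ in atTop, ∀ k ∈ Finset.Icc 1 N, ∀ k' ∈ Finset.Icc 1 N,
        ∀ n : Fin (2 * p), |Nanotube.cCoef N b k| ≠ |Nanotube.cCoef N b k'| →
        336 / g ^ 2 / t < |Nanotube.shiftC N b v k (((n : ℕ) : ℤ) + 1) -
          Nanotube.shiftC N b v k' (((n : ℕ) : ℤ) + 1)| :=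
      (eventually_all_finset _).2 fun k _ => (eventually_all_finset _).2 fun k' _ =>
        eventually_all.2 fun n => eventually_imp_distrib_left.2 fun hne =>
          Nanotube.eventually_div_lt _
            (abs_pos.2 (sub_ne_zero.2 (Nanotube.shiftC_ne hp hper hdist hne n)))
    filter_upwards [hev, hfar] with t ⟨ht, htg, h⟩ hC k hk n
    have hdisj : ∀ k' ∈ Finset.Icc 1 N, |Nanotube.cCoef N b k| ≠ |Nanotube.cCoef N b k'| →
        Disjoint (Nanotube.band N p b v t k (α.symm n))
          (Nanotube.band N p b v t k' (α.symm n)) := fun k' hk' hne =>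
      Nanotube.disjoint_band h ht hg htg hα n (hC k hk k' hk' n hne)
    have hmult : Nanotube.cCoef N b k ≠ 0 → _ := fun hc =>
      Nanotube.hasSpectralMultiplicity_band h ht hα n hc hdisj
    refine ⟨fun k' hk' hne => hdisj k' hk' ?_, hmult, fun hc hb => ?_, fun hc =>
      Nanotube.isFlatBand_band h ht hα n hk hc⟩
    · rcases hne with ⟨hne, hb⟩ | hne
      · exact Nanotube.abs_cCoef_ne hN hb hk hk' hne
      · exact hne
    · have hset : {k' : ℕ | k' ∈ Finset.Icc 1 N ∧
          |Nanotube.cCoef N b k'| = |Nanotube.cCoef N b k|} = {k} := by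
        ext k'
        refine ⟨fun hk' => ?_, fun hk' => ?_⟩
        · by_contra hne
          exact Nanotube.abs_cCoef_ne hN hb hk'.1 hk hne hk'.2
        · obtain rfl : k' = k := hk'
          exact ⟨hk, rfl⟩
      have h2 := hmult hc
      rwa [hset, Set.ncard_singleton] at h2
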